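/- Work in either the $C^\infty$ or the $C^\omega$ category. A germ at $p\in\mathbb R^{11}$ of a rank-3 distribution $D$ \emph{generates a special 2-flag of length 4} if the consecutive Lie squares $D=D^4\subset D^3\subset D^2\subset D^1\subset D^0=T\mathbb R^{11}$, $D^{j-1}=[D^j,D^j]$, are distributions of ranks $3,5,7,9,11$; for $j=1,2,3$ the Cauchy characteristics $L(D^j)=\{X\in D^j : [X,D^j]\subset D^j\}$ form a regular corank-one subdistribution of $D^{j+1}$, while $L(D^4)=0$; and $D^1$ has an involutive corank-one subdistribution $F$ (which is then unique, the covariant subdistribution of $D^1$). It belongs to the \emph{class 1.2.1.1} if $D^2(p)\subset F(p)$, $D^3(p)\not\subset L(D^1)(p)$ and $D^4(p)\not\subset L(D^2)(p)$. The small growth vector of $D$ at $p$ is the sequence of dimensions at $p$ of $V_1=D$, $V_{i+1}=V_i+[D,V_i]$. The germ is \emph{strongly nilpotent} if it is equivalent, by a local diffeomorphism sending $p$ to $0$, to its nilpotent approximation, i.e. the germ at $0$ of the distribution spanned by the terms of weight $-1$ of local generators of $D$ written in adapted coordinates $z_1,\dots,z_{11}$ centred at $p$ (the nonholonomic order of $z_i$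 equals its weight $w_i$, the least $s\ge 1$ with $\dim V_s(p)\ge i$). Let $E(b,c,B,C)$ denote the germ at $0\in\mathbb R^{11}(t,x_1,y_1,\dots,x_5,y_5)$ of the distribution $$dx_1-x_2dt=dy_1-y_2dt=0,\quad dt-x_3dx_2=dy_2-y_3dx_2=0,$$ $$dx_3-(b+x_4)dx_2=dy_3-(c+y_4)dx_2=0,\quad dx_4-(B+x_5)dx_2=dy_4-(C+y_5)dx_2=0.$$ \textbf{Proposition.} The class 1.2.1.1 is the disjoint union of the parts $10_1$, $10_2$, $10_3$ consisting of its germs with small growth vector $[3,5,7,9,10,11]$, $[3,5,7,9,10,10,11]$ and $[3,5,7,9,10,10,10,11]$, respectively. A germ of the class lies in $10_1$ iff it is equivalent to some $E(b,c,B,C)$ with $(b,c)\neq(0,0)$; in $10_2$ iff it is equivalent to some $E(0,0,B,C)$ with $(B,C)\neq(0,0)$; in $10_3$ iff it is equivalent to $E(0,0,0,0)$. Every germ in $10_3$ is strongly nilpotent. No germ in $10_1$ or $10_2$ is strongly nilpotent. -/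

import Mathlib

open Filter Topology
open scoped ContDiff

/-! Germs of distributions on `ℝ^N`, written `Fin N → ℝ`.  The order of smoothness `n` is `∞`
(smooth category) or `ω` (analytic category).  A distribution is a map `x ↦ D x` into the linear
subspaces of `ℝ^N`; only its behaviour near the reference point matters. -/

/-- `f` is of class `C^n` in a whole neighbourhood of `p`. -/
def SmoothNear (n : WithTop ℕ∞) {N M : ℕ} (f : (Fin N → ℝ) → (Fin M → ℝ)) (p : Fin N → ℝ) : Prop :=
  ∀ᶠ x in 𝓝 p, ContDiffAt ℝ n f x

/-- `X` is a local section near `p` of the distribution `D`. -/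
def IsSection (n : WithTop ℕ∞) {N : ℕ} (D : (Fin N → ℝ) → Submodule ℝ (Fin N → ℝ))
    (p : Fin N → ℝ) (X : (Fin N → ℝ) → (Fin N → ℝ)) : Prop :=
  SmoothNear n X p ∧ ∀ᶠ x in 𝓝 p, X x ∈ D x

/-- The fields `X 0, …, X (m-1)` are, near `p`, a local basis of sections of `D`. -/
def IsFrame (n : WithTop ℕ∞) {N m : ℕ} (D : (Fin N → ℝ) → Submodule ℝ (Fin N → ℝ))
    (p : Fin N → ℝ) (X : Fin m → (Fin N → ℝ) → (Fin N → ℝ)) : Prop :=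
  (∀ i, SmoothNear n (X i) p) ∧
    ∀ᶠ x in 𝓝 p, LinearIndependent ℝ (fun i => X i x) ∧
      D x = Submodule.span ℝ (Set.range fun i => X i x)

/-- `D` is, near `p`, a (regular) distribution of rank `m`. -/
def IsDistribution (n : WithTop ℕ∞) {N : ℕ} (m : ℕ) (D : (Fin N → ℝ) → Submodule ℝ (Fin N → ℝ))
    (p : Fin N → ℝ) : Prop :=
  ∃ X : Fin m → (Fin N → ℝ) → (Fin N → ℝ), IsFrame n D p X

/-- The Lie square `[D, D]`: at `x`, the span of `D x` and of the values at `x` of the Lie brackets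
of local sections of `D`. -/
def lieSquare (n : WithTop ℕ∞) {N : ℕ} (D : (Fin N → ℝ) → Submodule ℝ (Fin N → ℝ)) :
    (Fin N → ℝ) → Submodule ℝ (Fin N → ℝ) := fun x =>
  D x ⊔ Submodule.span ℝ {v | ∃ X Y, IsSection n D x X ∧ IsSection n D x Y ∧
    v = VectorField.lieBracket ℝ X Y x}

/-- The member `D^j` (`j ≤ r`) of the tower of consecutive Lie squares of `D = D^r`, so that
`D^(j-1) = [D^j, D^j]`. -/
def bigFlag (n : WithTop ℕ∞) {N : ℕ} (r : ℕ) (D : (Fin N → ℝ) → Submodule ℝ (Fin N → ℝ)) (j : ℕ) :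
    (Fin N → ℝ) → Submodule ℝ (Fin N → ℝ) :=
  (lieSquare n)^[r - j] D

/-- The Cauchy characteristics `L(D)`: at `x`, the values of the local sections `X` of `D`
such that `[X, D] ⊆ D`. -/
def cauchyChar (n : WithTop ℕ∞) {N : ℕ} (D : (Fin N → ℝ) → Submodule ℝ (Fin N → ℝ)) :
    (Fin N → ℝ) → Submodule ℝ (Fin N → ℝ) := fun x =>
  Submodule.span ℝ {v | ∃ X, IsSection n D x X ∧
    (∀ Y, IsSection n D x Y → ∀ᶠ y in 𝓝 x, VectorField.lieBracket ℝ X Y y ∈ D y) ∧ v = X x}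

/-- Near `p` the distribution `D = D^r` generates a special `k`-flag of length `r`, and `F` is
the covariant subdistribution of `D^1`.  For `k ≥ 2`, an involutive corank one subdistribution of
`D^1` is unique and is the covariant subdistribution. -/
structure IsSpecialFlag (n : WithTop ℕ∞) {N : ℕ} (k r : ℕ)
    (D F : (Fin N → ℝ) → Submodule ℝ (Fin N → ℝ)) (p : Fin N → ℝ) : Prop where
  two_le_width : 2 ≤ k
  one_le_length : 1 ≤ r
  dim_eq : N = (r + 1) * k + 1
  rank_eq : ∀ j ≤ r, IsDistribution n ((r + 1 - j) * k + 1) (bigFlag n r D j) p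
  cauchy_le : ∀ j, 1 ≤ j → j < r →
    ∀ᶠ x in 𝓝 p, cauchyChar n (bigFlag n r D j) x ≤ bigFlag n r D (j + 1) x
  cauchy_rank : ∀ j, 1 ≤ j → j < r →
    IsDistribution n ((r - j) * k) (cauchyChar n (bigFlag n r D j)) p
  cauchy_last : ∀ᶠ x in 𝓝 p, cauchyChar n D x = ⊥
  cov_le : ∀ᶠ x in 𝓝 p, F x ≤ bigFlag n r D 1 x
  cov_rank : IsDistribution n (r * k) F p
  cov_involutive : ∀ᶠ x in 𝓝 p, lieSquare n F x ≤ F x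

/-- The inclusion in the `j`-th sandwich (`2 ≤ j ≤ r`) at the reference point: `D^2(p) ⊆ F(p)` for
`j = 2`, and `D^j(p) ⊆ L(D^(j-2))(p)` for `j ≥ 3`. -/
def SandwichInclusion (n : WithTop ℕ∞) {N : ℕ} (r : ℕ)
    (D F : (Fin N → ℝ) → Submodule ℝ (Fin N → ℝ)) (p : Fin N → ℝ) (j : ℕ) : Prop :=
  if j = 2 then bigFlag n r D 2 p ≤ F p
  else bigFlag n r D j p ≤ cauchyChar n (bigFlag n r D (j - 2)) p

/-- The germ of `D` at `p` generates a special 2-flag of length 4 in the singularity class 1.2.1.1: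
the only inclusion is the one in the second sandwich.  (The first, here the only, letter marking
an inclusion is always 2, so nothing has to be refined.) -/
def InClass1211 (n : WithTop ℕ∞) (D : (Fin 11 → ℝ) → Submodule ℝ (Fin 11 → ℝ))
    (p : Fin 11 → ℝ) : Prop :=
  ∃ F, IsSpecialFlag n 2 4 D F p ∧ SandwichInclusion n 4 D F p 2 ∧
    ¬ SandwichInclusion n 4 D F p 3 ∧ ¬ SandwichInclusion n 4 D F p 4

/-- The small flag of `D` at `p`, as modules of vector fields near `p`, counted from 0:
`smallFlag n D p i` is `V_(i+1)`, where `V_1` consists of the sections of `D` and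
`V_(i+1) = V_i + [D, V_i]`. -/
def smallFlag (n : WithTop ℕ∞) {N : ℕ} (D : (Fin N → ℝ) → Submodule ℝ (Fin N → ℝ))
    (p : Fin N → ℝ) : ℕ → Submodule ℝ ((Fin N → ℝ) → (Fin N → ℝ))
  | 0 => Submodule.span ℝ {X | IsSection n D p X}
  | i + 1 => smallFlag n D p i ⊔ Submodule.span ℝ
      {Z | ∃ X Y, IsSection n D p X ∧ Y ∈ smallFlag n D p i ∧ Z = VectorField.lieBracket ℝ X Y}

/-- The small growth vector of `D` at `p`, counted from 0: `smallGrowth n D p i = dim V_(i+1)(p)`. -/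
noncomputable def smallGrowth (n : WithTop ℕ∞) {N : ℕ}
    (D : (Fin N → ℝ) → Submodule ℝ (Fin N → ℝ)) (p : Fin N → ℝ) (i : ℕ) : ℕ :=
  Module.finrank ℝ ((smallFlag n D p i).map
    (LinearMap.proj p : ((Fin N → ℝ) → (Fin N → ℝ)) →ₗ[ℝ] (Fin N → ℝ)))

/-- The germs of `D` at `p` and of `D'` at `p'` are equivalent: some local `C^n` diffeomorphism
sends `p` to `p'` and `D` to `D'`. -/
def GermEquiv (n : WithTop ℕ∞) {N : ℕ} (D : (Fin N → ℝ) → Submodule ℝ (Fin N → ℝ))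
    (p : Fin N → ℝ) (D' : (Fin N → ℝ) → Submodule ℝ (Fin N → ℝ)) (p' : Fin N → ℝ) : Prop :=
  ∃ φ : OpenPartialHomeomorph (Fin N → ℝ) (Fin N → ℝ), p ∈ φ.source ∧ φ p = p' ∧
    ContDiffOn ℝ n φ φ.source ∧ ContDiffOn ℝ n φ.symm φ.target ∧
    ∀ x ∈ φ.source, D' (φ x) = (D x).map (fderiv ℝ φ x : (Fin N → ℝ) →ₗ[ℝ] (Fin N → ℝ))

/-- The derivative `X f` of a function along a vector field. -/
noncomputable def dirDeriv {N : ℕ} (X : (Fin N → ℝ) → (Fin N → ℝ)) (f : (Fin N → ℝ) → ℝ) :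
    (Fin N → ℝ) → ℝ :=
  fun x => fderiv ℝ f x (X x)

/-- `f` has nonholonomic order `s` at `p` with respect to `D`: every derivative of `f` along fewer
than `s` sections of `D` vanishes at `p`, and some derivative along `s` sections does not. -/
def HasNonholonomicOrder (n : WithTop ℕ∞) {N : ℕ} (D : (Fin N → ℝ) → Submodule ℝ (Fin N → ℝ))
    (p : Fin N → ℝ) (f : (Fin N → ℝ) → ℝ) (s : ℕ) : Prop :=
  (∀ l : List ((Fin N → ℝ) → (Fin N → ℝ)), (∀ X ∈ l, IsSection n D p X) → l.length < s →
    l.foldr dirDeriv f p = 0) ∧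
  ∃ l : List ((Fin N → ℝ) → (Fin N → ℝ)), (∀ X ∈ l, IsSection n D p X) ∧ l.length = s ∧
    l.foldr dirDeriv f p ≠ 0

/-- `w` are the weights of `D` at `p`, read off from the small growth vector: the `i`-th weight
(`i` counted from 0) is the least `s ≥ 1` with `i < dim V_s(p)`. -/
def IsWeights (n : WithTop ℕ∞) {N : ℕ} (D : (Fin N → ℝ) → Submodule ℝ (Fin N → ℝ))
    (p : Fin N → ℝ) (w : Fin N → ℕ) : Prop :=
  ∀ i, 1 ≤ w i ∧ ∀ s, w i ≤ s + 1 ↔ (i : ℕ) < smallGrowth n D p s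

/-- `z` are adapted coordinates for `D` at `p`, centred at `p`: the nonholonomic order at `p` of each
coordinate function equals its weight. -/
def IsAdapted (n : WithTop ℕ∞) {N : ℕ} (D : (Fin N → ℝ) → Submodule ℝ (Fin N → ℝ))
    (p : Fin N → ℝ) (w : Fin N → ℕ) (z : OpenPartialHomeomorph (Fin N → ℝ) (Fin N → ℝ)) : Prop :=
  IsWeights n D p w ∧ p ∈ z.source ∧ z p = 0 ∧
    ContDiffOn ℝ n z z.source ∧ ContDiffOn ℝ n z.symm z.target ∧
    ∀ i, HasNonholonomicOrder n D p (fun x => z x i) (w i)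

/-- The sum at `y` of the terms of weighted degree `d` in the Taylor expansion of `f` at 0, where
the `i`-th variable has weight `w i`: the coefficient of `ε ^ d` in the Taylor expansion of
`ε ↦ f (ε ^ w 0 * y 0, ε ^ w 1 * y 1, …)` at 0. -/
noncomputable def homogPart {N : ℕ} (w : Fin N → ℕ) (d : ℕ) (f : (Fin N → ℝ) → ℝ) (y : Fin N → ℝ) :
    ℝ :=
  iteratedDeriv d (fun ε : ℝ => f (fun i => ε ^ w i * y i)) 0 / (d.factorial : ℝ)

/-- The vector field `X` written in the coordinates `z`. -/
noncomputable def inCoords {N : ℕ} (z : OpenPartialHomeomorph (Fin N → ℝ) (Fin N → ℝ))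
    (X : (Fin N → ℝ) → (Fin N → ℝ)) : (Fin N → ℝ) → (Fin N → ℝ) :=
  fun y => fderiv ℝ z (z.symm y) (X (z.symm y))

/-- The part of weight `-1` of a vector field on `ℝ^N`: since `∂/∂y_j` has weight `-w j`, it consists
of the terms of weighted degree `w j - 1` in the `j`-th component. -/
noncomputable def nilpotentPart {N : ℕ} (w : Fin N → ℕ) (Z : (Fin N → ℝ) → (Fin N → ℝ)) :
    (Fin N → ℝ) → (Fin N → ℝ) :=
  fun y j => homogPart w (w j - 1) (fun u => Z u j) y

/-- `Dhat`, near 0, is a nilpotent approximation of `D` at `p`: it is spanned by the parts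
of weight `-1` of the fields of a local basis of `D`, written in adapted coordinates.  It does not
depend on the basis, and other adapted coordinates give an equivalent germ. -/
def IsNilpotentApprox (n : WithTop ℕ∞) {N : ℕ} (D : (Fin N → ℝ) → Submodule ℝ (Fin N → ℝ))
    (p : Fin N → ℝ) (Dhat : (Fin N → ℝ) → Submodule ℝ (Fin N → ℝ)) : Prop :=
  ∃ (m : ℕ) (X : Fin m → (Fin N → ℝ) → (Fin N → ℝ)) (w : Fin N → ℕ)
    (z : OpenPartialHomeomorph (Fin N → ℝ) (Fin N → ℝ)),
    IsFrame n D p X ∧ IsAdapted n D p w z ∧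
    ∀ y, Dhat y = Submodule.span ℝ (Set.range fun i => nilpotentPart w (inCoords z (X i)) y)

/-- The germ of `D` at `p` is strongly nilpotent: it is equivalent to its nilpotent approximation. -/
def StronglyNilpotent (n : WithTop ℕ∞) {N : ℕ} (D : (Fin N → ℝ) → Submodule ℝ (Fin N → ℝ))
    (p : Fin N → ℝ) : Prop :=
  ∃ Dhat, IsNilpotentApprox n D p Dhat ∧ GermEquiv n D p Dhat 0

/-- The part of the class 1.2.1.1 with small growth vector `[3,5,7,9,10,11]`. -/
def InPart1 (n : WithTop ℕ∞) (D : (Fin 11 → ℝ) → Submodule ℝ (Fin 11 → ℝ))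
    (p : Fin 11 → ℝ) : Prop :=
  InClass1211 n D p ∧ (List.range 6).map (smallGrowth n D p) = [3, 5, 7, 9, 10, 11]

/-- The part of the class 1.2.1.1 with small growth vector `[3,5,7,9,10,10,11]`. -/
def InPart2 (n : WithTop ℕ∞) (D : (Fin 11 → ℝ) → Submodule ℝ (Fin 11 → ℝ))
    (p : Fin 11 → ℝ) : Prop :=
  InClass1211 n D p ∧ (List.range 7).map (smallGrowth n D p) = [3, 5, 7, 9, 10, 10, 11]

/-- The part of the class 1.2.1.1 with small growth vector `[3,5,7,9,10,10,10,11]`. -/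
def InPart3 (n : WithTop ℕ∞) (D : (Fin 11 → ℝ) → Submodule ℝ (Fin 11 → ℝ))
    (p : Fin 11 → ℝ) : Prop :=
  InClass1211 n D p ∧ (List.range 8).map (smallGrowth n D p) = [3, 5, 7, 9, 10, 10, 10, 11]

/-- The pseudo-normal form with constants `b, c, B, C`, in the coordinates
`(t, x₁, y₁, x₂, y₂, x₃, y₃, x₄, y₄, x₅, y₅)` numbered `0, …, 10`:
`dx₁ = x₂ dt`, `dy₁ = y₂ dt`, `dt = x₃ dx₂`, `dy₂ = y₃ dx₂`,
`dx₃ = (b + x₄) dx₂`, `dy₃ = (c + y₄) dx₂`, `dx₄ = (B + x₅) dx₂`, `dy₄ = (C + y₅) dx₂`. -/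
def ekr1211 (b c B C : ℝ) (x : Fin 11 → ℝ) : Submodule ℝ (Fin 11 → ℝ) where
  carrier := {v | v 1 = x 3 * v 0 ∧ v 2 = x 4 * v 0 ∧ v 0 = x 5 * v 3 ∧ v 4 = x 6 * v 3 ∧
    v 5 = (b + x 7) * v 3 ∧ v 6 = (c + x 8) * v 3 ∧
    v 7 = (B + x 9) * v 3 ∧ v 8 = (C + x 10) * v 3}
  zero_mem' := by simp
  add_mem' := by
    rintro u v ⟨h1, h2, h3, h4, h5, h6, h7, h8⟩ ⟨k1, k2, k3, k4, k5, k6, k7, k8⟩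
    simp only [Set.mem_ofPred_eq, Pi.add_apply]
    refine ⟨?_, ?_, ?_, ?_, ?_, ?_, ?_, ?_⟩
    · linear_combination h1 + k1
    · linear_combination h2 + k2
    · linear_combination h3 + k3
    · linear_combination h4 + k4
    · linear_combination h5 + k5
    · linear_combination h6 + k6
    · linear_combination h7 + k7
    · linear_combination h8 + k8
  smul_mem' := by
    rintro a v ⟨h1, h2, h3, h4, h5, h6, h7, h8⟩
    simp only [Set.mem_ofPred_eq, Pi.smul_apply, smul_eq_mul]
    refine ⟨?_, ?_, ?_, ?_, ?_, ?_, ?_, ?_⟩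
    · linear_combination a * h1
    · linear_combination a * h2
    · linear_combination a * h3
    · linear_combination a * h4
    · linear_combination a * h5
    · linear_combination a * h6
    · linear_combination a * h7
    · linear_combination a * h8

/-! Normal form. The covariant subdistribution `F` is involutive of corank 3, so Frobenius
(`exists_first_integrals`) gives three first integrals. The flag is then unwound from `D⁰` down to
`D⁴`. At each stage there are three functions with differentials independent on `Dʲ`, whose common
kernel in `Dʲ` consists of Cauchy characteristics. That kernel lies in `Dʲ⁺¹`, which has corank two
in `Dʲ`. So `Dʲ⁺¹` is cut out by two equations making two of the differentials multiples of the
third, and the two coefficients, with the third function, serve for `Dʲ⁺¹` (`IsCauchyTriple.step`).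
The sandwich conditions decide the third function: `t` for `D¹`; then `x₂`, because `dt` vanishes on
`D²(p) ⊆ F(p)`; and `x₂` again for `D³` and `D⁴`, because the remaining inclusions fail. Constants
that can be removed are absorbed by a linear change; those left are the values at `p` of `x₄, y₄,
x₅, y₅`.

Growth vector. Put `Z = ekrField`. Brackets of `Z` with `∂/∂x₅` and `∂/∂y₅` fill every direction but
`∂/∂y₁` within `V₅`. For that direction they give `x₃ ∂/∂y₁` in `V₅`, then `(b + x₄) ∂/∂y₁` and `(c
+ y₄) ∂/∂y₁` in `V₆`, `(B + x₅) ∂/∂y₁` and `(C + y₅) ∂/∂y₁` in `V₇`, and finally `∂/∂y₁` in `V₈`.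
Hence dimension 11 is reached at step 6, 7 or 8 according to which constants vanish. It is not
reached earlier, because the form `ekrForm` evaluated on the fields of `V₅, V₆, …` keeps a weighted
order of vanishing that falls by at most one per bracket (`hasWeightedOrder_ekrForm`).

Strong nilpotency. The frame of `E(0,0,0,0)` is homogeneous of weight -1 for the weights of its
small flag, so it is its own nilpotent approximation. Conversely, every nilpotent approximation is
invariant under the dilation `yᵢ ↦ 2 ^ wᵢ yᵢ`, which is multiplication by 2 on the distribution at
0. If `E(b,c,B,C)` is strongly nilpotent, conjugation gives a symmetry fixing 0 with the same effect
on its own plane. The bracket `[ad³_Z ∂/∂y₅, ad³_Z ∂/∂x₅]` has eight factors, and its `y₁`-component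
at 0 depends only on their values at 0; so the symmetry acts by `2⁸` modulo `V₅(0)`, and 8 must be a
weight (`StronglyNilpotent.exists_weights`). In `10₁` and `10₂` all weights are at most 7. -/

theorem natCast_le_of_infty_or_omega {n : WithTop ℕ∞} (hn : n = ∞ ∨ n = ω) (k : ℕ) :
    (k : WithTop ℕ∞) ≤ n := by
  rcases hn with rfl | rfl
  · exact_mod_cast le_top
  · exact le_top

/-- Differentiation stays inside either category; a finite order of smoothness would not have this
property. -/
theorem add_one_le_of_infty_or_omega {n : WithTop ℕ∞} (hn : n = ∞ ∨ n = ω) : n + 1 ≤ n := by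
  rcases hn with rfl | rfl
  · exact le_rfl
  · exact le_top

/-! ### Local diffeomorphisms -/

/-- The inverse function theorem, with the source cut down to points where `f` is `C^n` with
invertible derivative. The inverse is then `C^n` on the whole target, and any condition holding near
`x₀` can be imposed throughout the source through `U`. -/
theorem exists_local_diffeo {E F : Type*} [NormedAddCommGroup E] [NormedSpace ℝ E] [CompleteSpace E]
    [NormedAddCommGroup F] [NormedSpace ℝ F] [CompleteSpace F] {n : WithTop ℕ∞} (hn : 1 ≤ n)
    {f : E → F} {x₀ : E} {U : Set E} (hU : U ∈ 𝓝 x₀) (hf : ∀ᶠ x in 𝓝 x₀, ContDiffAt ℝ n f x)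
    (e : E ≃L[ℝ] F) (he : HasFDerivAt f (e : E →L[ℝ] F) x₀) :
    ∃ φ : OpenPartialHomeomorph E F, x₀ ∈ φ.source ∧ (∀ x, φ x = f x) ∧ φ.source ⊆ U ∧
      ContDiffOn ℝ n φ φ.source ∧ ContDiffOn ℝ n φ.symm φ.target := by
  have h0 : ContDiffAt ℝ n f x₀ := hf.self_of_nhds
  have hn0 : n ≠ 0 := (lt_of_lt_of_le one_pos hn).ne'
  have hcont : ContinuousAt (fderiv ℝ f) x₀ :=
    (h0.fderiv_right (m := 0) (by simpa using hn)).continuousAt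
  have hinv : ∀ᶠ x in 𝓝 x₀, fderiv ℝ f x ∈ Set.range ((↑) : (E ≃L[ℝ] F) → E →L[ℝ] F) := by
    refine hcont.eventually ?_
    rw [he.fderiv]
    exact ContinuousLinearEquiv.nhds e
  obtain ⟨O, hO, hOo, hOx⟩ := eventually_nhds_iff.1 (hf.and (hinv.and hU))
  refine ⟨(h0.toOpenPartialHomeomorph f he hn0).restrOpen O hOo, ?_, fun x => rfl, ?_, ?_, ?_⟩
  · exact ⟨h0.mem_toOpenPartialHomeomorph_source he hn0, hOx⟩
  · rintro x ⟨-, hx⟩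
    exact (hO x hx).2.2
  · rintro x ⟨-, hx⟩
    exact (hO x hx).1.contDiffWithinAt
  · intro y hy
    have hx : ((h0.toOpenPartialHomeomorph f he hn0).restrOpen O hOo).symm y ∈ O :=
      (OpenPartialHomeomorph.map_target _ hy).2
    obtain ⟨h1, ⟨e', he'⟩, -⟩ := hO _ hx
    refine (OpenPartialHomeomorph.contDiffAt_symm _ hy (f₀' := e') ?_ h1).contDiffWithinAt
    rw [he']
    exact (h1.differentiableAt hn0).hasFDerivAt

/-! ### Superposition operators on spaces of continuous functions -/

section Superposition

set_option linter.unusedSectionVars false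

variable {I : Type} [TopologicalSpace I] [CompactSpace I]
variable {E F : Type} [NormedAddCommGroup E] [NormedSpace ℝ E]
  [NormedAddCommGroup F] [NormedSpace ℝ F]

open Classical in
/-- The superposition operator `γ ↦ f ∘ γ` (zero where `f ∘ γ` is not continuous). -/
noncomputable def superpos (I : Type) [TopologicalSpace I] {E F : Type} [NormedAddCommGroup E]
    [NormedAddCommGroup F] (f : E → F) (γ : C(I, E)) : C(I, F) :=
  if h : Continuous fun s => f (γ s) then ⟨fun s => f (γ s), h⟩ else 0

theorem mem_ball_of_mem_ball_const {q : E} {r : ℝ} {γ : C(I, E)}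
    (hγ : γ ∈ Metric.ball (ContinuousMap.const I q) r) (s : I) : γ s ∈ Metric.ball q r :=
  lt_of_le_of_lt (ContinuousMap.dist_apply_le_dist (f := γ) (g := ContinuousMap.const I q) s) hγ

theorem superpos_apply {f : E → F} {q : E} {r : ℝ} (hf : ContinuousOn f (Metric.ball q r))
    {γ : C(I, E)} (hγ : γ ∈ Metric.ball (ContinuousMap.const I q) r) (s : I) :
    superpos I f γ s = f (γ s) := by
  have h : Continuous fun s => f (γ s) :=
    hf.comp_continuous γ.continuous fun s => mem_ball_of_mem_ball_const hγ s
  simp [superpos, h]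

/-- Pointwise application of a family of operators to a family of vectors. -/
noncomputable def pointwiseApply (I : Type) [TopologicalSpace I] [CompactSpace I] (E F : Type)
    [NormedAddCommGroup E] [NormedSpace ℝ E] [NormedAddCommGroup F] [NormedSpace ℝ F] :
    C(I, E →L[ℝ] F) →L[ℝ] C(I, E) →L[ℝ] C(I, F) :=
  LinearMap.mkContinuous₂ (LinearMap.mk₂ ℝ
      (fun (A : C(I, E →L[ℝ] F)) (h : C(I, E)) =>
        (⟨fun s => A s (h s), A.continuous.clm_apply h.continuous⟩ : C(I, F)))
      (fun _ _ _ => by ext; simp) (fun _ _ _ => by ext; simp)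
      (fun _ _ _ => by ext; simp) (fun _ _ _ => by ext; simp)) 1 (by
    intro A h
    rw [one_mul]
    refine (ContinuousMap.norm_le _ (by positivity)).2 fun s => ?_
    exact ((A s).le_opNorm _).trans (by
      gcongr
      exacts [A.norm_coe_le_norm s, h.norm_coe_le_norm s]))

@[simp] theorem pointwiseApply_apply (A : C(I, E →L[ℝ] F)) (h : C(I, E)) (s : I) :
    pointwiseApply I E F A h s = A s (h s) := rfl

/-- The derivative is pointwise multiplication by `f' ∘ γ`. Compactness of the range of `γ` makes
`f'` uniformly continuous along it, so the mean value inequality gives an error that is small in the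
sup norm. -/
theorem hasFDerivAt_superpos {f : E → F} {q : E} {r : ℝ}
    (hf : ContDiffOn ℝ 1 f (Metric.ball q r)) {γ : C(I, E)}
    (hγ : γ ∈ Metric.ball (ContinuousMap.const I q) r) :
    HasFDerivAt (superpos I f) (pointwiseApply I E F (superpos I (fderiv ℝ f) γ)) γ := by
  have hf' : ContinuousOn (fderiv ℝ f) (Metric.ball q r) :=
    hf.continuousOn_fderiv_of_isOpen Metric.isOpen_ball le_rfl
  have hK : IsCompact (Set.range γ) := isCompact_range γ.continuous
  have hKr : Set.range γ ⊆ Metric.ball q r := by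
    rintro _ ⟨s, rfl⟩
    exact mem_ball_of_mem_ball_const hγ s
  rw [hasFDerivAt_iff_isLittleO, Asymptotics.isLittleO_iff]
  intro ε hε
  have huc := hK.uniformContinuousAt_of_continuousAt (fderiv ℝ f)
    (fun x hx => hf'.continuousAt (Metric.isOpen_ball.mem_nhds (hKr hx))) (Metric.dist_mem_uniformity hε)
  obtain ⟨δ, hδ, hδ'⟩ := Metric.mem_uniformity_dist.1 huc
  have hB : ∀ᶠ γ' in 𝓝 γ, γ' ∈ Metric.ball (ContinuousMap.const I q) r :=
    Metric.isOpen_ball.mem_nhds hγ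
  filter_upwards [Metric.ball_mem_nhds γ hδ, hB,
    Metric.ball_mem_nhds γ (sub_pos.2 (Metric.mem_ball.1 hγ))] with γ' h1 h2 h3
  refine (ContinuousMap.norm_le _ (by positivity)).2 fun s => ?_
  have hfc := hf.continuousOn
  simp only [ContinuousMap.sub_apply, superpos_apply hfc h2, superpos_apply hfc hγ,
    pointwiseApply_apply, superpos_apply hf' hγ]
  set δ' := min δ (r - dist γ (ContinuousMap.const I q))
  have hball : Metric.ball (γ s) δ' ⊆ Metric.ball q r := by
    intro y hy
    have e1 : dist y (γ s) < r - dist γ (ContinuousMap.const I q) :=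
      lt_of_lt_of_le hy (min_le_right _ _)
    have e2 : dist (γ s) q ≤ dist γ (ContinuousMap.const I q) :=
      ContinuousMap.dist_apply_le_dist (f := γ) (g := ContinuousMap.const I q) s
    have e3 := dist_triangle y (γ s) q
    simp only [Metric.mem_ball]
    linarith
  have key := Convex.norm_image_sub_le_of_norm_hasFDerivWithin_le' (𝕜 := ℝ) (f := f)
    (f' := fderiv ℝ f) (φ := fderiv ℝ f (γ s)) (s := Metric.ball (γ s) δ') (C := ε)
    (x := γ s) (y := γ' s)
    (fun x hx => ((hf.differentiableOn (by simp)).differentiableAt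
      (Metric.isOpen_ball.mem_nhds (hball hx))).hasFDerivAt.hasFDerivWithinAt)
    (fun x hx => by
      have := hδ' (a := γ s) (b := x)
        (by rw [dist_comm]; exact lt_of_lt_of_le hx (min_le_left _ _)) ⟨s, rfl⟩
      rw [← dist_eq_norm, dist_comm]
      exact this.le)
    (convex_ball _ _)
    (Metric.mem_ball_self (lt_min hδ (sub_pos.2 (Metric.mem_ball.1 hγ))))
    (by
      have := ContinuousMap.dist_apply_le_dist (f := γ') (g := γ) s
      exact lt_min (this.trans_lt h1) (this.trans_lt h3))
  refine key.trans ?_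
  gcongr
  exact (γ' - γ).norm_coe_le_norm s

/-- Induction through the derivative formula: the derivative is the superposition operator of `f'`
followed by a bounded linear map. One order of smoothness is lost, which does no harm for `C^∞`. -/
theorem contDiffOn_superpos_nat (k : ℕ) : ∀ {F : Type} [NormedAddCommGroup F] [NormedSpace ℝ F]
    {f : E → F} {q : E} {r : ℝ}, ContDiffOn ℝ (k + 1) f (Metric.ball q r) →
    ContDiffOn ℝ k (superpos I f) (Metric.ball (ContinuousMap.const I q) r) := by
  induction k with
  | zero =>
    intro F _ _ f q r hf
    have hf1 : ContDiffOn ℝ 1 f (Metric.ball q r) := by simpa using hf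
    simp only [Nat.cast_zero, contDiffOn_zero]
    exact fun γ hγ => (hasFDerivAt_superpos hf1 hγ).continuousAt.continuousWithinAt
  | succ k ih =>
    intro F _ _ f q r hf
    have hf1 : ContDiffOn ℝ 1 f (Metric.ball q r) := hf.of_le (by simp)
    have hk : ((k + 1 : ℕ) : WithTop ℕ∞) = (k : WithTop ℕ∞) + 1 := by push_cast; rfl
    rw [hk, contDiffOn_succ_iff_fderiv_of_isOpen Metric.isOpen_ball]
    refine ⟨fun γ hγ => (hasFDerivAt_superpos hf1 hγ).differentiableAt.differentiableWithinAt,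
      fun h => absurd h (by simp), ?_⟩
    have hf' : ContDiffOn ℝ (k + 1) (fderiv ℝ f) (Metric.ball q r) :=
      hf.fderiv_of_isOpen Metric.isOpen_ball (by push_cast; rfl)
    refine ((pointwiseApply I E F).contDiff.comp_contDiffOn (ih hf')).congr fun γ hγ => ?_
    exact (hasFDerivAt_superpos hf1 hγ).fderiv

/-- Pointwise application of a continuous multilinear map. -/
noncomputable def pointwiseMultilinear (I : Type) [TopologicalSpace I] [CompactSpace I] {k : ℕ}
    (P : ContinuousMultilinearMap ℝ (fun _ : Fin k => E) F) :
    ContinuousMultilinearMap ℝ (fun _ : Fin k => C(I, E)) C(I, F) :=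
  MultilinearMap.mkContinuous
    { toFun := fun m => ⟨fun s => P fun i => m i s,
        P.cont.comp (continuous_pi fun i => (m i).continuous)⟩
      map_update_add' := by
        intro _ m i x y
        ext s
        have h : ∀ z : C(I, E), (fun j => Function.update m i z j s) =
            Function.update (fun j => m j s) i (z s) := by
          intro z; funext j
          by_cases hj : j = i
          · subst hj; simp
          · simp [hj]
        simp [h]
      map_update_smul' := by
        intro _ m i c x
        ext s
        have h : ∀ z : C(I, E), (fun j => Function.update m i z j s) =
            Function.update (fun j => m j s) i (z s) := by
          intro z; funext j
          by_cases hj : j = i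
          · subst hj; simp
          · simp [hj]
        simp [h] } ‖P‖ (by
    intro m
    refine (ContinuousMap.norm_le _ (by positivity)).2 fun s => ?_
    refine (P.le_opNorm _).trans ?_
    gcongr with i
    exact (m i).norm_coe_le_norm s)

theorem norm_pointwiseMultilinear_le {k : ℕ}
    (P : ContinuousMultilinearMap ℝ (fun _ : Fin k => E) F) : ‖pointwiseMultilinear I P‖ ≤ ‖P‖ :=
  MultilinearMap.mkContinuous_norm_le _ (norm_nonneg _) _

/-- At a constant path the power series of `f` may be applied pointwise. The resulting multilinear
maps have norms no larger than the original ones, so the series converges in the sup norm. -/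
theorem analyticAt_superpos [CompleteSpace F] {f : E → F} {q : E} (hf : AnalyticAt ℝ f q) :
    AnalyticAt ℝ (superpos I f) (ContinuousMap.const I q) := by
  obtain ⟨p, r, hp⟩ := hf
  refine ⟨fun k => pointwiseMultilinear I (p k), min r 1, ?_⟩
  have hrad : p.radius ≤ FormalMultilinearSeries.radius (fun k => pointwiseMultilinear I (p k)) :=
    FormalMultilinearSeries.radius_le_of_le fun k => norm_pointwiseMultilinear_le _
  refine ⟨(min_le_left _ _).trans (hp.r_le.trans hrad), lt_min hp.r_pos one_pos, ?_⟩
  intro y hy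
  have hyr : (‖y‖₊ : ENNReal) < r := by
    have h := Metric.mem_eball.1 hy
    rw [edist_zero_right] at h
    exact h.trans_le (min_le_left _ _)
  have hys : ∀ s, y s ∈ Metric.eball (0 : E) r := fun s => by
    refine lt_of_le_of_lt ?_ hyr
    rw [edist_zero_right]
    exact_mod_cast y.norm_coe_le_norm s
  have hsum : Summable fun k => pointwiseMultilinear I (p k) fun _ => y := by
    refine Summable.of_norm_bounded (p.summable_norm_mul_pow (hyr.trans_le hp.r_le)) fun k => ?_
    refine ((pointwiseMultilinear I (p k)).le_opNorm _).trans ?_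
    simp only [Finset.prod_const, Finset.card_univ, Fintype.card_fin, coe_nnnorm]
    gcongr
    exact norm_pointwiseMultilinear_le _
  have hval : ∀ s, (∑' k, pointwiseMultilinear I (p k) fun _ => y) s = f (q + y s) := by
    intro s
    have h1 := (ContinuousMap.evalCLM ℝ s).hasSum hsum.hasSum
    exact h1.unique (hp.hasSum (hys s))
  have hcont : Continuous fun s => f ((ContinuousMap.const I q + y) s) := by
    have : (fun s => f ((ContinuousMap.const I q + y) s)) =
        (∑' k, pointwiseMultilinear I (p k) fun _ => y) := by
      funext s; exact (hval s).symm
    rw [this]; exact ContinuousMap.continuous _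
  have heq : superpos I f (ContinuousMap.const I q + y) =
      ∑' k, pointwiseMultilinear I (p k) fun _ => y := by
    rw [superpos, dif_pos hcont]
    ext s
    exact (hval s).symm
  rw [heq]
  exact hsum.hasSum

theorem exists_contDiffOn_superpos [CompleteSpace F] {n : WithTop ℕ∞} (hn : n = ∞ ∨ n = ω)
    {f : E → F} {q : E} (hf : ∀ᶠ x in 𝓝 q, ContDiffAt ℝ n f x) :
    ∃ r > 0, ContDiffOn ℝ n (superpos I f) (Metric.ball (ContinuousMap.const I q) r) ∧
      ∀ γ ∈ Metric.ball (ContinuousMap.const I q) r, ∀ s, superpos I f γ s = f (γ s) := by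
  obtain ⟨r, hr, hball⟩ := Metric.eventually_nhds_iff_ball.1 hf
  have hfr : ContDiffOn ℝ n f (Metric.ball q r) := fun x hx => (hball x hx).contDiffWithinAt
  rcases hn with rfl | rfl
  · refine ⟨r, hr, ?_, fun γ hγ s => superpos_apply hfr.continuousOn hγ s⟩
    exact contDiffOn_infty.2 fun k => contDiffOn_superpos_nat k (hfr.of_le (by
      exact_mod_cast le_top))
  · have ha := analyticAt_superpos (I := I) hf.self_of_nhds.analyticAt
    obtain ⟨r', hr', hball'⟩ := Metric.eventually_nhds_iff_ball.1 ha.eventually_analyticAt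
    refine ⟨min r r', lt_min hr hr', ?_, fun γ hγ s => superpos_apply hfr.continuousOn
      (Metric.ball_subset_ball (min_le_left _ _) hγ) s⟩
    have : AnalyticOnNhd ℝ (superpos I f) (Metric.ball (ContinuousMap.const I q) (min r r')) :=
      fun γ hγ => hball' γ (Metric.ball_subset_ball (min_le_right _ _) hγ)
    exact fun γ hγ => (this γ hγ).contDiffAt.contDiffWithinAt

end Superposition

/-! ### Smooth dependence of the solutions of radial differential equations -/

section Radial

variable {V W : Type} [NormedAddCommGroup V] [NormedSpace ℝ V] [NormedAddCommGroup W]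
  [NormedSpace ℝ W]

/-- The primitive vanishing at 0 of a continuous path on the unit interval. -/
noncomputable def pathPrimitive (W : Type) [NormedAddCommGroup W] [NormedSpace ℝ W] :
    C(unitInterval, W) →L[ℝ] C(unitInterval, W) :=
  LinearMap.mkContinuous
    { toFun := fun γ => ⟨fun t => ∫ σ in (0 : ℝ)..t, Set.IccExtend zero_le_one γ σ, by
        have h : Continuous (Set.IccExtend (zero_le_one' ℝ) γ) := γ.continuous.Icc_extend'
        exact (intervalIntegral.continuous_primitive
          (fun a b => h.intervalIntegrable a b) 0).comp continuous_subtype_val⟩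
      map_add' := by
        intro γ δ
        ext t
        simp only [ContinuousMap.coe_mk, ContinuousMap.add_apply]
        rw [← intervalIntegral.integral_add]
        · rfl
        · exact (γ.continuous.Icc_extend').intervalIntegrable _ _
        · exact (δ.continuous.Icc_extend').intervalIntegrable _ _
      map_smul' := by
        intro c γ
        ext t
        simp only [ContinuousMap.coe_mk, ContinuousMap.smul_apply, RingHom.id_apply]
        rw [← intervalIntegral.integral_smul]
        rfl } 1 (by
    intro γ
    refine (ContinuousMap.norm_le _ (by positivity)).2 fun t => ?_
    have h := intervalIntegral.norm_integral_le_of_norm_le_const (a := (0 : ℝ)) (b := t)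
      (C := ‖γ‖) (f := Set.IccExtend (zero_le_one' ℝ) γ) (fun σ _ => γ.norm_coe_le_norm _)
    refine h.trans ?_
    rw [sub_zero, abs_of_nonneg t.2.1, mul_comm]
    gcongr
    exact t.2.2)

theorem pathPrimitive_apply (γ : C(unitInterval, W)) (t : unitInterval) :
    pathPrimitive W γ t = ∫ σ in (0 : ℝ)..t, Set.IccExtend zero_le_one γ σ := rfl

/-- The path `s ↦ ((s c, γ s), c)`. -/
noncomputable def rayPath (V W : Type) [NormedAddCommGroup V] [NormedSpace ℝ V]
    [NormedAddCommGroup W] [NormedSpace ℝ W] :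
    V × C(unitInterval, W) →L[ℝ] C(unitInterval, (V × W) × V) :=
  LinearMap.mkContinuous
    { toFun := fun x => ⟨fun s => (((s : ℝ) • x.1, x.2 s), x.1), by fun_prop⟩
      map_add' := by intro x y; ext s <;> simp
      map_smul' := by
        intro c x
        ext s
        · exact smul_comm (s : ℝ) c x.1
        · rfl
        · rfl } 1 (by
    intro x
    rw [one_mul]
    refine (ContinuousMap.norm_le _ (by positivity)).2 fun s => ?_
    refine max_le (max_le ?_ ?_) (norm_fst_le x)
    · change ‖(s : ℝ) • x.1‖ ≤ ‖x‖
      rw [norm_smul, Real.norm_of_nonneg s.2.1]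
      exact (mul_le_of_le_one_left (norm_nonneg _) s.2.2).trans (norm_fst_le x)
    · exact (x.2.norm_coe_le_norm s).trans (norm_snd_le x))

theorem rayPath_apply (x : V × C(unitInterval, W)) (s : unitInterval) :
    rayPath V W x s = (((s : ℝ) • x.1, x.2 s), x.1) := rfl

variable [CompleteSpace V] [CompleteSpace W]

/-- `Z (c, w)` is the value at time 1 of the solution of `γ' = a(sc, γ) c`, `γ(0) = w`. The inverse
function theorem in the Banach space of continuous paths, applied to the integral equation, gives
`C^n` dependence on `(c, w)` in the smooth and analytic categories alike. -/
theorem exists_radial_solution {n : WithTop ℕ∞} (hn : n = ∞ ∨ n = ω) {a : V × W → V →L[ℝ] W}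
    (ha : ∀ᶠ q in 𝓝 0, ContDiffAt ℝ n a q) :
    ∃ Z : V × W → W, (∀ᶠ q in 𝓝 0, ContDiffAt ℝ n Z q) ∧ (∀ᶠ w in 𝓝 0, Z (0, w) = w) ∧
      ∀ᶠ q in 𝓝 0, fderiv ℝ Z q (q.1, 0) = a (q.1, Z q) q.1 := by
  have hn1 : 1 ≤ n := by rcases hn with rfl | rfl <;> simp
  have hn0 : n ≠ 0 := (lt_of_lt_of_le one_pos hn1).ne'
  set b : (V × W) × V → W := fun q => a q.1 q.2 with hb
  have hbs : ∀ᶠ q in 𝓝 (0 : (V × W) × V), ContDiffAt ℝ n b q := by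
    have : Tendsto Prod.fst (𝓝 (0 : (V × W) × V)) (𝓝 0) := continuous_fst.tendsto _
    filter_upwards [this.eventually ha] with q hq
    exact (hq.comp q contDiffAt_fst).clm_apply contDiffAt_snd
  obtain ⟨r, hr, hSr, hSa⟩ := exists_contDiffOn_superpos (I := unitInterval) hn hbs
  have hzero : ContinuousMap.const unitInterval (0 : (V × W) × V) = 0 := rfl
  rw [hzero] at hSr hSa
  -- The zeros of `G ((c, w), ·)` are the solutions of the integral equation with initial value `w`
  -- and direction `c`.
  set G : (V × W) × C(unitInterval, W) → C(unitInterval, W) := fun x =>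
    x.2 - ContinuousMap.const _ x.1.2 -
      pathPrimitive W (superpos unitInterval b (rayPath V W (x.1.1, x.2))) with hG
  have hray : Continuous fun x : (V × W) × C(unitInterval, W) => rayPath V W (x.1.1, x.2) := by
    fun_prop
  have hO : ∀ᶠ x in 𝓝 (0 : (V × W) × C(unitInterval, W)),
      rayPath V W (x.1.1, x.2) ∈ Metric.ball 0 r := by
    refine hray.continuousAt.eventually (Metric.isOpen_ball.mem_nhds ?_)
    have h00 : rayPath V W ((0 : V), (0 : C(unitInterval, W))) = 0 := map_zero _
    simp [h00, hr]
  have hGs : ∀ᶠ x in 𝓝 (0 : (V × W) × C(unitInterval, W)), ContDiffAt ℝ n G x := by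
    filter_upwards [hO] with x hx
    have h1 : ContDiffAt ℝ n (superpos unitInterval b) (rayPath V W (x.1.1, x.2)) :=
      hSr.contDiffAt (Metric.isOpen_ball.mem_nhds hx)
    have h2 : ContDiff ℝ n fun x : (V × W) × C(unitInterval, W) => rayPath V W (x.1.1, x.2) :=
      (rayPath V W).contDiff.comp (by fun_prop)
    have h3 : ContDiff ℝ n fun x : (V × W) × C(unitInterval, W) =>
        ContinuousMap.const unitInterval x.1.2 :=
      (ContinuousLinearMap.const ℝ unitInterval (M := W)).contDiff.comp (by fun_prop)
    have h4 : ContDiffAt ℝ n (fun x : (V × W) × C(unitInterval, W) =>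
        superpos unitInterval b (rayPath V W (x.1.1, x.2))) x :=
      ContDiffAt.comp (f := fun x : (V × W) × C(unitInterval, W) =>
        rayPath V W (x.1.1, x.2)) x h1 h2.contDiffAt
    exact (contDiffAt_snd.sub h3.contDiffAt).sub ((pathPrimitive W).contDiff.contDiffAt.comp x h4)
  -- For `c = 0` the right-hand side of the equation vanishes, being linear in `c`. So the partial
  -- derivative of `G` in the path is the identity at 0, and `(q, γ) ↦ (q, G (q, γ))` is invertible
  -- there.
  have hG0 : ∀ᶠ γ in 𝓝 (0 : C(unitInterval, W)), G (0, γ) = γ := by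
    have : Tendsto (fun γ : C(unitInterval, W) => ((0 : V × W), γ)) (𝓝 0) (𝓝 0) :=
      (Continuous.prodMk_right (0 : V × W)).tendsto' _ _ rfl
    filter_upwards [this.eventually hO] with γ hγ
    have : superpos unitInterval b (rayPath V W ((0 : V), γ)) = 0 := by
      ext s
      rw [hSa (rayPath V W ((0 : V), γ)) hγ]
      simp [rayPath_apply, hb]
    simp only [hG, Prod.fst_zero, Prod.snd_zero]
    rw [this]
    ext s; simp
  have hGd : HasFDerivAt G (fderiv ℝ G 0) 0 :=
    (hGs.self_of_nhds.differentiableAt hn0).hasFDerivAt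
  have hGinr : ∀ γ, fderiv ℝ G 0 (0, γ) = γ := by
    have h1 : HasFDerivAt (fun γ => G (0, γ)) ((fderiv ℝ G 0).comp (.inr ℝ _ _)) 0 :=
      HasFDerivAt.comp (f := fun γ : C(unitInterval, W) => ((0 : V × W), γ)) 0 hGd
        (hasFDerivAt_prodMk_right (0 : V × W) (0 : C(unitInterval, W)))
    have h2 : HasFDerivAt (fun γ => G (0, γ)) (.id ℝ _) 0 :=
      (hasFDerivAt_id _).congr_of_eventuallyEq hG0
    intro γ
    have := congrArg (fun L => L γ) (h1.unique h2)
    simpa using this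
  set A : (V × W) →L[ℝ] C(unitInterval, W) := (fderiv ℝ G 0).comp (.inl ℝ _ _) with hA
  have hGsplit : ∀ x, fderiv ℝ G 0 x = A x.1 + x.2 := by
    intro x
    have : x = (x.1, 0) + (0, x.2) := by simp
    conv_lhs => rw [this, map_add, hGinr]
    rfl
  let e : ((V × W) × C(unitInterval, W)) ≃L[ℝ] ((V × W) × C(unitInterval, W)) :=
    ContinuousLinearEquiv.equivOfInverse
      ((ContinuousLinearMap.fst ℝ _ _).prod (fderiv ℝ G 0))
      ((ContinuousLinearMap.fst ℝ _ _).prod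
        (ContinuousLinearMap.snd ℝ _ _ - A.comp (ContinuousLinearMap.fst ℝ _ _)))
      (fun x => by ext <;> simp [hGsplit]) (fun x => by ext <;> simp [hGsplit])
  obtain ⟨φ, hφ0, hφ, -, -, hφs⟩ := exists_local_diffeo (n := n) hn1 (f := fun x => (x.1, G x))
    (hO) (hGs.mono fun x hx => contDiffAt_fst.prodMk hx) e
    (HasFDerivAt.prodMk (f₁ := Prod.fst) hasFDerivAt_fst hGd)
  have hφ00 : φ 0 = 0 := by
    rw [hφ]
    have h := hG0.self_of_nhds
    exact Prod.ext rfl h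
  have h0t : (0 : (V × W) × C(unitInterval, W)) ∈ φ.target := hφ00 ▸ φ.map_source hφ0
  have hsymm0 : φ.symm 0 = 0 := by
    have := φ.left_inv hφ0
    rwa [hφ00] at this
  obtain ⟨ρ, hρ, hρb⟩ := Metric.eventually_nhds_iff_ball.1
    ((φ.open_source.eventually_mem hφ0).and hO)
  have hemb : Tendsto (fun q : V × W => (q, (0 : C(unitInterval, W)))) (𝓝 0) (𝓝 0) :=
    (Continuous.prodMk_left (0 : C(unitInterval, W))).tendsto' _ _ rfl
  have hgood : ∀ᶠ q in 𝓝 (0 : V × W), (q, (0 : C(unitInterval, W))) ∈ φ.target ∧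
      φ.symm (q, 0) ∈ Metric.ball 0 ρ := by
    have h1 := φ.continuousAt_symm h0t
    have h2 : ∀ᶠ x in 𝓝 (0 : (V × W) × C(unitInterval, W)), φ.symm x ∈ Metric.ball 0 ρ :=
      h1.eventually (Metric.isOpen_ball.mem_nhds (by rw [hsymm0]; simpa using hρ))
    exact (hemb.eventually (φ.open_target.eventually_mem h0t)).and (hemb.eventually h2)
  have hsol : ∀ q, (q, (0 : C(unitInterval, W))) ∈ φ.target →
      (φ.symm (q, 0)).1 = q ∧ G (φ.symm (q, 0)) = 0 := by
    intro q hq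
    have := φ.right_inv hq
    rw [hφ] at this
    exact ⟨congrArg Prod.fst this, congrArg Prod.snd this⟩
  have huniq : ∀ q γ, (q, γ) ∈ Metric.ball (0 : (V × W) × C(unitInterval, W)) ρ → G (q, γ) = 0 →
      φ.symm (q, 0) = (q, γ) := by
    intro q γ hq hG'
    have := φ.left_inv (hρb _ hq).1
    rw [hφ, hG'] at this
    exact this
  have hZ : ∀ᶠ q in 𝓝 (0 : V × W), ContDiffAt ℝ n (fun q => (φ.symm (q, 0)).2 1) q := by
    filter_upwards [hgood] with q hq
    have h1 : ContDiffAt ℝ n φ.symm (q, (0 : C(unitInterval, W))) :=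
      hφs.contDiffAt (φ.open_target.mem_nhds hq.1)
    have h2 : ContDiffAt ℝ n (fun q : V × W => φ.symm (q, (0 : C(unitInterval, W)))) q :=
      ContDiffAt.comp (f := fun q : V × W => (q, (0 : C(unitInterval, W)))) q h1
        (contDiffAt_id.prodMk contDiffAt_const)
    exact (ContinuousMap.evalCLM ℝ (1 : unitInterval)).contDiff.contDiffAt.comp q
      (contDiffAt_snd.comp q h2)
  refine ⟨fun q => (φ.symm (q, 0)).2 1, hZ, ?_, ?_⟩
  · have h1 : Tendsto (fun w : W => (((0 : V), w), ContinuousMap.const unitInterval w)) (𝓝 0)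
        (𝓝 (0 : (V × W) × C(unitInterval, W))) := by
      have h2 : Continuous fun w : W => (((0 : V), w), ContinuousMap.const unitInterval w) :=
        (Continuous.prodMk_right (0 : V)).prodMk
          (ContinuousLinearMap.const ℝ unitInterval (M := W)).continuous
      exact h2.tendsto' _ _ rfl
    filter_upwards [h1.eventually (Metric.ball_mem_nhds _ hρ)] with w hw
    rw [huniq _ _ hw]
    · rfl
    · have hin := (hρb _ hw).2
      have : superpos unitInterval b (rayPath V W ((0 : V), ContinuousMap.const unitInterval w)) =
          0 := by
        ext s
        rw [hSa (rayPath V W ((0 : V), ContinuousMap.const unitInterval w)) hin]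
        simp [rayPath_apply, hb]
      simp only [hG]
      rw [this]
      simp
  · filter_upwards [hgood, hZ] with q hq hqZ
    obtain ⟨hq1, hqG⟩ := hsol q hq.1
    obtain ⟨c, w⟩ := q
    set γ := (φ.symm ((c, w), 0)).2 with hγ
    have hy : φ.symm ((c, w), 0) = ((c, w), γ) := Prod.ext hq1 rfl
    have hyb : ((c, w), γ) ∈ Metric.ball (0 : (V × W) × C(unitInterval, W)) ρ := hy ▸ hq.2
    rw [hy] at hqG
    set f : ℝ → W := Set.IccExtend (zero_le_one' ℝ)
      (superpos unitInterval b (rayPath V W (c, γ))) with hf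
    have hfc : Continuous f := (ContinuousMap.continuous _).Icc_extend'
    have hγf : ∀ s : unitInterval, γ s = w + ∫ σ in (0 : ℝ)..s, f σ := by
      intro s
      have := congrArg (fun δ : C(unitInterval, W) => δ s) hqG
      simp only [hG, ContinuousMap.sub_apply, ContinuousMap.const_apply, ContinuousMap.zero_apply,
        pathPrimitive_apply] at this
      rw [sub_sub, sub_eq_zero] at this
      exact this
    have hfval : ∀ σ : unitInterval, f σ = a ((σ : ℝ) • c, γ σ) c := by
      intro σ
      rw [hf, Set.IccExtend_val, hSa (rayPath V W (c, γ)) (hρb _ hyb).2]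
      rfl
    -- The path `γ(s ·)` solves the problem for direction `s c` with the same initial value, and it
    -- remains in the ball where solutions are unique. Hence moving along the ray of `c` follows one
    -- solution.
    have hray : ∀ s : unitInterval, (φ.symm (((s : ℝ) • c, w), 0)).2 1 = γ s := by
      intro s
      set γs : C(unitInterval, W) := γ.comp ⟨fun t => s * t, by fun_prop⟩ with hγs
      have hsb : (((s : ℝ) • c, w), γs) ∈ Metric.ball (0 : (V × W) × C(unitInterval, W)) ρ := by
        rw [mem_ball_zero_iff] at hyb ⊢
        refine lt_of_le_of_lt ?_ hyb
        refine max_le (max_le ?_ ?_) ?_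
        · change ‖(s : ℝ) • c‖ ≤ _
          rw [norm_smul, Real.norm_of_nonneg s.2.1]
          exact (mul_le_of_le_one_left (norm_nonneg _) s.2.2).trans
            ((norm_fst_le (c, w)).trans (norm_fst_le ((c, w), γ)))
        · exact (norm_snd_le (c, w)).trans (norm_fst_le ((c, w), γ))
        · refine le_trans ?_ (norm_snd_le ((c, w), γ))
          exact (ContinuousMap.norm_le _ (norm_nonneg _)).2 fun t => γ.norm_coe_le_norm _
      rw [huniq _ _ hsb]
      · change γ (s * 1) = γ s
        rw [mul_one]
      · ext t
        simp only [hG, ContinuousMap.sub_apply, ContinuousMap.const_apply,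
          ContinuousMap.zero_apply, pathPrimitive_apply]
        rw [sub_sub, sub_eq_zero]
        change γ (s * t) = _
        rw [hγf]
        congr 1
        have hsub := intervalIntegral.smul_integral_comp_mul_left (a := (0 : ℝ)) (b := t) f (s : ℝ)
        rw [mul_zero] at hsub
        change ∫ σ in (0 : ℝ)..((s : ℝ) * t), f σ = _
        rw [← hsub, ← intervalIntegral.integral_smul]
        refine intervalIntegral.integral_congr fun σ hσ => ?_
        rw [Set.uIcc_of_le t.2.1] at hσ
        have hσ1 : σ ∈ Set.Icc (0 : ℝ) 1 := ⟨hσ.1, hσ.2.trans t.2.2⟩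
        change (s : ℝ) • f (s * σ) = Set.IccExtend _ _ σ
        rw [Set.IccExtend_of_mem _ _ hσ1, hSa (rayPath V W ((s : ℝ) • c, γs)) (hρb _ hsb).2]
        have := hfval (s * ⟨σ, hσ1⟩)
        change f (s * σ) = _ at this
        rw [this, rayPath_apply]
        simp only [hb, map_smul]
        change _ = (s : ℝ) • (a (σ • (s : ℝ) • c, γ (s * ⟨σ, hσ1⟩))) c
        rw [smul_smul, mul_comm σ]
        rfl
    have h1mem : (1 : ℝ) ∈ Set.Icc (0 : ℝ) 1 := by simp
    -- The identity with `γ` is available only for times in `[0, 1]`, so the two derivatives at time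
    -- 1 are compared from the left.
    have hd1 : HasDerivWithinAt (fun s : ℝ => (φ.symm ((s • c, w), 0)).2 1)
        (fderiv ℝ (fun q => (φ.symm (q, 0)).2 1) (c, w) (c, 0)) (Set.Icc 0 1) 1 := by
      have hc : HasDerivAt (fun s : ℝ => (s • c, w)) (c, 0) 1 := by
        have := ((hasDerivAt_id (1 : ℝ)).smul_const c).prodMk (hasDerivAt_const (1 : ℝ) w)
        simpa using this
      have hZd := (hqZ.differentiableAt hn0).hasFDerivAt
      have h1c : ((1 : ℝ) • c, w) = (c, w) := by rw [one_smul]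
      rw [← h1c] at hZd
      have := hZd.comp_hasDerivAt (1 : ℝ) hc
      rw [h1c] at this
      exact this.hasDerivWithinAt
    have hd2 : HasDerivWithinAt (fun s : ℝ => (φ.symm ((s • c, w), 0)).2 1)
        (a ((c, w).1, γ 1) (c, w).1) (Set.Icc 0 1) 1 := by
      have h2 : HasDerivAt (fun s => w + ∫ σ in (0 : ℝ)..s, f σ) (f 1) 1 :=
        (intervalIntegral.integral_hasDerivAt_right (hfc.intervalIntegrable _ _)
          (hfc.stronglyMeasurableAtFilter _ _) hfc.continuousAt).const_add w
      have h3 : f 1 = a (c, γ 1) c := by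
        have := hfval 1
        simpa using this
      rw [h3] at h2
      refine h2.hasDerivWithinAt.congr (fun s hs => ?_) ?_
      · exact (hray ⟨s, hs⟩).trans (hγf ⟨s, hs⟩)
      · exact (hray 1).trans (hγf 1)
    exact (uniqueDiffOn_Icc one_pos 1 h1mem).eq_deriv _ hd1 hd2

end Radial

/-! ### The Frobenius theorem -/

section Frobenius

variable {V W : Type} [NormedAddCommGroup V] [NormedSpace ℝ V] [NormedAddCommGroup W]
  [NormedSpace ℝ W]

/-- A radial solution `z` of a total differential equation `dz = a(c, z) dc` satisfying the
integrability condition is a solution. -/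
theorem fderiv_eq_of_radial {a : V × W → V →L[ℝ] W} {z : V → W} {ρ : ℝ}
    (hz : ContDiffOn ℝ 2 z (Metric.ball 0 ρ))
    (ha : ∀ c ∈ Metric.ball (0 : V) ρ, ContDiffAt ℝ 2 a (c, z c))
    (hrad : ∀ c ∈ Metric.ball (0 : V) ρ, fderiv ℝ z c c = a (c, z c) c)
    (hint : ∀ c ∈ Metric.ball (0 : V) ρ, ∀ u v, fderiv ℝ a (c, z c) (u, a (c, z c) u) v =
      fderiv ℝ a (c, z c) (v, a (c, z c) v) u) :
    ∀ c ∈ Metric.ball (0 : V) ρ, fderiv ℝ z c = a (c, z c) := by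
  intro c hc
  have hzd : ∀ x ∈ Metric.ball (0 : V) ρ, ContDiffAt ℝ 2 z x := fun x hx =>
    hz.contDiffAt (Metric.isOpen_ball.mem_nhds hx)
  have hz1 : ∀ x ∈ Metric.ball (0 : V) ρ, HasFDerivAt z (fderiv ℝ z x) x := fun x hx =>
    ((hzd x hx).differentiableAt (by simp)).hasFDerivAt
  have hz2 : ∀ x ∈ Metric.ball (0 : V) ρ, HasFDerivAt (fderiv ℝ z) (fderiv ℝ (fderiv ℝ z) x) x :=
    fun x hx => (((hzd x hx).fderiv_right (m := 1) (by norm_num)).differentiableAt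
      (by simp)).hasFDerivAt
  have hb : ∀ x ∈ Metric.ball (0 : V) ρ, HasFDerivAt (fun x => a (x, z x))
      ((fderiv ℝ a (x, z x)).comp ((ContinuousLinearMap.id ℝ V).prod (fderiv ℝ z x))) x :=
    fun x hx => HasFDerivAt.comp (f := fun x => (x, z x)) x
      (((ha x hx).differentiableAt (by simp)).hasFDerivAt) ((hasFDerivAt_id x).prodMk (hz1 x hx))
  set e : V → V →L[ℝ] W := fun x => fderiv ℝ z x - a (x, z x) with he
  set e' : V → V →L[ℝ] V →L[ℝ] W := fun x => fderiv ℝ (fderiv ℝ z) x -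
    (fderiv ℝ a (x, z x)).comp ((ContinuousLinearMap.id ℝ V).prod (fderiv ℝ z x)) with he'
  have hed : ∀ x ∈ Metric.ball (0 : V) ρ, HasFDerivAt e (e' x) x := fun x hx =>
    (hz2 x hx).sub (hb x hx)
  -- `e` is the defect of the full equation. The radial equation says `e x x = 0` on the ball; this
  -- is its derivative in the direction `v`.
  have hrad' : ∀ x ∈ Metric.ball (0 : V) ρ, ∀ v, e' x v x + e x v = 0 := by
    intro x hx v
    have h1 : HasFDerivAt (fun x => e x x) _ x := (hed x hx).clm_apply (hasFDerivAt_id x)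
    have h2 : HasFDerivAt (fun x => e x x) (0 : V →L[ℝ] W) x := by
      refine (hasFDerivAt_const (0 : W) x).congr_of_eventuallyEq ?_
      filter_upwards [Metric.isOpen_ball.mem_nhds hx] with y hy
      simp [he, hrad y hy]
    have := congrArg (fun L => L v) (h1.unique h2)
    simpa [add_comm] using this
  have hsymm : ∀ x ∈ Metric.ball (0 : V) ρ, ∀ u v,
      fderiv ℝ (fderiv ℝ z) x u v = fderiv ℝ (fderiv ℝ z) x v u := fun x hx u v =>
    (hzd x hx).isSymmSndFDerivAt (by simp) u v
  ext v
  have hseg : ∀ s ∈ Set.Icc (0 : ℝ) 1, s • c ∈ Metric.ball (0 : V) ρ := by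
    intro s hs
    rw [mem_ball_zero_iff] at hc ⊢
    rw [norm_smul, Real.norm_of_nonneg hs.1]
    exact (mul_le_of_le_one_left (norm_nonneg _) hs.2).trans_lt hc
  -- Along a ray, symmetry of the second derivative and the integrability condition leave a
  -- homogeneous linear equation for `s e(sc) v`. Its initial value is 0 and its coefficient is
  -- bounded by compactness, so Grönwall makes it vanish, in particular at `s = 1`.
  have hderiv : ∀ s ∈ Set.Icc (0 : ℝ) 1, HasDerivAt (fun s : ℝ => s • e (s • c) v)
      (fderiv ℝ a (s • c, z (s • c)) (0, s • e (s • c) v) c) s := by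
    intro s hs
    have hx := hseg s hs
    have h1 : HasDerivAt (fun s : ℝ => s • c) c s := by
      simpa using (hasDerivAt_id s).smul_const c
    have h2 : HasDerivAt (fun s : ℝ => e (s • c)) (e' (s • c) c) s :=
      (hed _ hx).comp_hasDerivAt s h1
    have h3 : HasDerivAt (fun s : ℝ => e (s • c) v) (e' (s • c) c v) s := by
      simpa using h2.clm_apply (hasDerivAt_const s v)
    have h4 := (hasDerivAt_id s).smul h3
    convert! h4 using 1
    have k1 := hrad' _ hx v
    have k2 := hint _ hx (s • c) v
    have k3 := hrad _ hx
    have k4 := hsymm _ hx c v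
    set x := s • c
    simp only [id, one_smul]
    conv_rhs => rw [eq_neg_of_add_eq_zero_right k1]
    have k5 : s • e' x c v = s • fderiv ℝ (fderiv ℝ z) x c v -
        fderiv ℝ a (x, z x) (x, a (x, z x) x) v := by
      rw [← k3]
      have : (x, fderiv ℝ z x x) = s • (c, fderiv ℝ z x c) := by
        simp [x, Prod.smul_mk]
      rw [this, map_smul]
      simp [he', smul_sub]
    have k6 : e' x v x = s • fderiv ℝ (fderiv ℝ z) x v c -
        fderiv ℝ a (x, z x) (v, fderiv ℝ z x v) x := by
      simp [he', x, smul_sub]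
    rw [k5, k6, k4, k2]
    have k7 : s • e x v = s • (fderiv ℝ z x v - a (x, z x) v) := rfl
    have k8 : ((0 : V), s • e x v) = s • ((v, fderiv ℝ z x v) - (v, a (x, z x) v)) := by
      simp [k7]
    rw [k8]
    simp only [map_smul, map_sub, smul_apply, sub_apply]
    simp only [x, map_smul, smul_sub]
    abel
  have hcont : ContinuousOn (fun s : ℝ => ‖fderiv ℝ a (s • c, z (s • c))‖) (Set.Icc 0 1) := by
    intro s hs
    have hx := hseg s hs
    have h1 : ContinuousAt (fderiv ℝ a) (s • c, z (s • c)) :=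
      ((ha _ hx).fderiv_right (m := 0) (by norm_num)).continuousAt
    have h2 : ContinuousAt (fun s : ℝ => (s • c, z (s • c))) s := by
      have h3 : ContinuousAt (fun s : ℝ => s • c) s := by fun_prop
      exact h3.prodMk (ContinuousAt.comp (f := fun s : ℝ => s • c) (hz1 _ hx).continuousAt h3)
    have h4 : ContinuousAt (fun s : ℝ => fderiv ℝ a (s • c, z (s • c))) s :=
      ContinuousAt.comp (f := fun s : ℝ => (s • c, z (s • c))) h1 h2
    have h5 : ContinuousAt (fun s : ℝ => ‖fderiv ℝ a (s • c, z (s • c))‖) s :=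
      ContinuousAt.norm (E := V × W →L[ℝ] V →L[ℝ] W) h4
    exact h5.continuousWithinAt
  obtain ⟨K, hK⟩ := (isCompact_Icc.image_of_continuousOn hcont).bddAbove
  have := eq_zero_of_abs_deriv_le_mul_abs_self_of_eq_zero_right (K := K * ‖c‖)
    (f := fun s : ℝ => s • e (s • c) v)
    (fun s hs => (hderiv s hs).continuousAt.continuousWithinAt)
    (fun s hs => (hderiv s (Set.Ico_subset_Icc_self hs)).hasDerivWithinAt) (by simp)
    (fun s hs => by
      have hs' := Set.Ico_subset_Icc_self hs
      refine ((fderiv ℝ a (s • c, z (s • c)) (0, s • e (s • c) v)).le_opNorm c).trans ?_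
      have h1 := (fderiv ℝ a (s • c, z (s • c))).le_opNorm (0, s • e (s • c) v)
      have h2 : ‖((0 : V), s • e (s • c) v)‖ = ‖s • e (s • c) v‖ := by simp [Prod.norm_mk]
      have h3 : ‖fderiv ℝ a (s • c, z (s • c))‖ ≤ K := hK ⟨s, hs', rfl⟩
      rw [h2] at h1
      calc _ ≤ ‖fderiv ℝ a (s • c, z (s • c))‖ * ‖s • e (s • c) v‖ * ‖c‖ := by gcongr
        _ ≤ K * ‖s • e (s • c) v‖ * ‖c‖ := by gcongr
        _ = K * ‖c‖ * ‖s • e (s • c) v‖ := by ring) 1 (by simp)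
  simpa [he, sub_eq_zero] using this

theorem exists_prod_equiv_of_injective {N m k : ℕ} (hN : N = m + k)
    (ξ : (Fin m → ℝ) →ₗ[ℝ] (Fin N → ℝ)) (hξ : Function.Injective ξ) :
    ∃ e : ((Fin m → ℝ) × (Fin k → ℝ)) ≃L[ℝ] (Fin N → ℝ), ∀ c, e (c, 0) = ξ c := by
  obtain ⟨Q, hQ⟩ := Submodule.exists_isCompl (LinearMap.range ξ)
  have h1 : Module.finrank ℝ (LinearMap.range ξ) = m := by
    rw [LinearMap.finrank_range_of_inj hξ]; simp
  have h2 := Submodule.finrank_add_eq_of_isCompl hQ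
  have h3 : Module.finrank ℝ (Fin k → ℝ) = Module.finrank ℝ Q := by
    simp only [Module.finrank_fin_fun] at h2 ⊢
    omega
  let e₁ := LinearEquiv.ofInjective ξ hξ
  let e₂ := LinearEquiv.ofFinrankEq (Fin k → ℝ) Q h3
  let e := (e₁.prodCongr e₂).trans (Submodule.prodEquivOfIsCompl _ Q hQ)
  exact ⟨e.toContinuousLinearEquiv, fun c => by simp [e, e₁]⟩

theorem IsDistribution.exists_param {n : WithTop ℕ∞} {N m : ℕ}
    {F : (Fin N → ℝ) → Submodule ℝ (Fin N → ℝ)} {p : Fin N → ℝ} (hF : IsDistribution n m F p) :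
    ∃ ξ : (Fin N → ℝ) → (Fin m → ℝ) →L[ℝ] (Fin N → ℝ), (∀ᶠ x in 𝓝 p, ContDiffAt ℝ n ξ x) ∧
      ∀ᶠ x in 𝓝 p, Function.Injective (ξ x) ∧ ∀ v, v ∈ F x ↔ ∃ d, ξ x d = v := by
  obtain ⟨X, hXs, hX⟩ := hF
  set ξ : (Fin N → ℝ) → (Fin m → ℝ) →L[ℝ] (Fin N → ℝ) := fun x =>
    ∑ i, (ContinuousLinearMap.proj (R := ℝ) (φ := fun _ : Fin m => ℝ) i).smulRight (X i x) with hξ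
  have hξa : ∀ x c, ξ x c = ∑ i, c i • X i x := by
    intro x c
    simp [hξ]
  refine ⟨ξ, ?_, ?_⟩
  · filter_upwards [eventually_all.2 hXs] with x hx
    refine ContDiffAt.sum fun i _ => ?_
    exact (ContinuousLinearMap.smulRightL ℝ (Fin m → ℝ) (Fin N → ℝ)
      (ContinuousLinearMap.proj (R := ℝ) (φ := fun _ : Fin m => ℝ) i)).contDiff.contDiffAt.comp x
      (hx i)
  · filter_upwards [hX] with x hx
    refine ⟨?_, fun v => ?_⟩
    · rw [injective_iff_map_eq_zero]
      intro c hc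
      rw [hξa] at hc
      funext i
      exact Fintype.linearIndependent_iff.1 hx.1 c hc i
    · rw [hx.2, Submodule.mem_span_range_iff_exists_fun]
      simp only [hξa]

/-- In a splitting with first factor `F p`, projection of `F x` to that factor stays invertible for
`x` near `p`. The normalisation `A p = 0` makes the chart built in `exists_first_integrals` have
derivative `e` at 0. -/
theorem exists_graph_of_isDistribution {n : WithTop ℕ∞} {N m k : ℕ} (hN : N = m + k)
    {F : (Fin N → ℝ) → Submodule ℝ (Fin N → ℝ)} {p : Fin N → ℝ} (hF : IsDistribution n m F p) :
    ∃ (e : ((Fin m → ℝ) × (Fin k → ℝ)) ≃L[ℝ] (Fin N → ℝ))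
      (A : (Fin N → ℝ) → (Fin m → ℝ) →L[ℝ] (Fin k → ℝ)), (∀ᶠ x in 𝓝 p, ContDiffAt ℝ n A x) ∧
      A p = 0 ∧ ∀ᶠ x in 𝓝 p, ∀ v, v ∈ F x ↔ ∃ c, v = e (c, A x c) := by
  obtain ⟨ξ, hξs, hξ⟩ := hF.exists_param
  have hξF := hξ.mono fun x hx => hx.2
  have hinj := hξ.self_of_nhds.1
  obtain ⟨e, he⟩ := exists_prod_equiv_of_injective hN (ξ p : (Fin m → ℝ) →ₗ[ℝ] (Fin N → ℝ)) hinj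
  set B : (Fin N → ℝ) → (Fin m → ℝ) →L[ℝ] (Fin m → ℝ) := fun x =>
    ((ContinuousLinearMap.fst ℝ (Fin m → ℝ) (Fin k → ℝ)).comp (e.symm : (Fin N → ℝ) →L[ℝ] _)).comp (ξ x) with hB
  set C : (Fin N → ℝ) → (Fin m → ℝ) →L[ℝ] (Fin k → ℝ) := fun x =>
    ((ContinuousLinearMap.snd ℝ (Fin m → ℝ) (Fin k → ℝ)).comp (e.symm : (Fin N → ℝ) →L[ℝ] _)).comp (ξ x) with hC
  have hsymm : ∀ c, e.symm (ξ p c) = (c, 0) := fun c => by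
    rw [e.symm_apply_eq, he]; rfl
  have hBp : B p = ContinuousLinearMap.id ℝ _ := by
    ext1 c; simp [hB, hsymm]
  have hCp : C p = 0 := by
    ext1 c; simp [hC, hsymm]
  have hBs : ∀ᶠ x in 𝓝 p, ContDiffAt ℝ n B x := by
    filter_upwards [hξs] with x hx
    exact contDiffAt_const.clm_comp hx
  have hCs : ∀ᶠ x in 𝓝 p, ContDiffAt ℝ n C x := by
    filter_upwards [hξs] with x hx
    exact contDiffAt_const.clm_comp hx
  have hBinv : ∀ᶠ x in 𝓝 p, (B x).IsInvertible := by
    have h := ContinuousLinearEquiv.nhds (ContinuousLinearEquiv.refl ℝ (Fin m → ℝ))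
    have hc : ContinuousAt B p := hBs.self_of_nhds.continuousAt
    refine hc.eventually ?_
    rw [hBp]
    exact h
  refine ⟨e, fun x => (C x).comp (B x).inverse, ?_, ?_, ?_⟩
  · filter_upwards [hBs, hCs, hBinv] with x h1 h2 h3
    exact h2.clm_comp (ContDiffAt.comp x h3.contDiffAt_map_inverse h1)
  · change (C p).comp _ = 0
    rw [hCp, ContinuousLinearMap.zero_comp]
  · filter_upwards [hξF, hBinv] with x h1 h2 v
    obtain ⟨b, hb⟩ := h2
    have hBinverse : (B x).inverse = b.symm := by rw [← hb]; simp
    have hsplit : ∀ d, ξ x d = e (b d, C x d) := by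
      intro d
      rw [← e.symm_apply_eq]
      have : b d = B x d := by rw [← hb]; rfl
      rw [this]
      rfl
    rw [h1, hBinverse]
    constructor
    · rintro ⟨d, rfl⟩
      exact ⟨b d, by simp [hsplit]⟩
    · rintro ⟨c, rfl⟩
      exact ⟨b.symm c, by simp [hsplit]⟩

/-- Frobenius: with `F` written as a graph, leaves are solutions of the total differential equation
`dz = a(c, z) dc`. Solving it radially with initial value `w` gives a chart whose slices with `w`
fixed are the leaves, and the integrals are the components of `w`. -/
theorem exists_first_integrals {n : WithTop ℕ∞} (hn : n = ∞ ∨ n = ω) {N m k : ℕ} (hN : N = m + k)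
    {F : (Fin N → ℝ) → Submodule ℝ (Fin N → ℝ)} {p : Fin N → ℝ} (hF : IsDistribution n m F p)
    (hinv : ∀ᶠ x in 𝓝 p, lieSquare n F x ≤ F x) :
    ∃ u : (Fin N → ℝ) → (Fin k → ℝ), (∀ᶠ x in 𝓝 p, ContDiffAt ℝ n u x) ∧
      Function.Surjective (fderiv ℝ u p) ∧ ∀ᶠ x in 𝓝 p, ∀ v ∈ F x, fderiv ℝ u x v = 0 := by
  have hn1 : 1 ≤ n := by rcases hn with rfl | rfl <;> simp
  have hn2 : 2 ≤ n := natCast_le_of_infty_or_omega hn 2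
  have hn0 : n ≠ 0 := (lt_of_lt_of_le one_pos hn1).ne'
  obtain ⟨e, A, hAs, hAp, hAF⟩ := exists_graph_of_isDistribution hN hF
  -- The fields `y ↦ e (c, A y c)` have constant first component, so their brackets have first
  -- component 0. Lying in the graph `F`, these brackets must vanish, and this is the integrability
  -- condition.
  have hint : ∀ᶠ x in 𝓝 p, ∀ c d, fderiv ℝ A x (e (c, A x c)) d = fderiv ℝ A x (e (d, A x d)) c := by
    filter_upwards [hAs.eventually_nhds, hAF.eventually_nhds, hinv] with x h1 h2 h3 c d
    have hA' : HasFDerivAt A (fderiv ℝ A x) x :=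
      (h1.self_of_nhds.differentiableAt hn0).hasFDerivAt
    have hYs : ∀ c, IsSection n F x fun y => e (c, A y c) := by
      intro c
      refine ⟨?_, ?_⟩
      · filter_upwards [h1] with y hy
        exact e.contDiff.contDiffAt.comp y (contDiffAt_const.prodMk (hy.clm_apply contDiffAt_const))
      · filter_upwards [h2] with y hy
        exact (hy _).2 ⟨c, rfl⟩
    have hYd : ∀ c, HasFDerivAt (fun y => e (c, A y c))
        ((e : _ →L[ℝ] _).comp ((0 : (Fin N → ℝ) →L[ℝ] (Fin m → ℝ)).prod
          ((fderiv ℝ A x).flip c))) x := by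
      intro c
      have h := hA'.clm_apply (hasFDerivAt_const c x)
      have h' := e.hasFDerivAt.comp x ((hasFDerivAt_const c x).prodMk h)
      simpa using h'
    have hbr : VectorField.lieBracket ℝ (fun y => e (c, A y c)) (fun y => e (d, A y d)) x ∈ F x :=
      h3 (Submodule.mem_sup_right (Submodule.subset_span ⟨_, _, hYs c, hYs d, rfl⟩))
    rw [VectorField.lieBracket_eq] at hbr
    beta_reduce at hbr
    rw [(hYd c).fderiv, (hYd d).fderiv] at hbr
    obtain ⟨c', hc'⟩ := (h2.self_of_nhds _).1 hbr
    simp only [ContinuousLinearMap.comp_apply, ContinuousLinearEquiv.coe_coe, ← map_sub] at hc'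
    have hc'' := e.injective hc'
    have h5 : c' = 0 := by simpa using (congrArg Prod.fst hc'').symm
    have h6 := congrArg Prod.snd hc''
    rw [h5] at h6
    simpa [sub_eq_zero] using h6
  set a : (Fin m → ℝ) × (Fin k → ℝ) → (Fin m → ℝ) →L[ℝ] (Fin k → ℝ) := fun q => A (p + e q) with ha
  have hpe : Tendsto (fun q => p + e q) (𝓝 0) (𝓝 p) := by
    have : Continuous fun q => p + e q := by fun_prop
    exact this.tendsto' _ _ (by simp)
  have has : ∀ᶠ q in 𝓝 0, ContDiffAt ℝ n a q := by
    filter_upwards [hpe.eventually hAs] with q hq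
    exact ContDiffAt.comp (f := fun q => p + e q) q hq (by fun_prop)
  have haint : ∀ᶠ q in 𝓝 0, ∀ c d, fderiv ℝ a q (c, a q c) d = fderiv ℝ a q (d, a q d) c := by
    filter_upwards [hpe.eventually hint, hpe.eventually hAs] with q hq hs c d
    have : HasFDerivAt a ((fderiv ℝ A (p + e q)).comp (e : _ →L[ℝ] _)) q :=
      HasFDerivAt.comp (f := fun q => p + e q) q (hs.differentiableAt hn0).hasFDerivAt
        (e.hasFDerivAt.const_add p)
    rw [this.fderiv]
    exact hq c d
  obtain ⟨Z, hZs, hZ0, hZr⟩ := exists_radial_solution hn has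
  have hZ00 : Z 0 = 0 := hZ0.self_of_nhds
  have hqZ : Tendsto (fun q : (Fin m → ℝ) × (Fin k → ℝ) => (q.1, Z q)) (𝓝 0) (𝓝 0) := by
    have h1 : ContinuousAt (fun q : (Fin m → ℝ) × (Fin k → ℝ) => (q.1, Z q)) 0 :=
      continuousAt_fst.prodMk hZs.self_of_nhds.continuousAt
    have h2 := h1.tendsto
    rwa [hZ00] at h2
  have hZd : ∀ᶠ q in 𝓝 0, ∀ c, fderiv ℝ Z q (c, 0) = a (q.1, Z q) c := by
    obtain ⟨ρ, hρ, hb⟩ := Metric.eventually_nhds_iff_ball.1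
      (hZs.and (hZr.and (hqZ.eventually (has.and haint))))
    filter_upwards [Metric.ball_mem_nhds 0 hρ] with q hq
    obtain ⟨c, w⟩ := q
    have hw : ‖w‖ < ρ := (norm_snd_le (c, w)).trans_lt (mem_ball_zero_iff.1 hq)
    have hmem : ∀ c' ∈ Metric.ball (0 : Fin m → ℝ) ρ, (c', w) ∈
        Metric.ball (0 : (Fin m → ℝ) × (Fin k → ℝ)) ρ := fun c' hc' => by
      rw [mem_ball_zero_iff] at hc' ⊢
      exact max_lt hc' hw
    have hzder : ∀ c' ∈ Metric.ball (0 : Fin m → ℝ) ρ, HasFDerivAt (fun c => Z (c, w))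
        ((fderiv ℝ Z (c', w)).comp (.inl ℝ _ _)) c' := fun c' hc' =>
      HasFDerivAt.comp (f := fun c => (c, w)) c'
        ((hb _ (hmem c' hc')).1.differentiableAt hn0).hasFDerivAt (hasFDerivAt_prodMk_left c' w)
    have key := fderiv_eq_of_radial (a := a) (z := fun c => Z (c, w)) (ρ := ρ)
      (fun c' hc' => (ContDiffAt.comp (f := fun c => (c, w)) c'
        ((hb _ (hmem c' hc')).1.of_le hn2) (by fun_prop)).contDiffWithinAt)
      (fun c' hc' => (hb _ (hmem c' hc')).2.2.1.of_le hn2)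
      (fun c' hc' => by
        rw [(hzder c' hc').fderiv]
        exact (hb _ (hmem c' hc')).2.1)
      (fun c' hc' u v => (hb _ (hmem c' hc')).2.2.2 u v) c
      (mem_ball_zero_iff.2 ((norm_fst_le (c, w)).trans_lt (mem_ball_zero_iff.1 hq)))
    intro v
    rw [(hzder c (mem_ball_zero_iff.2
      ((norm_fst_le (c, w)).trans_lt (mem_ball_zero_iff.1 hq)))).fderiv] at key
    exact congrArg (fun L => L v) key
  set Φ : (Fin m → ℝ) × (Fin k → ℝ) → (Fin N → ℝ) := fun q => p + e (q.1, Z q) with hΦ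
  have hΦs : ∀ᶠ q in 𝓝 0, ContDiffAt ℝ n Φ q := by
    filter_upwards [hZs] with q hq
    exact contDiffAt_const.add (e.contDiff.contDiffAt.comp q (contDiffAt_fst.prodMk hq))
  have hΦd : ∀ᶠ q in 𝓝 0, HasFDerivAt Φ ((e : _ →L[ℝ] _).comp
      ((ContinuousLinearMap.fst ℝ _ _).prod (fderiv ℝ Z q))) q := by
    filter_upwards [hZs] with q hq
    exact (e.hasFDerivAt.comp q (HasFDerivAt.prodMk (f₁ := Prod.fst) hasFDerivAt_fst
      (hq.differentiableAt hn0).hasFDerivAt)).const_add p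
  have hZd0 : fderiv ℝ Z 0 = ContinuousLinearMap.snd ℝ _ _ := by
    have h1 : HasFDerivAt (fun w => Z (0, w)) ((fderiv ℝ Z 0).comp (.inr ℝ _ _)) 0 :=
      HasFDerivAt.comp (f := fun w : Fin k → ℝ => ((0 : Fin m → ℝ), w)) 0
        (hZs.self_of_nhds.differentiableAt hn0).hasFDerivAt (hasFDerivAt_prodMk_right _ _)
    have h2 : HasFDerivAt (fun w => Z (0, w)) (.id ℝ _) 0 :=
      (hasFDerivAt_id _).congr_of_eventuallyEq hZ0
    have h3 := h1.unique h2
    refine ContinuousLinearMap.ext fun q => ?_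
    have h4 : q = (q.1, 0) + (0, q.2) := by simp
    have h5 := hZd.self_of_nhds q.1
    have h6 : a ((0 : (Fin m → ℝ) × (Fin k → ℝ)).1, Z 0) = 0 := by
      rw [hZ00]
      simp only [ha, Prod.fst_zero]
      rw [show ((0 : Fin m → ℝ), (0 : Fin k → ℝ)) = 0 from rfl, map_zero, add_zero, hAp]
    rw [h6] at h5
    have h7 : fderiv ℝ Z 0 (0, q.2) = q.2 := congrArg (fun L => L q.2) h3
    rw [h4, map_add, h5, h7]
    simp
  have hΦ0 : Φ 0 = p := by
    simp only [hΦ, hZ00]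
    rw [show ((0 : (Fin m → ℝ) × (Fin k → ℝ)).1, (0 : Fin k → ℝ)) = 0 from rfl]
    simp
  have hΦd0 : HasFDerivAt Φ (e : _ →L[ℝ] _) 0 := by
    convert hΦd.self_of_nhds using 1
    rw [hZd0]
    refine ContinuousLinearMap.ext fun q => ?_
    simp
  obtain ⟨φ, hφ0, hφ, hφU, -, hφs⟩ := exists_local_diffeo hn1 (hΦd.and hZd) hΦs e hΦd0
  have hpt : p ∈ φ.target := by
    have := φ.map_source hφ0
    rwa [hφ, hΦ0] at this
  have hφp : φ.symm p = 0 := by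
    have := φ.left_inv hφ0
    rwa [hφ, hΦ0] at this
  have hsd : ∀ x ∈ φ.target, ContDiffAt ℝ n φ.symm x := fun x hx =>
    hφs.contDiffAt (φ.open_target.mem_nhds hx)
  have hsnd : ∀ x ∈ φ.target, HasFDerivAt (fun x => (φ.symm x).2)
      ((ContinuousLinearMap.snd ℝ _ _).comp (fderiv ℝ φ.symm x)) x := fun x hx =>
    HasFDerivAt.comp (g := Prod.snd) x hasFDerivAt_snd ((hsd x hx).differentiableAt hn0).hasFDerivAt
  have hinvd : ∀ q ∈ φ.source, ∀ L : _ →L[ℝ] _, HasFDerivAt Φ L q →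
      ∀ v, fderiv ℝ φ.symm (Φ q) (L v) = v := by
    intro q hq L hL v
    -- `φ` agrees with `Φ`, so a derivative `L` of `Φ` at `q` is undone by the derivative of the
    -- inverse chart.
    have hx : Φ q ∈ φ.target := by
      rw [← hφ]; exact φ.map_source hq
    have h1 := ((hsd _ hx).differentiableAt hn0).hasFDerivAt.comp q hL
    have h2 : HasFDerivAt (φ.symm ∘ Φ) (.id ℝ _) q := by
      refine (hasFDerivAt_id _).congr_of_eventuallyEq ?_
      filter_upwards [φ.open_source.mem_nhds hq] with y hy
      have := φ.left_inv hy
      rw [hφ] at this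
      exact this
    exact congrArg (fun L => L v) (h1.unique h2)
  refine ⟨fun x => (φ.symm x).2, ?_, ?_, ?_⟩
  · filter_upwards [φ.open_target.mem_nhds hpt] with x hx
    exact contDiffAt_snd.comp x (hsd x hx)
  · intro w
    have := hinvd 0 hφ0 e hΦd0 (0, w)
    rw [hΦ0] at this
    refine ⟨e (0, w), ?_⟩
    rw [(hsnd p hpt).fderiv]
    change (fderiv ℝ φ.symm p (e (0, w))).2 = w
    have h2 := congrArg Prod.snd this
    exact h2
  · filter_upwards [φ.open_target.mem_nhds hpt, hAF] with x hx hxF v hv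
    obtain ⟨c, rfl⟩ := (hxF v).1 hv
    have hq := φ.map_target hx
    have hΦx : Φ (φ.symm x) = x := by rw [← hφ]; exact φ.right_inv hx
    obtain ⟨h1, h2⟩ := hφU hq
    have h3 := hinvd _ hq _ h1 (c, 0)
    have h4 : a ((φ.symm x).1, Z (φ.symm x)) = A x := by
      simp only [ha]
      congr 1
    rw [hΦx] at h3
    simp only [ContinuousLinearMap.comp_apply, ContinuousLinearMap.prod_apply, h2 c, h4] at h3
    rw [(hsnd x hx).fderiv]
    change (fderiv ℝ φ.symm x (e (c, A x c))).2 = 0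
    have h5 := congrArg Prod.snd h3
    exact h5

end Frobenius

/-! ### Prolongation of distributions -/

section Prolongation

variable {n : WithTop ℕ∞} {N : ℕ}

theorem IsSection.eventually {D : (Fin N → ℝ) → Submodule ℝ (Fin N → ℝ)} {p : Fin N → ℝ}
    {X : (Fin N → ℝ) → (Fin N → ℝ)} (h : IsSection n D p X) : ∀ᶠ x in 𝓝 p, IsSection n D x X := by
  filter_upwards [h.1.eventually_nhds, h.2.eventually_nhds] with x h1 h2 using ⟨h1, h2⟩

theorem IsSection.mono {D D' : (Fin N → ℝ) → Submodule ℝ (Fin N → ℝ)} {p : Fin N → ℝ}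
    {X : (Fin N → ℝ) → (Fin N → ℝ)} (h : IsSection n D p X) (hD : ∀ᶠ x in 𝓝 p, D x ≤ D' x) :
    IsSection n D' p X :=
  ⟨h.1, by filter_upwards [h.2, hD] with x h1 h2 using h2 h1⟩

theorem fderiv_apply_lieBracket_eq {f : (Fin N → ℝ) → ℝ} {X Y : (Fin N → ℝ) → (Fin N → ℝ)}
    {x : Fin N → ℝ} (hf : ContDiffAt ℝ 2 f x) (hX : DifferentiableAt ℝ X x)
    (hY : DifferentiableAt ℝ Y x) :
    fderiv ℝ f x (VectorField.lieBracket ℝ X Y x) =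
      fderiv ℝ (fun y => fderiv ℝ f y (Y y)) x (X x) -
        fderiv ℝ (fun y => fderiv ℝ f y (X y)) x (Y x) :=
  VectorField.fderiv_apply_lieBracket hf (by simp) hY hX

theorem differentiableAt_fderiv_apply {f : (Fin N → ℝ) → ℝ} {X : (Fin N → ℝ) → (Fin N → ℝ)}
    {x : Fin N → ℝ} (hf : ContDiffAt ℝ 2 f x) (hX : DifferentiableAt ℝ X x) :
    DifferentiableAt ℝ (fun y => fderiv ℝ f y (X y)) x :=
  ((hf.fderiv_right (m := 1) (by norm_num)).differentiableAt (by simp)).clm_apply hX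

/-- The structure equation of the Pfaffian equation `df = a dg`. -/
theorem fderiv_lieBracket_of_pfaff {f g a : (Fin N → ℝ) → ℝ} {X Y : (Fin N → ℝ) → (Fin N → ℝ)}
    {x : Fin N → ℝ} (hf : ContDiffAt ℝ 2 f x) (hg : ContDiffAt ℝ 2 g x)
    (ha : DifferentiableAt ℝ a x) (hX : DifferentiableAt ℝ X x) (hY : DifferentiableAt ℝ Y x)
    (hXf : ∀ᶠ y in 𝓝 x, fderiv ℝ f y (X y) = a y * fderiv ℝ g y (X y))
    (hYf : ∀ᶠ y in 𝓝 x, fderiv ℝ f y (Y y) = a y * fderiv ℝ g y (Y y)) :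
    fderiv ℝ f x (VectorField.lieBracket ℝ X Y x) =
      a x * fderiv ℝ g x (VectorField.lieBracket ℝ X Y x) +
        (fderiv ℝ a x (X x) * fderiv ℝ g x (Y x) - fderiv ℝ a x (Y x) * fderiv ℝ g x (X x)) := by
  rw [fderiv_apply_lieBracket_eq hf hX hY, fderiv_apply_lieBracket_eq hg hX hY,
    Filter.EventuallyEq.fderiv_eq hYf, Filter.EventuallyEq.fderiv_eq hXf,
    fderiv_fun_mul ha (differentiableAt_fderiv_apply hg hY),
    fderiv_fun_mul ha (differentiableAt_fderiv_apply hg hX)]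
  simp only [add_apply, smul_apply, smul_eq_mul]
  ring

theorem IsDistribution.finrank_eq {m : ℕ} {D : (Fin N → ℝ) → Submodule ℝ (Fin N → ℝ)}
    {p : Fin N → ℝ} (hD : IsDistribution n m D p) :
    ∀ᶠ x in 𝓝 p, Module.finrank ℝ (D x) = m := by
  obtain ⟨X, -, hX⟩ := hD
  filter_upwards [hX] with x hx
  rw [hx.2, finrank_span_eq_card hx.1, Fintype.card_fin]

theorem contDiffAt_fderiv_apply (hn : n = ∞ ∨ n = ω) {f : (Fin N → ℝ) → ℝ}
    {X : (Fin N → ℝ) → (Fin N → ℝ)} {x : Fin N → ℝ} (hf : ContDiffAt ℝ n f x)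
    (hX : ContDiffAt ℝ n X x) : ContDiffAt ℝ n (fun y => fderiv ℝ f y (X y)) x :=
  (hf.fderiv_right (add_one_le_of_infty_or_omega hn)).clm_apply hX

/-- A right inverse `R` of `M p` is kept fixed: nearby, `M x ∘ R` is still invertible. This provides
right inverses depending smoothly on `x`. -/
theorem eventually_surjective {E F : Type*} [NormedAddCommGroup E] [NormedSpace ℝ E]
    [NormedAddCommGroup F] [NormedSpace ℝ F] [FiniteDimensional ℝ F] {α : Type*}
    [TopologicalSpace α] {M : α → E →L[ℝ] F} {p : α} (hM : ContinuousAt M p)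
    (hs : Function.Surjective (M p)) :
    ∃ R : F →L[ℝ] E, ∀ᶠ x in 𝓝 p, ((M x).comp R).IsInvertible := by
  have : CompleteSpace F := FiniteDimensional.complete ℝ F
  obtain ⟨R, hR⟩ := (M p : E →ₗ[ℝ] F).exists_rightInverse_of_surjective
    (LinearMap.range_eq_top.2 hs)
  refine ⟨LinearMap.toContinuousLinearMap R, ?_⟩
  have hc : ContinuousAt (fun x => (M x).comp (LinearMap.toContinuousLinearMap R)) p :=
    hM.clm_comp continuousAt_const
  have hp : (M p).comp (LinearMap.toContinuousLinearMap R) = ContinuousLinearEquiv.refl ℝ F := by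
    ext1 w
    exact congrArg (fun L => L w) hR
  refine hc.eventually ?_
  beta_reduce
  rw [hp]
  exact ContinuousLinearEquiv.nhds _

/-- Functions `h 0, h 1, h 2` with independent differentials on the distribution `Δ`, such that the
sections of `Δ` annihilated by these differentials are Cauchy characteristics of `Δ`. -/
structure IsCauchyTriple (n : WithTop ℕ∞) (Δ : (Fin N → ℝ) → Submodule ℝ (Fin N → ℝ))
    (p : Fin N → ℝ) (h : Fin 3 → (Fin N → ℝ) → ℝ) : Prop where
  smooth : ∀ i, ∀ᶠ x in 𝓝 p, ContDiffAt ℝ n (h i) x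
  surj : ∀ y : Fin 3 → ℝ, ∃ v ∈ Δ p, ∀ i, fderiv ℝ (h i) p v = y i
  bracket_mem : ∀ᶠ x in 𝓝 p, ∀ X Y, IsSection n Δ x X → IsSection n Δ x Y →
    (∀ i, ∀ᶠ y in 𝓝 x, fderiv ℝ (h i) y (X y) = 0) → VectorField.lieBracket ℝ X Y x ∈ Δ x

variable {Δ Δ' : (Fin N → ℝ) → Submodule ℝ (Fin N → ℝ)} {p : Fin N → ℝ}
  {h : Fin 3 → (Fin N → ℝ) → ℝ}

theorem IsCauchyTriple.perm (H : IsCauchyTriple n Δ p h) (σ : Equiv.Perm (Fin 3)) :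
    IsCauchyTriple n Δ p (fun i => h (σ i)) where
  smooth i := H.smooth (σ i)
  surj y := by
    obtain ⟨v, hv, hvy⟩ := H.surj fun i => y (σ.symm i)
    exact ⟨v, hv, fun i => by simpa using hvy (σ i)⟩
  bracket_mem := by
    filter_upwards [H.bracket_mem] with x hx X Y hX hY hk
    exact hx X Y hX hY fun i => by simpa using hk (σ.symm i)

/-- Every vector of a distribution annihilated by three differentials which are independent on the
distribution extends to a section with the same property. -/
theorem exists_section_of_annihilated (hn : n = ∞ ∨ n = ω) {m : ℕ} (hΔ : IsDistribution n m Δ p)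
    (hs : ∀ i, ∀ᶠ x in 𝓝 p, ContDiffAt ℝ n (h i) x)
    (hsurj : ∀ y : Fin 3 → ℝ, ∃ v ∈ Δ p, ∀ i, fderiv ℝ (h i) p v = y i) :
    ∀ᶠ x in 𝓝 p, ∀ v ∈ Δ x, (∀ i, fderiv ℝ (h i) x v = 0) →
      ∃ X, IsSection n Δ x X ∧ (∀ i, ∀ᶠ y in 𝓝 x, fderiv ℝ (h i) y (X y) = 0) ∧ X x = v := by
  obtain ⟨ξ, hξs, hξ⟩ := hΔ.exists_param
  set M : (Fin N → ℝ) → (Fin m → ℝ) →L[ℝ] (Fin 3 → ℝ) := fun x =>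
    ContinuousLinearMap.pi fun i => (fderiv ℝ (h i) x).comp (ξ x) with hM
  have hMs : ∀ᶠ x in 𝓝 p, ContDiffAt ℝ n M x := by
    filter_upwards [eventually_all.2 hs, hξs] with x h1 h2
    have hsum : M = fun x => ∑ i, (ContinuousLinearMap.single ℝ (fun _ : Fin 3 => ℝ) i).comp
        ((fderiv ℝ (h i) x).comp (ξ x)) := by
      funext x
      ext1 c
      funext i
      simp [hM, Finset.sum_apply, Pi.single_apply]
    rw [hsum]
    exact ContDiffAt.sum fun i _ => contDiffAt_const.clm_comp
      (((h1 i).fderiv_right (add_one_le_of_infty_or_omega hn)).clm_comp h2)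
  have hMp : Function.Surjective (M p) := by
    intro y
    obtain ⟨v, hv, hvy⟩ := hsurj y
    obtain ⟨d, rfl⟩ := (hξ.self_of_nhds.2 v).1 hv
    exact ⟨d, funext hvy⟩
  obtain ⟨R, hR⟩ := eventually_surjective hMs.self_of_nhds.continuousAt hMp
  filter_upwards [hξs.eventually_nhds, hξ.eventually_nhds, hMs.eventually_nhds, hR.eventually_nhds]
    with x h1 h2 h3 h4 v hv hv0
  obtain ⟨d, rfl⟩ := (h2.self_of_nhds.2 v).1 hv
  have hMd : M x d = 0 := funext hv0
  -- The coefficient vector is projected onto the kernel of `M y` along the range of `R`. At `x`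
  -- nothing changes, because `M x d = 0`.
  refine ⟨fun y => ξ y (d - R (((M y).comp R).inverse (M y d))), ⟨?_, ?_⟩, ?_, ?_⟩
  · filter_upwards [h1, h3, h4] with y k1 k3 k4
    refine k1.clm_apply (contDiffAt_const.sub (R.contDiff.contDiffAt.comp y ?_))
    have k5 : ContDiffAt ℝ n (fun y => (M y).comp R) y := k3.clm_comp contDiffAt_const
    have k6 : ContDiffAt ℝ n (fun y => ((M y).comp R).inverse) y :=
      ContDiffAt.comp (f := fun y => (M y).comp R) y k4.contDiffAt_map_inverse k5
    exact k6.clm_apply (k3.clm_apply contDiffAt_const)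
  · filter_upwards [h2] with y k2
    exact (k2.2 _).2 ⟨_, rfl⟩
  · intro i
    filter_upwards [h4] with y k4
    obtain ⟨b, hb⟩ := k4
    have k5 : M y (d - R (((M y).comp R).inverse (M y d))) = 0 := by
      have k6 : ((M y).comp R).inverse = b.symm := by rw [← hb]; simp
      have k7 : M y (R (b.symm (M y d))) = b (b.symm (M y d)) := by
        change ((M y).comp R) _ = _
        rw [← hb]; rfl
      rw [map_sub, k6]
      change M y d - M y (R (b.symm (M y d))) = 0
      rw [k7, b.apply_symm_apply, sub_self]
    exact congrFun k5 i
  · simp [hMd]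

/-- `cauchyChar` asks for a section with the bracket property near the point, not just a vector,
hence the need for an extension that stays annihilated. -/
theorem IsCauchyTriple.mem_cauchyChar (hn : n = ∞ ∨ n = ω) {m : ℕ} (hΔ : IsDistribution n m Δ p)
    (H : IsCauchyTriple n Δ p h) :
    ∀ᶠ x in 𝓝 p, ∀ v ∈ Δ x, (∀ i, fderiv ℝ (h i) x v = 0) → v ∈ cauchyChar n Δ x := by
  filter_upwards [exists_section_of_annihilated hn hΔ H.smooth H.surj, H.bracket_mem.eventually_nhds]
    with x h1 h2 v hv hv0
  obtain ⟨X, hX, hXh, rfl⟩ := h1 v hv hv0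
  refine Submodule.subset_span ⟨X, hX, fun Y hY => ?_, rfl⟩
  filter_upwards [h2, hX.eventually, hY.eventually,
    eventually_all.2 fun i => (hXh i).eventually_nhds] with y k1 k2 k3 k4
  exact k1 X Y k2 k3 k4

theorem finrank_le_of_annihilated {K : Type*} [AddCommGroup K] [Module ℝ K] [FiniteDimensional ℝ K]
    {k : ℕ} (L : K →ₗ[ℝ] (Fin k → ℝ)) (hL : Function.Surjective L) (S : Submodule ℝ K)
    (hS : ∀ v ∈ S, L v = 0) : Module.finrank ℝ S + k ≤ Module.finrank ℝ K := by
  have h1 := LinearMap.finrank_range_add_finrank_ker L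
  rw [LinearMap.range_eq_top.2 hL, finrank_top, Module.finrank_fin_fun] at h1
  have h2 : Module.finrank ℝ S ≤ Module.finrank ℝ (LinearMap.ker L) :=
    Submodule.finrank_mono fun v hv => hS v hv
  omega

/-- Three independent functionals cannot all vanish on a subspace of codimension two. This supplies
the function whose differential serves as base in the next pair of equations. -/
theorem IsCauchyTriple.exists_ne {S : Submodule ℝ (Fin N → ℝ)} {m : ℕ} (H : IsCauchyTriple n Δ p h)
    (hm : Module.finrank ℝ (Δ p) = m + 2) (hle : S ≤ Δ p) (hS : Module.finrank ℝ S = m) :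
    ∃ i, ∃ v ∈ S, fderiv ℝ (h i) p v ≠ 0 := by
  by_contra! hcon
  let L : Δ p →ₗ[ℝ] (Fin 3 → ℝ) :=
    LinearMap.pi fun i => (fderiv ℝ (h i) p : (Fin N → ℝ) →ₗ[ℝ] ℝ).comp (Δ p).subtype
  have h1 := finrank_le_of_annihilated L (fun y => by
    obtain ⟨v, hv, hvy⟩ := H.surj y
    exact ⟨⟨v, hv⟩, funext hvy⟩) (S.comap (Δ p).subtype) (fun v hv => by
      funext i
      exact hcon i v hv)
  rw [hm, (Submodule.comapSubtypeEquivOfLe hle).finrank_eq, hS] at h1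
  omega

theorem exists_dual_of_not_surjective {K : Type*} [AddCommGroup K] [Module ℝ K]
    {k : ℕ} (L : K →ₗ[ℝ] (Fin k → ℝ)) (hL : ¬ Function.Surjective L) :
    ∃ y : Fin k → ℝ, y ≠ 0 ∧ ∀ v, ∑ i, y i * L v i = 0 := by
  obtain ⟨f, hf, hle⟩ := Submodule.exists_le_ker_of_lt_top (LinearMap.range L)
    (lt_top_iff_ne_top.2 fun h => hL (LinearMap.range_eq_top.1 h))
  have hfs : ∀ w, f w = ∑ i, f (Pi.single i 1) * w i := by
    intro w
    conv_lhs => rw [← Finset.univ_sum_single w, map_sum]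
    refine Finset.sum_congr rfl fun i _ => ?_
    have : Pi.single i (w i) = w i • (Pi.single i 1 : Fin k → ℝ) := by
      rw [← Pi.single_smul, smul_eq_mul, mul_one]
    rw [this, map_smul, smul_eq_mul, mul_comm]
  refine ⟨fun i => f (Pi.single i 1), fun h => hf ?_, fun v => ?_⟩
  · refine LinearMap.ext fun w => ?_
    rw [hfs]
    simp [fun i => congrFun h i]
  · rw [← hfs]
    exact hle ⟨v, rfl⟩

/-- The prolongation step: a corank two subdistribution `Δ'` with Lie square `Δ` which contains the
sections annihilated by the triple, and on which `d (h 0)` does not vanish, is given by two further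
Pfaffian equations, whose coefficients together with `h 0` form a triple for `Δ'`. -/
theorem IsCauchyTriple.step (hn : n = ∞ ∨ n = ω) {m : ℕ} (H : IsCauchyTriple n Δ p h)
    (hm : ∀ᶠ x in 𝓝 p, Module.finrank ℝ (Δ x) = m + 2) (hΔ' : IsDistribution n m Δ' p)
    (hle : ∀ᶠ x in 𝓝 p, Δ' x ≤ Δ x) (hsq : lieSquare n Δ' p = Δ p)
    (hK : ∀ᶠ x in 𝓝 p, ∀ v ∈ Δ x, (∀ i, fderiv ℝ (h i) x v = 0) → v ∈ Δ' x)
    (hne : ∃ v ∈ Δ' p, fderiv ℝ (h 0) p v ≠ 0) :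
    ∃ a b : (Fin N → ℝ) → ℝ, IsCauchyTriple n Δ' p ![h 0, a, b] ∧
      ∀ᶠ x in 𝓝 p, ∀ v, v ∈ Δ' x ↔ v ∈ Δ x ∧ fderiv ℝ (h 1) x v = a x * fderiv ℝ (h 0) x v ∧
        fderiv ℝ (h 2) x v = b x * fderiv ℝ (h 0) x v := by
  have hn2 : 2 ≤ n := natCast_le_of_infty_or_omega hn 2
  have hn0 : n ≠ 0 := (lt_of_lt_of_le two_pos hn2).ne'
  obtain ⟨v₀, hv₀, hv₀h⟩ := hne
  obtain ⟨ξ, hξs, hξ⟩ := hΔ'.exists_param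
  obtain ⟨d₀, rfl⟩ := (hξ.self_of_nhds.2 v₀).1 hv₀
  have hd : ∀ i, ∀ᶠ x in 𝓝 p, ContDiffAt ℝ n (fun x => fderiv ℝ (h i) x (ξ x d₀)) x := by
    intro i
    filter_upwards [H.smooth i, hξs] with x h1 h2
    exact contDiffAt_fderiv_apply hn h1 (h2.clm_apply contDiffAt_const)
  have hne : ∀ᶠ x in 𝓝 p, fderiv ℝ (h 0) x (ξ x d₀) ≠ 0 :=
    (hd 0).self_of_nhds.continuousAt.eventually_ne hv₀h
  -- The coefficients are read off from a single section `ξ x d₀` of `Δ'` on which `d (h 0)` does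
  -- not vanish.
  set a : (Fin N → ℝ) → ℝ := fun x => fderiv ℝ (h 1) x (ξ x d₀) / fderiv ℝ (h 0) x (ξ x d₀) with ha
  set b : (Fin N → ℝ) → ℝ := fun x => fderiv ℝ (h 2) x (ξ x d₀) / fderiv ℝ (h 0) x (ξ x d₀) with hb
  have has : ∀ᶠ x in 𝓝 p, ContDiffAt ℝ n a x := by
    filter_upwards [hd 1, hd 0, hne] with x h1 h2 h3 using h1.div h2 h3
  have hbs : ∀ᶠ x in 𝓝 p, ContDiffAt ℝ n b x := by
    filter_upwards [hd 2, hd 0, hne] with x h1 h2 h3 using h1.div h2 h3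
  have hiff : ∀ᶠ x in 𝓝 p, ∀ v, v ∈ Δ' x ↔ v ∈ Δ x ∧
      fderiv ℝ (h 1) x v = a x * fderiv ℝ (h 0) x v ∧
        fderiv ℝ (h 2) x v = b x * fderiv ℝ (h 0) x v := by
    filter_upwards [hne, hξ, hle, hK, hm, hΔ'.finrank_eq] with x k1 k2 k3 k4 k5 k6
    let L : Δ x →ₗ[ℝ] (Fin 2 → ℝ) := LinearMap.pi ![
      ((fderiv ℝ (h 1) x - a x • fderiv ℝ (h 0) x :) : (Fin N → ℝ) →ₗ[ℝ] ℝ).comp (Δ x).subtype,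
      ((fderiv ℝ (h 2) x - b x • fderiv ℝ (h 0) x :) : (Fin N → ℝ) →ₗ[ℝ] ℝ).comp (Δ x).subtype]
    set S : Submodule ℝ (Fin N → ℝ) := (LinearMap.ker L).map (Δ x).subtype with hS
    have hSmem : ∀ v, v ∈ S ↔ v ∈ Δ x ∧ fderiv ℝ (h 1) x v = a x * fderiv ℝ (h 0) x v ∧
        fderiv ℝ (h 2) x v = b x * fderiv ℝ (h 0) x v := by
      intro v
      constructor
      · rintro ⟨w, hw, rfl⟩
        have e1 := congrFun hw 0
        have e2 := congrFun hw 1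
        exact ⟨w.2, sub_eq_zero.1 e1, sub_eq_zero.1 e2⟩
      · rintro ⟨hv, e1, e2⟩
        refine ⟨⟨v, hv⟩, ?_, rfl⟩
        refine funext fun i => ?_
        fin_cases i
        · exact sub_eq_zero.2 e1
        · exact sub_eq_zero.2 e2
    -- Subtracting the right multiple of `ξ x d₀` from a solution of both equations makes all three
    -- differentials vanish, so `hK` applies. Equality follows because `S` has codimension at most
    -- two in `Δ x`.
    have hle' : S ≤ Δ' x := by
      intro v hv
      obtain ⟨hv1, hv2, hv3⟩ := (hSmem v).1 hv
      have hZ : ξ x d₀ ∈ Δ' x := (k2.2 _).2 ⟨_, rfl⟩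
      set r := fderiv ℝ (h 0) x v / fderiv ℝ (h 0) x (ξ x d₀) with hr
      have hmem : v - r • ξ x d₀ ∈ Δ' x := by
        refine k4 _ ((Δ x).sub_mem hv1 ((Δ x).smul_mem _ (k3 hZ))) fun i => ?_
        rw [map_sub, map_smul, smul_eq_mul]
        fin_cases i
        · simp only [Fin.zero_eta, hr]
          field_simp
          ring
        · simp only [Fin.mk_one, hv2, ha, hr]
          field_simp
          ring
        · simp only [Fin.reduceFinMk, hv3, hb, hr]
          field_simp
          ring
      have := (Δ' x).add_mem hmem ((Δ' x).smul_mem r hZ)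
      simpa using this
    have hfin : Module.finrank ℝ (Δ' x) ≤ Module.finrank ℝ S := by
      rw [k6, hS, LinearEquiv.finrank_eq (Submodule.equivMapOfInjective _
        (Submodule.subtype_injective _) (LinearMap.ker L)).symm]
      have e1 := LinearMap.finrank_range_add_finrank_ker L
      have e2 : Module.finrank ℝ (LinearMap.range L) ≤ 2 := by
        have := Submodule.finrank_le (LinearMap.range L)
        simpa using this
      omega
    intro v
    rw [← hSmem, Submodule.eq_of_le_of_finrank_le hle' hfin]
  have hpf : ∀ᶠ x in 𝓝 p, ∀ X Y, IsSection n Δ' x X → IsSection n Δ' x Y →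
      fderiv ℝ (h 1) x (VectorField.lieBracket ℝ X Y x) =
        a x * fderiv ℝ (h 0) x (VectorField.lieBracket ℝ X Y x) +
          (fderiv ℝ a x (X x) * fderiv ℝ (h 0) x (Y x) -
            fderiv ℝ a x (Y x) * fderiv ℝ (h 0) x (X x)) ∧
      fderiv ℝ (h 2) x (VectorField.lieBracket ℝ X Y x) =
        b x * fderiv ℝ (h 0) x (VectorField.lieBracket ℝ X Y x) +
          (fderiv ℝ b x (X x) * fderiv ℝ (h 0) x (Y x) -
            fderiv ℝ b x (Y x) * fderiv ℝ (h 0) x (X x)) := by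
    filter_upwards [eventually_all.2 H.smooth, has, hbs, hiff.eventually_nhds]
      with x k1 k2 k3 k4 X Y hX hY
    have hXd := hX.1.self_of_nhds.differentiableAt hn0
    have hYd := hY.1.self_of_nhds.differentiableAt hn0
    constructor
    · refine fderiv_lieBracket_of_pfaff ((k1 1).of_le hn2) ((k1 0).of_le hn2)
        (k2.differentiableAt hn0) hXd hYd ?_ ?_
      · filter_upwards [hX.2, k4] with y e1 e2 using ((e2 _).1 e1).2.1
      · filter_upwards [hY.2, k4] with y e1 e2 using ((e2 _).1 e1).2.1
    · refine fderiv_lieBracket_of_pfaff ((k1 2).of_le hn2) ((k1 0).of_le hn2)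
        (k3.differentiableAt hn0) hXd hYd ?_ ?_
      · filter_upwards [hX.2, k4] with y e1 e2 using ((e2 _).1 e1).2.2
      · filter_upwards [hY.2, k4] with y e1 e2 using ((e2 _).1 e1).2.2
  refine ⟨a, b, ⟨?_, ?_, ?_⟩, hiff⟩
  · intro i
    fin_cases i
    exacts [H.smooth 0, has, hbs]
  · let L : Δ' p →ₗ[ℝ] (Fin 3 → ℝ) := LinearMap.pi fun i =>
      (fderiv ℝ ((![h 0, a, b] : Fin 3 → _) i) p : (Fin N → ℝ) →ₗ[ℝ] ℝ).comp (Δ' p).subtype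
    suffices hL : Function.Surjective L by
      intro y
      obtain ⟨v, hv⟩ := hL y
      exact ⟨v, v.2, fun i => congrFun hv i⟩
    by_contra hL
    obtain ⟨y, hy, hyL⟩ := exists_dual_of_not_surjective L hL
    have hyL' : ∀ v ∈ Δ' p, y 0 * fderiv ℝ (h 0) p v + y 1 * fderiv ℝ a p v +
        y 2 * fderiv ℝ b p v = 0 := by
      intro v hv
      have := hyL ⟨v, hv⟩
      rw [Fin.sum_univ_three] at this
      exact this
    -- A relation between `d (h 0)`, `da` and `db` on `Δ' p` kills the correction term of the
    -- structure equations. The matching combination of the two Pfaffian forms then vanishes on the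
    -- Lie square of `Δ'`, that is, on `Δ p`.
    have hker : Δ p ≤ LinearMap.ker ((y 1 • (fderiv ℝ (h 1) p - a p • fderiv ℝ (h 0) p) +
        y 2 • (fderiv ℝ (h 2) p - b p • fderiv ℝ (h 0) p) :) : (Fin N → ℝ) →ₗ[ℝ] ℝ) := by
      rw [← hsq]
      refine sup_le ?_ (Submodule.span_le.2 ?_)
      · intro v hv
        obtain ⟨-, e1, e2⟩ := (hiff.self_of_nhds v).1 hv
        change y 1 * (fderiv ℝ (h 1) p v - a p * fderiv ℝ (h 0) p v) +
          y 2 * (fderiv ℝ (h 2) p v - b p * fderiv ℝ (h 0) p v) = 0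
        rw [e1, e2]
        ring
      · rintro _ ⟨X, Y, hX, hY, rfl⟩
        obtain ⟨e1, e2⟩ := hpf.self_of_nhds X Y hX hY
        set Q := VectorField.lieBracket ℝ X Y p
        change y 1 * (fderiv ℝ (h 1) p Q - a p * fderiv ℝ (h 0) p Q) +
          y 2 * (fderiv ℝ (h 2) p Q - b p * fderiv ℝ (h 0) p Q) = 0
        rw [e1, e2]
        have e3 := hyL' _ hX.2.self_of_nhds
        have e4 := hyL' _ hY.2.self_of_nhds
        linear_combination fderiv ℝ (h 0) p (Y p) * e3 - fderiv ℝ (h 0) p (X p) * e4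
    -- Testing on a vector of `Δ p` with `d (h 0) = 0`, `d (h 1) = y 1`, `d (h 2) = y 2` gives `y 1
    -- ^ 2 + y 2 ^ 2 = 0`.
    have h12 : y 1 = 0 ∧ y 2 = 0 := by
      obtain ⟨v, hv, hvy⟩ := H.surj ![0, y 1, y 2]
      have e1 : y 1 * (fderiv ℝ (h 1) p v - a p * fderiv ℝ (h 0) p v) +
          y 2 * (fderiv ℝ (h 2) p v - b p * fderiv ℝ (h 0) p v) = 0 := hker hv
      have e2 : fderiv ℝ (h 0) p v = 0 := hvy 0
      have e3 : fderiv ℝ (h 1) p v = y 1 := hvy 1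
      have e4 : fderiv ℝ (h 2) p v = y 2 := hvy 2
      rw [e2, e3, e4] at e1
      constructor <;> nlinarith [sq_nonneg (y 1), sq_nonneg (y 2)]
    have h0 : y 0 = 0 := by
      have := hyL' _ hv₀
      rw [h12.1, h12.2] at this
      simpa [hv₀h] using this
    apply hy
    funext i
    fin_cases i
    exacts [h0, h12.1, h12.2]
  · filter_upwards [H.bracket_mem, hpf, hiff.eventually_nhds, hle.eventually_nhds]
      with x k1 k2 k3 k4 X Y hX hY hk
    obtain ⟨e1, e2⟩ := k2 X Y hX hY
    have f0 : ∀ᶠ y in 𝓝 x, fderiv ℝ (h 0) y (X y) = 0 := hk 0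
    have f1 : fderiv ℝ a x (X x) = 0 := (hk 1).self_of_nhds
    have f2 : fderiv ℝ b x (X x) = 0 := (hk 2).self_of_nhds
    rw [k3.self_of_nhds]
    refine ⟨k1 X Y (hX.mono k4) (hY.mono k4) fun i => ?_, ?_, ?_⟩
    · filter_upwards [f0, hX.2, k3] with y g1 g2 g3
      obtain ⟨-, g4, g5⟩ := (g3 _).1 g2
      fin_cases i
      · exact g1
      · exact g4.trans (by rw [g1, mul_zero])
      · exact g5.trans (by rw [g1, mul_zero])
    · rw [e1, f1, f0.self_of_nhds]; ring
    · rw [e2, f2, f0.self_of_nhds]; ring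

end Prolongation

/-! ### The pseudo-normal form -/

section NormalForm

variable {n : WithTop ℕ∞}

theorem mem_ekr1211 {b c B C : ℝ} {x v : Fin 11 → ℝ} : v ∈ ekr1211 b c B C x ↔
    v 1 = x 3 * v 0 ∧ v 2 = x 4 * v 0 ∧ v 0 = x 5 * v 3 ∧ v 4 = x 6 * v 3 ∧
    v 5 = (b + x 7) * v 3 ∧ v 6 = (c + x 8) * v 3 ∧
    v 7 = (B + x 9) * v 3 ∧ v 8 = (C + x 10) * v 3 := Iff.rfl

theorem lieSquare_ge {N : ℕ} (D : (Fin N → ℝ) → Submodule ℝ (Fin N → ℝ)) (x : Fin N → ℝ) :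
    D x ≤ lieSquare n D x := le_sup_left

/-- A distribution given by the Pfaffian equations of the pseudo-normal form, written with functions
`f 0, …, f 10` which have independent differentials, is equivalent to a pseudo-normal form. -/
theorem germEquiv_ekr1211_of_pfaff (hn : n = ∞ ∨ n = ω)
    {D : (Fin 11 → ℝ) → Submodule ℝ (Fin 11 → ℝ)} {p : Fin 11 → ℝ}
    {f : Fin 11 → (Fin 11 → ℝ) → ℝ} (hf : ∀ i, ∀ᶠ x in 𝓝 p, ContDiffAt ℝ n (f i) x)
    (hinj : ∀ v, (∀ i, fderiv ℝ (f i) p v = 0) → v = 0) (h5 : f 5 p = 0)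
    (hD : ∀ᶠ x in 𝓝 p, ∀ v, v ∈ D x ↔ (fun i => fderiv ℝ (f i) x v) ∈ ekr1211 0 0 0 0
      (fun i => f i x)) :
    GermEquiv n D p (ekr1211 (f 7 p) (f 8 p) (f 9 p) (f 10 p)) 0 := by
  have hn1 : 1 ≤ n := natCast_le_of_infty_or_omega hn 1
  have hn0 : n ≠ 0 := (lt_of_lt_of_le one_pos hn1).ne'
  -- With `t, x₁, …, y₅` for the functions `f`, the replacements `y₂ - y₃(p) x₂`, `x₁ - x₂(p) t` and
  -- `y₁ - y₂(p) t - y₃(p) (x₁ - x₂(p) t)` absorb the values of `x₂, y₂, y₃` at `p`. The value of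
  -- `x₃` is 0 by hypothesis, and those of `x₄, y₄, x₅, y₅` remain as `b, c, B, C`.
  set g : (Fin 11 → ℝ) → (Fin 11 → ℝ) := fun w =>
    ![w 0, w 1 - f 3 p * w 0, w 2 - f 4 p * w 0 - f 6 p * (w 1 - f 3 p * w 0), w 3,
      w 4 - f 6 p * w 3, w 5, w 6, w 7, w 8, w 9, w 10] with hg
  let Λ : (Fin 11 → ℝ) →L[ℝ] (Fin 11 → ℝ) := LinearMap.toContinuousLinearMap
    { toFun := g
      map_add' := by
        intro v w
        funext i
        fin_cases i <;> simp [hg] <;> ring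
      map_smul' := by
        intro r w
        funext i
        fin_cases i <;> simp [hg] <;> ring }
  have hΛ : ∀ w, Λ w = g w := fun w => rfl
  have hΛ0 : ∀ w, Λ w = 0 → w = 0 := by
    intro w hw
    rw [hΛ] at hw
    have e : ∀ i, g w i = 0 := fun i => congrFun hw i
    have e0 : w 0 = 0 := e 0
    have e1 : w 1 - f 3 p * w 0 = 0 := e 1
    have e2 : w 2 - f 4 p * w 0 - f 6 p * (w 1 - f 3 p * w 0) = 0 := e 2
    have e3 : w 3 = 0 := e 3
    have e4 : w 4 - f 6 p * w 3 = 0 := e 4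
    rw [e1, e0] at e2
    rw [e0] at e1
    rw [e3] at e4
    simp only [mul_zero, sub_zero] at e1 e2 e4
    funext i
    fin_cases i
    exacts [e0, e1, e2, e3, e4, e 5, e 6, e 7, e 8, e 9, e 10]
  set Φ : (Fin 11 → ℝ) → (Fin 11 → ℝ) := fun x => Λ ((fun i => f i x) - fun i => f i p) with hΦ
  have hΦs : ∀ᶠ x in 𝓝 p, ContDiffAt ℝ n Φ x := by
    filter_upwards [eventually_all.2 hf] with x hx
    exact Λ.contDiff.contDiffAt.comp x ((contDiffAt_pi.2 hx).sub contDiffAt_const)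
  have hΦd : ∀ᶠ x in 𝓝 p, ∀ v, fderiv ℝ Φ x v = Λ fun i => fderiv ℝ (f i) x v := by
    filter_upwards [eventually_all.2 hf] with x hx v
    have h1 : HasFDerivAt (fun x i => f i x) (ContinuousLinearMap.pi fun i => fderiv ℝ (f i) x) x :=
      hasFDerivAt_pi.2 fun i => ((hx i).differentiableAt hn0).hasFDerivAt
    have h2 : HasFDerivAt Φ (Λ.comp (ContinuousLinearMap.pi fun i => fderiv ℝ (f i) x)) x :=
      Λ.hasFDerivAt.comp x (h1.sub_const _)
    rw [h2.fderiv]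
    rfl
  have hΦinj : Function.Injective (fderiv ℝ Φ p : (Fin 11 → ℝ) →ₗ[ℝ] (Fin 11 → ℝ)) := by
    rw [injective_iff_map_eq_zero]
    intro v hv
    have hv' : fderiv ℝ Φ p v = 0 := hv
    rw [hΦd.self_of_nhds] at hv'
    exact hinj v fun i => congrFun (hΛ0 _ hv') i
  let e : (Fin 11 → ℝ) ≃L[ℝ] (Fin 11 → ℝ) :=
    (LinearEquiv.ofInjectiveEndo _ hΦinj).toContinuousLinearEquiv
  have he : (e : (Fin 11 → ℝ) →L[ℝ] (Fin 11 → ℝ)) = fderiv ℝ Φ p := by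
    ext1 v; rfl
  have hinv : ∀ᶠ x in 𝓝 p, (fderiv ℝ Φ x).IsInvertible := by
    have hc : ContinuousAt (fderiv ℝ Φ) p :=
      (hΦs.self_of_nhds.fderiv_right (m := 0) (by simpa using hn1)).continuousAt
    refine hc.eventually ?_
    rw [← he]
    exact ContinuousLinearEquiv.nhds e
  obtain ⟨φ, hφp, hφ, hφU, hφs, hφss⟩ := exists_local_diffeo hn1 (hD.and (hΦd.and hinv)) hΦs e
    (by rw [he]; exact (hΦs.self_of_nhds.differentiableAt hn0).hasFDerivAt)
  have hφΦ : (φ : (Fin 11 → ℝ) → (Fin 11 → ℝ)) = Φ := funext hφ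
  refine ⟨φ, hφp, ?_, hφs, hφss, ?_⟩
  · rw [hφ]
    simp [hΦ]
  · intro x hx
    obtain ⟨k1, k2, e', he'⟩ := hφU hx
    rw [hφΦ]
    have key : ∀ u, fderiv ℝ Φ x u ∈ ekr1211 (f 7 p) (f 8 p) (f 9 p) (f 10 p) (Φ x) ↔ u ∈ D x := by
      intro u
      rw [k1, k2, mem_ekr1211, mem_ekr1211, hΛ]
      simp only [hΦ, hΛ]
      set w : Fin 11 → ℝ := fun i => fderiv ℝ (f i) x u
      simp only [hg, Pi.sub_apply, Matrix.cons_val]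
      rw [h5]
      constructor
      · rintro ⟨g1, g2, g3, g4, g5, g6, g7, g8⟩
        refine ⟨?_, ?_, ?_, ?_, ?_, ?_, ?_, ?_⟩
        · linear_combination g1
        · linear_combination g2 + f 6 p * g1
        · linear_combination g3
        · linear_combination g4
        · linear_combination g5
        · linear_combination g6
        · linear_combination g7
        · linear_combination g8
      · rintro ⟨g1, g2, g3, g4, g5, g6, g7, g8⟩
        refine ⟨?_, ?_, ?_, ?_, ?_, ?_, ?_, ?_⟩
        · linear_combination g1
        · linear_combination g2 - f 6 p * g1
        · linear_combination g3
        · linear_combination g4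
        · linear_combination g5
        · linear_combination g6
        · linear_combination g7
        · linear_combination g8
    ext v
    constructor
    · intro hv
      refine ⟨e'.symm v, ?_, ?_⟩
      · refine (key _).1 ?_
        rw [← he']
        simpa using hv
      · rw [← he']
        simp
    · rintro ⟨u, hu, rfl⟩
      exact (key u).2 hu

/-- Four prolongation steps down the flag, starting from the first integrals of `F`. The class is
used only through the choice of the base function in each step and through `x₃(p) = 0`. -/
theorem InClass1211.exists_germEquiv_ekr1211 (hn : n = ∞ ∨ n = ω)
    {D : (Fin 11 → ℝ) → Submodule ℝ (Fin 11 → ℝ)} {p : Fin 11 → ℝ} (hD : InClass1211 n D p) :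
    ∃ b c B C : ℝ, GermEquiv n D p (ekr1211 b c B C) 0 := by
  obtain ⟨F, hF, hs2, hs3, hs4⟩ := hD
  have hn1 : 1 ≤ n := natCast_le_of_infty_or_omega hn 1
  set D3 := lieSquare n D with hD3
  set D2 := lieSquare n D3 with hD2
  set D1 := lieSquare n D2 with hD1
  set D0 := lieSquare n D1 with hD0
  have r4 : IsDistribution n 3 D p := hF.rank_eq 4 le_rfl
  have r3 : IsDistribution n 5 D3 p := hF.rank_eq 3 (by norm_num)
  have r2 : IsDistribution n 7 D2 p := hF.rank_eq 2 (by norm_num)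
  have r1 : IsDistribution n 9 D1 p := hF.rank_eq 1 (by norm_num)
  have r0 : IsDistribution n 11 D0 p := hF.rank_eq 0 (by norm_num)
  have c1 : ∀ᶠ x in 𝓝 p, cauchyChar n D1 x ≤ D2 x := hF.cauchy_le 1 le_rfl (by norm_num)
  have c2 : ∀ᶠ x in 𝓝 p, cauchyChar n D2 x ≤ D3 x := hF.cauchy_le 2 (by norm_num) (by norm_num)
  have c3 : ∀ᶠ x in 𝓝 p, cauchyChar n D3 x ≤ D x := hF.cauchy_le 3 (by norm_num) (by norm_num)
  have rF : IsDistribution n 8 F p := hF.cov_rank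
  have cF : ∀ᶠ x in 𝓝 p, F x ≤ D1 x := hF.cov_le
  have s2 : D2 p ≤ F p := hs2
  have s3 : ¬ D3 p ≤ cauchyChar n D1 p := hs3
  have s4 : ¬ D p ≤ cauchyChar n D2 p := hs4
  have htop : ∀ᶠ x in 𝓝 p, D0 x = ⊤ := by
    filter_upwards [r0.finrank_eq] with x hx
    exact Submodule.eq_top_of_finrank_eq (by simpa using hx)
  -- first integrals of the covariant subdistribution
  obtain ⟨u, hus, husurj, huF⟩ := exists_first_integrals hn (N := 11) (m := 8) (k := 3) rfl rF hF.cov_involutive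
  set u' : Fin 3 → (Fin 11 → ℝ) → ℝ := fun i x => u x i with hu'
  have hu's : ∀ i, ∀ᶠ x in 𝓝 p, ContDiffAt ℝ n (u' i) x := fun i => by
    filter_upwards [hus] with x hx
    exact contDiffAt_pi.1 hx i
  have hu'd : ∀ᶠ x in 𝓝 p, ∀ i v, fderiv ℝ (u' i) x v = fderiv ℝ u x v i := by
    filter_upwards [hus] with x hx i v
    have h := hasFDerivAt_pi'.1 (hx.differentiableAt (by positivity)).hasFDerivAt i
    rw [h.fderiv]
    rfl
  have T0 : IsCauchyTriple n D0 p u' := by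
    refine ⟨hu's, fun y => ?_, ?_⟩
    · obtain ⟨v, hv⟩ := husurj y
      refine ⟨v, by rw [htop.self_of_nhds]; trivial, fun i => ?_⟩
      rw [hu'd.self_of_nhds, hv]
    · filter_upwards [htop] with x hx X Y _ _ _
      rw [hx]; trivial
  have hFker : ∀ᶠ x in 𝓝 p, ∀ v, (∀ i, fderiv ℝ (u' i) x v = 0) ↔ v ∈ F x := by
    have hc : ContinuousAt (fderiv ℝ u) p :=
      (hus.self_of_nhds.fderiv_right (m := 0) (by simpa using hn1)).continuousAt
    obtain ⟨R, hR⟩ := eventually_surjective hc husurj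
    filter_upwards [hR, hu'd, huF, rF.finrank_eq] with x k1 k2 k3 k4
    have hs : Function.Surjective (fderiv ℝ u x) := by
      obtain ⟨e, he⟩ := k1
      intro w
      refine ⟨R (e.symm w), ?_⟩
      change ((fderiv ℝ u x).comp R) _ = w
      rw [← he]
      simp
    have h1 := LinearMap.finrank_range_add_finrank_ker
      (fderiv ℝ u x : (Fin 11 → ℝ) →ₗ[ℝ] (Fin 3 → ℝ))
    rw [LinearMap.range_eq_top.2 hs, finrank_top, Module.finrank_fin_fun,
      Module.finrank_fin_fun] at h1
    have h2 : F x = LinearMap.ker (fderiv ℝ u x : (Fin 11 → ℝ) →ₗ[ℝ] (Fin 3 → ℝ)) :=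
      Submodule.eq_of_le_of_finrank_le (fun v hv => k3 v hv) (by omega)
    intro v
    rw [h2]
    simp only [k2]
    exact ⟨fun h => funext h, fun h i => congrFun h i⟩
  obtain ⟨i₀, v₁, hv₁, hv₁0⟩ := T0.exists_ne r0.finrank_eq.self_of_nhds
    (lieSquare_ge D1 p) r1.finrank_eq.self_of_nhds
  have T0' := T0.perm (Equiv.swap 0 i₀)
  -- Here the common kernel of the triple is `F`, contained in `D¹`. In the later steps the
  -- corresponding inclusion is that of the Cauchy characteristics of `Dʲ` in `Dʲ⁺¹`.
  obtain ⟨a₁, b₁, T1, E1⟩ := T0'.step hn r0.finrank_eq r1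
    (Eventually.of_forall fun x => lieSquare_ge D1 x) rfl (by
      filter_upwards [hFker, cF] with x k1 k2 v _ hv
      refine k2 ((k1 v).1 fun i => ?_)
      simpa using hv (Equiv.swap 0 i₀ i)) ⟨v₁, hv₁, by simpa using hv₁0⟩
  set t := u' (Equiv.swap 0 i₀ 0) with ht
  have htF : ∀ v ∈ F p, fderiv ℝ t p v = 0 := fun v hv => (hFker.self_of_nhds v).2 hv _
  -- the second step, with the roles of the two remaining functions chosen suitably
  obtain ⟨x₁, y₁, x₂, y₂, hx₁, hy₁, T1', E1', v₂, hv₂, hv₂0⟩ :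
      ∃ x₁ y₁ x₂ y₂ : (Fin 11 → ℝ) → ℝ, (∀ᶠ x in 𝓝 p, ContDiffAt ℝ n x₁ x) ∧
        (∀ᶠ x in 𝓝 p, ContDiffAt ℝ n y₁ x) ∧ IsCauchyTriple n D1 p ![x₂, t, y₂] ∧
        (∀ᶠ x in 𝓝 p, ∀ v, v ∈ D1 x ↔ v ∈ D0 x ∧ fderiv ℝ x₁ x v = x₂ x * fderiv ℝ t x v ∧
          fderiv ℝ y₁ x v = y₂ x * fderiv ℝ t x v) ∧ ∃ v ∈ D2 p, fderiv ℝ x₂ p v ≠ 0 := by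
    obtain ⟨i, v, hv, hv0⟩ := T1.exists_ne r1.finrank_eq.self_of_nhds
      (lieSquare_ge D2 p) r2.finrank_eq.self_of_nhds
    have h3 : i = 0 ∨ i = 1 ∨ i = 2 := by fin_cases i <;> simp
    rcases h3 with rfl | rfl | rfl
    -- Since `D²(p) ⊆ F(p)` and `t` is a first integral of `F`, the base function cannot be `t`. If
    -- it is the third function of the triple, the names of the two coordinate pairs are exchanged.
    · exact absurd (htF v (s2 hv)) hv0
    · refine ⟨_, _, a₁, b₁, T0'.smooth 1, T0'.smooth 2, ?_, E1, v, hv, hv0⟩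
      convert T1.perm (Equiv.swap 0 1) using 1
      funext i
      fin_cases i <;> rfl
    · refine ⟨_, _, b₁, a₁, T0'.smooth 2, T0'.smooth 1, ?_, ?_, v, hv, hv0⟩
      · convert T1.perm ((Equiv.swap 0 2).trans (Equiv.swap 0 1)) using 1
        funext i
        fin_cases i <;> rfl
      · filter_upwards [E1] with x hx v
        rw [hx, and_comm (a := fderiv ℝ _ x v = _)]
  have K1 := T1'.mem_cauchyChar hn r1
  obtain ⟨x₃, y₃, T2, E2⟩ := T1'.step hn r1.finrank_eq r2
    (Eventually.of_forall fun x => lieSquare_ge D2 x) rfl (by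
      filter_upwards [K1, c1] with x k1 k2 v hv hv0 using k2 (k1 v hv hv0)) ⟨v₂, hv₂, hv₂0⟩
  have hx₃ : x₃ p = 0 := by
    have := ((E2.self_of_nhds v₂).1 hv₂).2.1
    change fderiv ℝ t p v₂ = x₃ p * fderiv ℝ x₂ p v₂ at this
    rw [htF _ (s2 hv₂)] at this
    simpa [hv₂0] using this.symm
  have K2 := T2.mem_cauchyChar hn r2
  -- If `dx₂` vanished on `D³(p)`, so would `dt` and `dy₂` by the equations of `D²`. Then `D³(p)`
  -- would lie in `L(D¹)(p)`, which the class excludes. The same argument one level down, with the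
  -- fourth sandwich, serves `D⁴`.
  have hne3 : ∃ v ∈ D3 p, fderiv ℝ x₂ p v ≠ 0 := by
    by_contra! hcon
    refine s3 fun v hv => ?_
    have hv2 : v ∈ D2 p := lieSquare_ge D3 p hv
    obtain ⟨g1, g2, g3⟩ := (E2.self_of_nhds v).1 hv2
    refine K1.self_of_nhds v g1 fun i => ?_
    have g0 : fderiv ℝ x₂ p v = 0 := hcon v hv
    fin_cases i
    · exact g0
    · exact g2.trans (by change _ * fderiv ℝ x₂ p v = 0; rw [g0, mul_zero])
    · exact g3.trans (by change _ * fderiv ℝ x₂ p v = 0; rw [g0, mul_zero])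
  obtain ⟨x₄, y₄, T3, E3⟩ := T2.step hn r2.finrank_eq r3
    (Eventually.of_forall fun x => lieSquare_ge D3 x) rfl (by
      filter_upwards [K2, c2] with x k1 k2 v hv hv0 using k2 (k1 v hv hv0)) hne3
  have K3 := T3.mem_cauchyChar hn r3
  have hne4 : ∃ v ∈ D p, fderiv ℝ x₂ p v ≠ 0 := by
    by_contra! hcon
    refine s4 fun v hv => ?_
    have hv3 : v ∈ D3 p := lieSquare_ge D p hv
    obtain ⟨g1, g2, g3⟩ := (E3.self_of_nhds v).1 hv3
    refine K2.self_of_nhds v g1 fun i => ?_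
    have g0 : fderiv ℝ x₂ p v = 0 := hcon v hv
    fin_cases i
    · exact g0
    · exact g2.trans (by change _ * fderiv ℝ x₂ p v = 0; rw [g0, mul_zero])
    · exact g3.trans (by change _ * fderiv ℝ x₂ p v = 0; rw [g0, mul_zero])
  obtain ⟨x₅, y₅, T4, E4⟩ := T3.step hn r3.finrank_eq r4
    (Eventually.of_forall fun x => lieSquare_ge D x) rfl (by
      filter_upwards [K3, c3] with x k1 k2 v hv hv0 using k2 (k1 v hv hv0)) hne4
  have hDiff : ∀ᶠ x in 𝓝 p, ∀ v, v ∈ D x ↔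
      (fderiv ℝ x₁ x v = x₂ x * fderiv ℝ t x v ∧ fderiv ℝ y₁ x v = y₂ x * fderiv ℝ t x v ∧
      fderiv ℝ t x v = x₃ x * fderiv ℝ x₂ x v ∧ fderiv ℝ y₂ x v = y₃ x * fderiv ℝ x₂ x v ∧
      fderiv ℝ x₃ x v = x₄ x * fderiv ℝ x₂ x v ∧ fderiv ℝ y₃ x v = y₄ x * fderiv ℝ x₂ x v ∧
      fderiv ℝ x₄ x v = x₅ x * fderiv ℝ x₂ x v ∧ fderiv ℝ y₄ x v = y₅ x * fderiv ℝ x₂ x v) := by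
    filter_upwards [htop, E1', E2, E3, E4] with x k0 k1 k2 k3 k4 v
    rw [k4, k3, k2, k1, k0]
    simp only [Submodule.mem_top, true_and, and_assoc]
    rfl
  have key := germEquiv_ekr1211_of_pfaff hn (D := D) (p := p)
    (f := ![t, x₁, y₁, x₂, y₂, x₃, y₃, x₄, y₄, x₅, y₅]) (fun i => by
      fin_cases i
      exacts [T1'.smooth 1, hx₁, hy₁, T1'.smooth 0, T1'.smooth 2, T2.smooth 1, T2.smooth 2,
        T3.smooth 1, T3.smooth 2, T4.smooth 1, T4.smooth 2])
    (fun v hv => by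
      have hvD : v ∈ D p := by
        rw [hDiff.self_of_nhds]
        have e0 : fderiv ℝ t p v = 0 := hv 0
        have e1 : fderiv ℝ x₁ p v = 0 := hv 1
        have e2 : fderiv ℝ y₁ p v = 0 := hv 2
        have e3 : fderiv ℝ x₂ p v = 0 := hv 3
        have e4 : fderiv ℝ y₂ p v = 0 := hv 4
        have e5 : fderiv ℝ x₃ p v = 0 := hv 5
        have e6 : fderiv ℝ y₃ p v = 0 := hv 6
        have e7 : fderiv ℝ x₄ p v = 0 := hv 7
        have e8 : fderiv ℝ y₄ p v = 0 := hv 8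
        simp [e0, e1, e2, e3, e4, e5, e6, e7, e8]
      -- A vector killed by all eleven differentials lies in `D p`, where `dx₂, dx₅, dy₅` already
      -- form a coordinate system by the last triple. Hence the eleven functions are coordinates.
      let L : D p →ₗ[ℝ] (Fin 3 → ℝ) := LinearMap.pi fun i =>
        (fderiv ℝ ((![x₂, x₅, y₅] : Fin 3 → _) i) p : (Fin 11 → ℝ) →ₗ[ℝ] ℝ).comp (D p).subtype
      have hL : Function.Surjective L := fun y => by
        obtain ⟨w, hw, hwy⟩ := T4.surj y
        exact ⟨⟨w, hw⟩, funext hwy⟩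
      have hLi : Function.Injective L :=
        (LinearMap.injective_iff_surjective_of_finrank_eq_finrank (by
          rw [r4.finrank_eq.self_of_nhds, Module.finrank_fin_fun])).2 hL
      have hL0 : L ⟨v, hvD⟩ = 0 := by
        funext i
        fin_cases i
        exacts [hv 3, hv 9, hv 10]
      exact congrArg Subtype.val (hLi (hL0.trans (map_zero L).symm)))
    hx₃ (by
      filter_upwards [hDiff] with x hx v
      rw [hx, mem_ekr1211]
      simp only [Matrix.cons_val, zero_add])
  exact ⟨_, _, _, _, key⟩

end NormalForm

/-! ### Transport by local diffeomorphisms -/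

section Transport

variable {n : WithTop ℕ∞} {N : ℕ}

/-- The local diffeomorphism `φ` maps the germ of `D` at `p` to the germ of `D'` at `p'`. -/
structure IsGermIso (n : WithTop ℕ∞) (D : (Fin N → ℝ) → Submodule ℝ (Fin N → ℝ)) (p : Fin N → ℝ)
    (D' : (Fin N → ℝ) → Submodule ℝ (Fin N → ℝ)) (p' : Fin N → ℝ)
    (φ : OpenPartialHomeomorph (Fin N → ℝ) (Fin N → ℝ)) : Prop where
  mem_source : p ∈ φ.source
  map_eq : φ p = p'
  contDiffOn : ContDiffOn ℝ n φ φ.source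
  contDiffOn_symm : ContDiffOn ℝ n φ.symm φ.target
  map_fderiv : ∀ x ∈ φ.source, D' (φ x) = (D x).map (fderiv ℝ φ x : (Fin N → ℝ) →ₗ[ℝ] (Fin N → ℝ))

theorem germEquiv_iff_exists_isGermIso {D D' : (Fin N → ℝ) → Submodule ℝ (Fin N → ℝ)}
    {p p' : Fin N → ℝ} : GermEquiv n D p D' p' ↔ ∃ φ, IsGermIso n D p D' p' φ :=
  ⟨fun ⟨φ, h1, h2, h3, h4, h5⟩ => ⟨φ, h1, h2, h3, h4, h5⟩,
    fun ⟨φ, h1, h2, h3, h4, h5⟩ => ⟨φ, h1, h2, h3, h4, h5⟩⟩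

/-! ### Vector fields and derivations in changed coordinates -/

section Derivatives

variable {φ : OpenPartialHomeomorph (Fin N → ℝ) (Fin N → ℝ)}

theorem fderiv_symm_fderiv_of_contDiffOn (hn : 1 ≤ n) (h : ContDiffOn ℝ n φ φ.source)
    (h' : ContDiffOn ℝ n φ.symm φ.target) {x : Fin N → ℝ} (hx : x ∈ φ.source) (v : Fin N → ℝ) :
    fderiv ℝ φ.symm (φ x) (fderiv ℝ φ x v) = v := by
  have hn0 : n ≠ 0 := (lt_of_lt_of_le one_pos hn).ne'
  have h1 := ((h.contDiffAt (φ.open_source.mem_nhds hx)).differentiableAt hn0).hasFDerivAt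
  have h2 := ((h'.contDiffAt (φ.open_target.mem_nhds (φ.map_source hx))).differentiableAt
    hn0).hasFDerivAt
  have h3 := h2.comp x h1
  have h4 : HasFDerivAt (φ.symm ∘ φ) (.id ℝ _) x := by
    refine (hasFDerivAt_id x).congr_of_eventuallyEq ?_
    filter_upwards [φ.open_source.mem_nhds hx] with y hy using φ.left_inv hy
  exact congrArg (fun L => L v) (h3.unique h4)

theorem fderiv_fderiv_symm_of_contDiffOn (hn : 1 ≤ n) (h : ContDiffOn ℝ n φ φ.source)
    (h' : ContDiffOn ℝ n φ.symm φ.target) {x : Fin N → ℝ} (hx : x ∈ φ.source) (v : Fin N → ℝ) :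
    fderiv ℝ φ x (fderiv ℝ φ.symm (φ x) v) = v := by
  have := fderiv_symm_fderiv_of_contDiffOn (φ := φ.symm) hn h' h (φ.map_source hx) v
  rwa [φ.symm_symm, φ.left_inv hx] at this

theorem inCoords_apply_map (X : (Fin N → ℝ) → (Fin N → ℝ)) {x : Fin N → ℝ} (hx : x ∈ φ.source) :
    inCoords φ X (φ x) = fderiv ℝ φ x (X x) := by
  simp only [inCoords, φ.left_inv hx]

/-- `inCoords` as a linear map. -/
noncomputable def inCoordsLinear (φ : OpenPartialHomeomorph (Fin N → ℝ) (Fin N → ℝ)) :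
    ((Fin N → ℝ) → (Fin N → ℝ)) →ₗ[ℝ] ((Fin N → ℝ) → (Fin N → ℝ)) where
  toFun := inCoords φ
  map_add' X Y := by
    funext y
    simp [inCoords]
  map_smul' r X := by
    funext y
    simp [inCoords]

theorem inCoordsLinear_apply (X : (Fin N → ℝ) → (Fin N → ℝ)) :
    inCoordsLinear φ X = inCoords φ X := rfl

theorem eventually_nhds_map {p : Fin N → ℝ} (hp : p ∈ φ.source) {P : (Fin N → ℝ) → Prop} :
    (∀ᶠ y in 𝓝 (φ p), P y) ↔ ∀ᶠ x in 𝓝 p, P (φ x) := by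
  rw [← φ.map_nhds_eq hp, eventually_map]

theorem smoothNear_inCoords (hn : n = ∞ ∨ n = ω) (h : ContDiffOn ℝ n φ φ.source)
    (h' : ContDiffOn ℝ n φ.symm φ.target) {p : Fin N → ℝ} (hp : p ∈ φ.source)
    {X : (Fin N → ℝ) → (Fin N → ℝ)} (hX : SmoothNear n X p) :
    SmoothNear n (inCoords φ X) (φ p) := by
  rw [SmoothNear, eventually_nhds_map hp]
  filter_upwards [hX, φ.open_source.mem_nhds hp] with x hx hxs
  have hs : ContDiffAt ℝ n φ.symm (φ x) :=
    h'.contDiffAt (φ.open_target.mem_nhds (φ.map_source hxs))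
  have hd : ContDiffAt ℝ n (fderiv ℝ φ) (φ.symm (φ x)) := by
    rw [φ.left_inv hxs]
    exact (h.contDiffAt (φ.open_source.mem_nhds hxs)).fderiv_right
      (add_one_le_of_infty_or_omega hn)
  have hX' : ContDiffAt ℝ n X (φ.symm (φ x)) := by rwa [φ.left_inv hxs]
  exact (hd.comp (φ x) hs).clm_apply (hX'.comp (φ x) hs)

theorem lieBracket_inCoords (hn : n = ∞ ∨ n = ω) (h : ContDiffOn ℝ n φ φ.source)
    (h' : ContDiffOn ℝ n φ.symm φ.target) {p : Fin N → ℝ} (hp : p ∈ φ.source)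
    {X Y : (Fin N → ℝ) → (Fin N → ℝ)} (hX : SmoothNear n X p) (hY : SmoothNear n Y p) :
    inCoords φ (VectorField.lieBracket ℝ X Y) =ᶠ[𝓝 (φ p)]
      VectorField.lieBracket ℝ (inCoords φ X) (inCoords φ Y) := by
  have hn0 : n ≠ 0 := (lt_of_lt_of_le one_pos (natCast_le_of_infty_or_omega hn 1)).ne'
  have key : ∀ Z, SmoothNear n Z p → ∀ᶠ x in 𝓝 p, ∀ v,
      fderiv ℝ (fun y => fderiv ℝ φ y (Z y)) x v =
        fderiv ℝ (inCoords φ Z) (φ x) (fderiv ℝ φ x v) := by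
    intro Z hZ
    have h1 := (eventually_nhds_map hp).1 (smoothNear_inCoords hn h h' hp hZ)
    filter_upwards [h1, φ.open_source.mem_nhds hp] with x h2 hxs v
    have h3 : (fun y => fderiv ℝ φ y (Z y)) =ᶠ[𝓝 x] inCoords φ Z ∘ φ := by
      filter_upwards [φ.open_source.mem_nhds hxs] with y hy using (inCoords_apply_map Z hy).symm
    rw [h3.fderiv_eq, fderiv_comp x (h2.differentiableAt hn0)
      ((h.contDiffAt (φ.open_source.mem_nhds hxs)).differentiableAt hn0)]
    rfl
  change ∀ᶠ y in 𝓝 (φ p), _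
  rw [eventually_nhds_map hp]
  filter_upwards [hX, hY, key X hX, key Y hY, φ.open_source.mem_nhds hp] with x hx hy kx ky hxs
  rw [inCoords_apply_map _ hxs, VectorField.fderiv_apply_lieBracket
    (h.contDiffAt (φ.open_source.mem_nhds hxs))
    (by simpa using natCast_le_of_infty_or_omega hn 2) (hy.differentiableAt hn0)
    (hx.differentiableAt hn0), kx, ky, VectorField.lieBracket_eq]
  beta_reduce
  rw [inCoords_apply_map _ hxs, inCoords_apply_map _ hxs]

theorem dirDeriv_inCoords {X : (Fin N → ℝ) → (Fin N → ℝ)} {f : (Fin N → ℝ) → ℝ} {x : Fin N → ℝ}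
    (hx : x ∈ φ.source) (hφ : DifferentiableAt ℝ φ x) (hf : DifferentiableAt ℝ f (φ x)) :
    dirDeriv X (f ∘ φ) x = dirDeriv (inCoords φ X) f (φ x) := by
  rw [dirDeriv, dirDeriv, inCoords_apply_map X hx, fderiv_comp x hf hφ]
  rfl

end Derivatives

variable {D D' D'' : (Fin N → ℝ) → Submodule ℝ (Fin N → ℝ)} {p p' p'' : Fin N → ℝ}
  {φ ψ : OpenPartialHomeomorph (Fin N → ℝ) (Fin N → ℝ)}

theorem IsGermIso.symm (hn : 1 ≤ n) (h : IsGermIso n D p D' p' φ) :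
    IsGermIso n D' p' D p φ.symm where
  mem_source := h.map_eq ▸ φ.map_source h.mem_source
  map_eq := by rw [← h.map_eq, φ.left_inv h.mem_source]
  contDiffOn := h.contDiffOn_symm
  contDiffOn_symm := h.contDiffOn
  map_fderiv := by
    intro y hy
    obtain ⟨x, hx, rfl⟩ : ∃ x ∈ φ.source, φ x = y := ⟨φ.symm y, φ.map_target hy, φ.right_inv hy⟩
    rw [h.map_fderiv x hx, φ.left_inv hx, ← Submodule.map_comp]
    have : (fderiv ℝ φ.symm (φ x) : (Fin N → ℝ) →ₗ[ℝ] (Fin N → ℝ)).comp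
        (fderiv ℝ φ x : (Fin N → ℝ) →ₗ[ℝ] (Fin N → ℝ)) = LinearMap.id :=
      LinearMap.ext fun v =>
        fderiv_symm_fderiv_of_contDiffOn hn h.contDiffOn h.contDiffOn_symm hx v
    rw [this, Submodule.map_id]

theorem IsGermIso.trans (hn : 1 ≤ n) (h : IsGermIso n D p D' p' φ) (h' : IsGermIso n D' p' D'' p'' ψ) :
    IsGermIso n D p D'' p'' (φ.trans ψ) where
  mem_source := by
    rw [φ.trans_source]
    exact ⟨h.mem_source, by rw [Set.mem_preimage, h.map_eq]; exact h'.mem_source⟩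
  map_eq := by
    rw [φ.coe_trans, Function.comp_apply, h.map_eq, h'.map_eq]
  contDiffOn := by
    rw [φ.coe_trans, φ.trans_source]
    exact h'.contDiffOn.comp (h.contDiffOn.mono Set.inter_subset_left) fun x hx => hx.2
  contDiffOn_symm := by
    rw [φ.coe_trans_symm, φ.trans_target]
    exact h.contDiffOn_symm.comp (h'.contDiffOn_symm.mono Set.inter_subset_left) fun x hx => hx.2
  map_fderiv := by
    intro x hx
    have hn0 : n ≠ 0 := (lt_of_lt_of_le one_pos hn).ne'
    rw [φ.trans_source] at hx
    rw [φ.coe_trans, Function.comp_apply, h'.map_fderiv _ hx.2, h.map_fderiv x hx.1,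
      fderiv_comp x ((h'.contDiffOn.contDiffAt (ψ.open_source.mem_nhds hx.2)).differentiableAt hn0)
        ((h.contDiffOn.contDiffAt (φ.open_source.mem_nhds hx.1)).differentiableAt hn0),
      ← Submodule.map_comp]
    rfl

theorem IsGermIso.isSection (hn : n = ∞ ∨ n = ω) (h : IsGermIso n D p D' p' φ)
    {X : (Fin N → ℝ) → (Fin N → ℝ)} (hX : IsSection n D p X) :
    IsSection n D' p' (inCoords φ X) := by
  rw [← h.map_eq]
  refine ⟨smoothNear_inCoords hn h.contDiffOn h.contDiffOn_symm h.mem_source hX.1, ?_⟩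
  rw [eventually_nhds_map h.mem_source]
  filter_upwards [hX.2, φ.open_source.mem_nhds h.mem_source] with x hx hxs
  rw [inCoords_apply_map X hxs, h.map_fderiv x hxs]
  exact ⟨X x, hx, rfl⟩

theorem smoothNear_of_mem_smallFlag (hn : n = ∞ ∨ n = ω) {i : ℕ} {Y : (Fin N → ℝ) → (Fin N → ℝ)}
    (hY : Y ∈ smallFlag n D p i) : SmoothNear n Y p := by
  let S : Submodule ℝ ((Fin N → ℝ) → (Fin N → ℝ)) :=
    { carrier := {Y | SmoothNear n Y p}
      zero_mem' := Eventually.of_forall fun x => contDiffAt_const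
      add_mem' := fun {X Y} hX hY => by
        filter_upwards [hX, hY] with x h1 h2 using h1.add h2
      smul_mem' := fun r X hX => by
        filter_upwards [hX] with x h1 using contDiffAt_const.smul h1 }
  suffices h : smallFlag n D p i ≤ S from h hY
  induction i generalizing Y with
  | zero => exact Submodule.span_le.2 fun X hX => hX.1
  | succ i ih =>
    have ih' : smallFlag n D p i ≤ S := by
      by_cases h : ∃ Y, Y ∈ smallFlag n D p i
      · obtain ⟨Y, hY⟩ := h
        exact ih hY
      · exact fun Y hY => absurd ⟨Y, hY⟩ h
    refine sup_le ih' (Submodule.span_le.2 ?_)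
    rintro _ ⟨X, Y, hX, hY, rfl⟩
    have h1 : SmoothNear n X p := hX.1
    have h2 : SmoothNear n Y p := ih' hY
    change SmoothNear n _ p
    filter_upwards [h1, h2] with x k1 k2
    exact k1.lieBracket_vectorField k2 (add_one_le_of_infty_or_omega hn)

theorem smallFlag_mono (i : ℕ) : smallFlag n D p i ≤ smallFlag n D p (i + 1) := le_sup_left

theorem lieBracket_mem_smallFlag {i : ℕ} {X Y : (Fin N → ℝ) → (Fin N → ℝ)} (hX : IsSection n D p X)
    (hY : Y ∈ smallFlag n D p i) : VectorField.lieBracket ℝ X Y ∈ smallFlag n D p (i + 1) :=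
  Submodule.mem_sup_right (Submodule.subset_span ⟨X, Y, hX, hY, rfl⟩)

/-- A field that vanishes near `p` is a section of `D`, so the modules of the small flag see only
germs. Identities of brackets that hold merely near `p` can therefore be used. -/
theorem mem_smallFlag_congr {i : ℕ} {Y Y' : (Fin N → ℝ) → (Fin N → ℝ)}
    (hY : Y ∈ smallFlag n D p i) (h : Y =ᶠ[𝓝 p] Y') : Y' ∈ smallFlag n D p i := by
  have h0 : Y' - Y ∈ smallFlag n D p 0 := by
    refine Submodule.subset_span ⟨?_, ?_⟩
    · filter_upwards [h.eventually_nhds] with x hx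
      have : (fun _ => (0 : Fin N → ℝ)) =ᶠ[𝓝 x] Y' - Y := by
        filter_upwards [hx] with y hy
        simp [hy]
      exact contDiffAt_const.congr_of_eventuallyEq this.symm
    · filter_upwards [h] with x hx
      simp [hx]
  have hle : ∀ i, smallFlag n D p 0 ≤ smallFlag n D p i := fun i => by
    induction i with
    | zero => exact le_rfl
    | succ i ih => exact ih.trans (smallFlag_mono i)
  have := (smallFlag n D p i).add_mem (hle i h0) hY
  simpa using this

theorem IsGermIso.inCoords_mem_smallFlag (hn : n = ∞ ∨ n = ω) (h : IsGermIso n D p D' p' φ) (i : ℕ) :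
    (smallFlag n D p i).map (inCoordsLinear φ) ≤ smallFlag n D' p' i := by
  rw [Submodule.map_le_iff_le_comap]
  induction i with
  | zero => exact Submodule.span_le.2 fun X hX => Submodule.subset_span (h.isSection hn hX)
  | succ i ih =>
    refine sup_le (ih.trans (Submodule.comap_mono (smallFlag_mono i))) (Submodule.span_le.2 ?_)
    rintro _ ⟨X, Y, hX, hY, rfl⟩
    have h1 := lieBracket_mem_smallFlag (h.isSection hn hX) (ih hY)
    have h2 := lieBracket_inCoords hn h.contDiffOn h.contDiffOn_symm h.mem_source hX.1
      (smoothNear_of_mem_smallFlag hn hY)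
    rw [h.map_eq] at h2
    exact mem_smallFlag_congr h1 h2.symm

theorem IsGermIso.smallGrowth_le (hn : n = ∞ ∨ n = ω) (h : IsGermIso n D p D' p' φ) (i : ℕ) :
    smallGrowth n D p i ≤ smallGrowth n D' p' i := by
  have hn1 : 1 ≤ n := natCast_le_of_infty_or_omega hn 1
  let A : (Fin N → ℝ) →ₗ[ℝ] (Fin N → ℝ) := (fderiv ℝ φ p).toLinearMap
  have hA : Function.Injective A := Function.LeftInverse.injective
    (g := fderiv ℝ φ.symm (φ p)) fun v =>
      fderiv_symm_fderiv_of_contDiffOn hn1 h.contDiffOn h.contDiffOn_symm h.mem_source v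
  rw [smallGrowth, smallGrowth, (Submodule.equivMapOfInjective A hA _).finrank_eq]
  refine Submodule.finrank_mono ?_
  rw [← Submodule.map_comp, Submodule.map_le_iff_le_comap]
  intro Y hY
  refine ⟨inCoords φ Y, h.inCoords_mem_smallFlag hn i ⟨Y, hY, rfl⟩, ?_⟩
  have := inCoords_apply_map Y h.mem_source
  rw [h.map_eq] at this
  exact this

theorem IsGermIso.smallGrowth_eq (hn : n = ∞ ∨ n = ω) (h : IsGermIso n D p D' p' φ) :
    smallGrowth n D p = smallGrowth n D' p' :=
  funext fun i => (h.smallGrowth_le hn i).antisymm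
    ((h.symm (natCast_le_of_infty_or_omega hn 1)).smallGrowth_le hn i)

theorem inCoords_symm_inCoords (hn : 1 ≤ n) (h : IsGermIso n D p D' p' φ)
    (X : (Fin N → ℝ) → (Fin N → ℝ)) : inCoords φ (inCoords φ.symm X) =ᶠ[𝓝 p'] X := by
  rw [← h.map_eq]
  change ∀ᶠ y in 𝓝 (φ p), _
  rw [eventually_nhds_map h.mem_source]
  filter_upwards [φ.open_source.mem_nhds h.mem_source] with x hx
  rw [inCoords_apply_map _ hx, inCoords, φ.symm_symm,
    fderiv_fderiv_symm_of_contDiffOn hn h.contDiffOn h.contDiffOn_symm hx]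

theorem IsGermIso.isFrame (hn : n = ∞ ∨ n = ω) (h : IsGermIso n D p D' p' φ) {m : ℕ}
    {X : Fin m → (Fin N → ℝ) → (Fin N → ℝ)} (hX : IsFrame n D p X) :
    IsFrame n D' p' fun i => inCoords φ (X i) := by
  have hn1 : 1 ≤ n := natCast_le_of_infty_or_omega hn 1
  rw [← h.map_eq]
  refine ⟨fun i => smoothNear_inCoords hn h.contDiffOn h.contDiffOn_symm h.mem_source (hX.1 i), ?_⟩
  rw [eventually_nhds_map h.mem_source]
  filter_upwards [hX.2, φ.open_source.mem_nhds h.mem_source] with x ⟨h1, h2⟩ hx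
  have h3 : (fun i => inCoords φ (X i) (φ x)) = fderiv ℝ φ x ∘ fun i => X i x :=
    funext fun i => inCoords_apply_map (X i) hx
  have hinj : Function.Injective (fderiv ℝ φ x) := Function.LeftInverse.injective
    (g := fderiv ℝ φ.symm (φ x)) fun v =>
      fderiv_symm_fderiv_of_contDiffOn hn1 h.contDiffOn h.contDiffOn_symm hx v
  rw [h3]
  refine ⟨h1.map' (fderiv ℝ φ x : (Fin N → ℝ) →ₗ[ℝ] (Fin N → ℝ)) (LinearMap.ker_eq_bot.2 hinj), ?_⟩
  rw [h.map_fderiv x hx, h2, Submodule.map_span, Set.range_comp]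
  rfl

theorem contDiffAt_dirDeriv (hn : n = ∞ ∨ n = ω) {f : (Fin N → ℝ) → ℝ}
    {X : (Fin N → ℝ) → (Fin N → ℝ)} (hf : ∀ᶠ x in 𝓝 p, ContDiffAt ℝ n f x)
    (hX : SmoothNear n X p) : ∀ᶠ x in 𝓝 p, ContDiffAt ℝ n (dirDeriv X f) x := by
  filter_upwards [hf, hX] with x h1 h2 using contDiffAt_fderiv_apply hn h1 h2

theorem contDiffAt_foldr_dirDeriv (hn : n = ∞ ∨ n = ω) {f : (Fin N → ℝ) → ℝ}
    (hf : ∀ᶠ x in 𝓝 p, ContDiffAt ℝ n f x) (l : List ((Fin N → ℝ) → (Fin N → ℝ)))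
    (hl : ∀ X ∈ l, IsSection n D p X) :
    ∀ᶠ x in 𝓝 p, ContDiffAt ℝ n (l.foldr dirDeriv f) x := by
  induction l with
  | nil => exact hf
  | cons X l ih =>
    exact contDiffAt_dirDeriv hn (ih fun Y hY => hl Y (List.mem_cons_of_mem _ hY))
      (hl X List.mem_cons_self).1

theorem foldr_dirDeriv_congr {f g : (Fin N → ℝ) → ℝ} (h : f =ᶠ[𝓝 p] g)
    (l : List ((Fin N → ℝ) → (Fin N → ℝ))) : l.foldr dirDeriv f =ᶠ[𝓝 p] l.foldr dirDeriv g := by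
  induction l with
  | nil => exact h
  | cons X l ih =>
    filter_upwards [ih.eventually_nhds] with x hx
    have h1 := Filter.EventuallyEq.fderiv_eq (𝕜 := ℝ) hx
    change fderiv ℝ _ x (X x) = fderiv ℝ _ x (X x)
    rw [h1]

theorem IsGermIso.foldr_dirDeriv (hn : n = ∞ ∨ n = ω) (h : IsGermIso n D p D' p' φ)
    {f : (Fin N → ℝ) → ℝ} (hf : ∀ᶠ x in 𝓝 p', ContDiffAt ℝ n f x)
    (l : List ((Fin N → ℝ) → (Fin N → ℝ))) (hl : ∀ X ∈ l, IsSection n D p X) :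
    l.foldr dirDeriv (f ∘ φ) =ᶠ[𝓝 p] (l.map (inCoords φ)).foldr dirDeriv f ∘ φ := by
  have hn0 : n ≠ 0 := (lt_of_lt_of_le one_pos (natCast_le_of_infty_or_omega hn 1)).ne'
  induction l with
  | nil => exact EventuallyEq.rfl
  | cons X l ih =>
    have ih' := ih fun Y hY => hl Y (List.mem_cons_of_mem _ hY)
    have hs := contDiffAt_foldr_dirDeriv (D := D') hn hf (l.map (inCoords φ)) (by
      intro Y hY
      obtain ⟨Z, hZ, rfl⟩ := List.mem_map.1 hY
      exact h.isSection hn (hl Z (List.mem_cons_of_mem _ hZ)))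
    rw [← h.map_eq, eventually_nhds_map h.mem_source] at hs
    filter_upwards [ih'.eventually_nhds, hs, φ.open_source.mem_nhds h.mem_source] with x h1 h2 hx
    simp only [List.foldr_cons, List.map_cons, Function.comp_apply]
    have h3 := congrArg (fun L : (Fin N → ℝ) →L[ℝ] ℝ => L (X x)) (Filter.EventuallyEq.fderiv_eq h1)
    refine h3.trans ?_
    exact dirDeriv_inCoords hx
      ((h.contDiffOn.contDiffAt (φ.open_source.mem_nhds hx)).differentiableAt hn0)
      (h2.differentiableAt hn0)

theorem IsGermIso.hasNonholonomicOrder (hn : n = ∞ ∨ n = ω) (h : IsGermIso n D p D' p' φ)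
    {f : (Fin N → ℝ) → ℝ} (hf : ∀ᶠ x in 𝓝 p', ContDiffAt ℝ n f x) {s : ℕ}
    (ho : HasNonholonomicOrder n D' p' f s) : HasNonholonomicOrder n D p (f ∘ φ) s := by
  have hn1 : 1 ≤ n := natCast_le_of_infty_or_omega hn 1
  have hsymm := h.symm hn1
  refine ⟨fun l hl hls => ?_, ?_⟩
  · rw [(h.foldr_dirDeriv hn hf l hl).self_of_nhds, Function.comp_apply, h.map_eq]
    refine ho.1 _ (fun X hX => ?_) (by simpa using hls)
    obtain ⟨Z, hZ, rfl⟩ := List.mem_map.1 hX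
    exact h.isSection hn (hl Z hZ)
  · obtain ⟨l, hl, hls, hne⟩ := ho.2
    refine ⟨l.map (inCoords φ.symm), fun X hX => ?_, by simpa using hls, ?_⟩
    · obtain ⟨Z, hZ, rfl⟩ := List.mem_map.1 hX
      exact hsymm.isSection hn (hl Z hZ)
    · have hfφ : ∀ᶠ x in 𝓝 p, ContDiffAt ℝ n (f ∘ φ) x := by
        rw [← h.map_eq, eventually_nhds_map h.mem_source] at hf
        filter_upwards [hf, φ.open_source.mem_nhds h.mem_source] with x h1 hx
        exact h1.comp x (h.contDiffOn.contDiffAt (φ.open_source.mem_nhds hx))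
      have h1 := (hsymm.foldr_dirDeriv hn hfφ l hl).self_of_nhds
      have h2 : f =ᶠ[𝓝 p'] (f ∘ φ) ∘ φ.symm := by
        rw [← h.map_eq]
        filter_upwards [φ.open_target.mem_nhds (φ.map_source h.mem_source)] with y hy
        simp [φ.right_inv hy]
      rw [(foldr_dirDeriv_congr h2 l).self_of_nhds, h1, Function.comp_apply, hsymm.map_eq] at hne
      exact hne

/-- Positive weights make the curve `ε ↦ (ε ^ w i * y i)` tend to 0, so only the germ at 0 matters.
-/
theorem homogPart_congr {w : Fin N → ℕ} (hw : ∀ i, 1 ≤ w i) (d : ℕ) {f g : (Fin N → ℝ) → ℝ}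
    (h : f =ᶠ[𝓝 0] g) (y : Fin N → ℝ) : homogPart w d f y = homogPart w d g y := by
  have hc : Tendsto (fun ε : ℝ => fun i => ε ^ w i * y i) (𝓝 0) (𝓝 0) := by
    have : Continuous fun ε : ℝ => fun i => ε ^ w i * y i := by fun_prop
    refine this.tendsto' _ _ (funext fun i => ?_)
    rw [zero_pow (by have := hw i; omega), zero_mul]
    rfl
  have h1 : (fun ε : ℝ => f fun i => ε ^ w i * y i) =ᶠ[𝓝 0] fun ε => g fun i => ε ^ w i * y i :=
    hc.eventually h
  rw [homogPart, homogPart, h1.iteratedDeriv_eq]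

theorem nilpotentPart_congr {w : Fin N → ℕ} (hw : ∀ i, 1 ≤ w i)
    {Z Z' : (Fin N → ℝ) → (Fin N → ℝ)} (h : Z =ᶠ[𝓝 0] Z') :
    nilpotentPart w Z = nilpotentPart w Z' := by
  funext y j
  refine homogPart_congr hw _ ?_ y
  filter_upwards [h] with x hx
  rw [hx]

/-- Adapted coordinates `z` of `D'` become adapted coordinates `z ∘ φ` of `D`. The pulled back frame
has the same expression in them, so the very same `Dhat` approximates both germs. -/
theorem IsGermIso.stronglyNilpotent (hn : n = ∞ ∨ n = ω) (h : IsGermIso n D p D' p' φ)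
    (hD' : StronglyNilpotent n D' p') : StronglyNilpotent n D p := by
  have hn1 : 1 ≤ n := natCast_le_of_infty_or_omega hn 1
  have hn0 : n ≠ 0 := (lt_of_lt_of_le one_pos hn1).ne'
  obtain ⟨Dhat, ⟨m, X, w, z, hX, ⟨hw, hz1, hz2, hz3, hz4, hz5⟩, hDhat⟩, he⟩ := hD'
  rw [germEquiv_iff_exists_isGermIso] at he
  obtain ⟨ψ, hψ⟩ := he
  have hz3' : ∀ᶠ x in 𝓝 p', ContDiffAt ℝ n z x := by
    filter_upwards [z.open_source.mem_nhds hz1] with x hx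
    exact hz3.contDiffAt (z.open_source.mem_nhds hx)
  refine ⟨Dhat, ⟨m, fun i => inCoords φ.symm (X i), w, φ.trans z, (h.symm hn1).isFrame hn hX,
    ⟨?_, ?_, ?_, ?_, ?_, ?_⟩, ?_⟩, germEquiv_iff_exists_isGermIso.2 ⟨_, h.trans hn1 hψ⟩⟩
  · rw [IsWeights, h.smallGrowth_eq hn]
    exact hw
  · rw [φ.trans_source]
    exact ⟨h.mem_source, by rw [Set.mem_preimage, h.map_eq]; exact hz1⟩
  · rw [φ.coe_trans, Function.comp_apply, h.map_eq, hz2]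
  · rw [φ.coe_trans, φ.trans_source]
    exact hz3.comp (h.contDiffOn.mono Set.inter_subset_left) fun x hx => hx.2
  · rw [φ.coe_trans_symm, φ.trans_target]
    exact h.contDiffOn_symm.comp (hz4.mono Set.inter_subset_left) fun x hx => hx.2
  · intro i
    refine h.hasNonholonomicOrder hn (f := fun x => z x i) ?_ (hz5 i)
    filter_upwards [hz3'] with x hx using contDiffAt_pi.1 hx i
  · intro y
    rw [hDhat]
    congr 2
    funext i
    refine congrFun (nilpotentPart_congr (fun i => (hw i).1) ?_) y
    rw [← hz2]
    change ∀ᶠ y in 𝓝 (z p'), _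
    rw [eventually_nhds_map hz1]
    have h1 := inCoords_symm_inCoords hn1 h (X i)
    filter_upwards [z.open_source.mem_nhds hz1, h1,
      φ.open_target.mem_nhds (h.symm hn1).mem_source] with x hx hxi hxt
    rw [inCoords_apply_map _ hx, ← hxi]
    obtain ⟨q, hq, rfl⟩ : ∃ q ∈ φ.source, φ q = x :=
      ⟨φ.symm x, φ.map_target hxt, φ.right_inv hxt⟩
    have h2 : q ∈ (φ.trans z).source := by
      rw [φ.trans_source]; exact ⟨hq, hx⟩
    have h3 := inCoords_apply_map (φ := φ.trans z) (inCoords φ.symm (X i)) h2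
    rw [φ.coe_trans, Function.comp_apply] at h3
    rw [h3, inCoords_apply_map _ hq, fderiv_comp q
      ((hz3.contDiffAt (z.open_source.mem_nhds hx)).differentiableAt hn0)
      ((h.contDiffOn.contDiffAt (φ.open_source.mem_nhds hq)).differentiableAt hn0)]
    rfl

end Transport

/-! ### Weighted orders of vanishing and the small flag of the pseudo-normal forms -/

section WeightedOrder

variable {n : WithTop ℕ∞} {N : ℕ} {w : Fin N → ℕ} {s t : ℕ} {f g : (Fin N → ℝ) → ℝ}

/-- The germ at 0 of `f` has order at least `s`, when the coordinate `x i` is given weight `w i`. -/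
inductive HasWeightedOrder (n : WithTop ℕ∞) (w : Fin N → ℕ) : ℕ → ((Fin N → ℝ) → ℝ) → Prop
  | smooth {f : (Fin N → ℝ) → ℝ} (hf : ∀ᶠ x in 𝓝 0, ContDiffAt ℝ n f x) : HasWeightedOrder n w 0 f
  | zero (s : ℕ) : HasWeightedOrder n w s fun _ => 0
  | coord (i : Fin N) : HasWeightedOrder n w (w i) fun x => x i
  | mul {s t : ℕ} {f g : (Fin N → ℝ) → ℝ} (hf : HasWeightedOrder n w s f)
      (hg : HasWeightedOrder n w t g) : HasWeightedOrder n w (s + t) fun x => f x * g x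
  | add {s : ℕ} {f g : (Fin N → ℝ) → ℝ} (hf : HasWeightedOrder n w s f)
      (hg : HasWeightedOrder n w s g) : HasWeightedOrder n w s fun x => f x + g x
  | mono {s t : ℕ} {f : (Fin N → ℝ) → ℝ} (hst : s ≤ t) (hf : HasWeightedOrder n w t f) :
      HasWeightedOrder n w s f
  | congr {s : ℕ} {f g : (Fin N → ℝ) → ℝ} (h : f =ᶠ[𝓝 0] g) (hf : HasWeightedOrder n w s f) :
      HasWeightedOrder n w s g

theorem HasWeightedOrder.contDiffAt (hf : HasWeightedOrder n w s f) :
    ∀ᶠ x in 𝓝 0, ContDiffAt ℝ n f x := by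
  induction hf with
  | smooth hf => exact hf
  | zero s => exact Eventually.of_forall fun x => contDiffAt_const
  | coord i => exact Eventually.of_forall fun x => (contDiff_apply ℝ ℝ i).contDiffAt
  | mul _ _ h1 h2 => filter_upwards [h1, h2] with x k1 k2 using k1.mul k2
  | add _ _ h1 h2 => filter_upwards [h1, h2] with x k1 k2 using k1.add k2
  | mono _ _ h => exact h
  | congr h _ h1 =>
    filter_upwards [h1, h.eventually_nhds] with x k1 k2 using k1.congr_of_eventuallyEq (EventuallyEq.symm k2)

/-- The only consequence of positive order that is needed. Weights may be 0, and a product of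
positive order has a factor of positive order. -/
theorem HasWeightedOrder.apply_zero (hf : HasWeightedOrder n w s f) (hs : 1 ≤ s) : f 0 = 0 := by
  induction hf with
  | smooth hf => omega
  | zero s => rfl
  | coord i => rfl
  | @mul s t f g _ _ h1 h2 =>
    rcases Nat.eq_zero_or_pos s with h | h
    · simp [h2 (by omega)]
    · simp [h1 h]
  | add _ _ h1 h2 => simp [h1 hs, h2 hs]
  | mono h _ h1 => exact h1 (hs.trans h)
  | congr h _ h1 => rw [← h.self_of_nhds, h1 hs]

theorem HasWeightedOrder.mul_left (hf : ∀ᶠ x in 𝓝 0, ContDiffAt ℝ n f x)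
    (hg : HasWeightedOrder n w s g) : HasWeightedOrder n w s fun x => f x * g x :=
  .mono (by omega) (.mul (.smooth hf) hg)

theorem HasWeightedOrder.mul_right (hf : HasWeightedOrder n w s f)
    (hg : ∀ᶠ x in 𝓝 0, ContDiffAt ℝ n g x) : HasWeightedOrder n w s fun x => f x * g x :=
  .mul hf (.smooth hg)

/-- A field whose `i`-th component has order at least `w i - 1` lowers orders by at most one. -/
theorem HasWeightedOrder.dirDeriv (hn : n = ∞ ∨ n = ω) {X : (Fin N → ℝ) → (Fin N → ℝ)}
    (hX : SmoothNear n X 0) (hXw : ∀ i, HasWeightedOrder n w (w i - 1) fun x => X x i)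
    (hf : HasWeightedOrder n w s f) : HasWeightedOrder n w (s - 1) (dirDeriv X f) := by
  have hn0 : n ≠ 0 := (lt_of_lt_of_le one_pos (natCast_le_of_infty_or_omega hn 1)).ne'
  induction hf with
  | smooth hf => exact .smooth (contDiffAt_dirDeriv hn hf hX)
  | zero s =>
    refine .congr (.of_forall fun x => ?_) (.zero _)
    simp [_root_.dirDeriv]
  | coord i =>
    refine .congr (.of_forall fun x => ?_) (hXw i)
    change X x i = fderiv ℝ (fun x : Fin N → ℝ => x i) x (X x)
    rw [(hasFDerivAt_apply i x).fderiv]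
    rfl
  | @mul s t f g hf hg h1 h2 =>
    have : HasWeightedOrder n w (s + t - 1) fun x => f x * _root_.dirDeriv X g x + g x * _root_.dirDeriv X f x :=
      .add (.mono (by omega) (.mul hf h2)) (.mono (by omega) (.mul hg h1))
    refine .congr ?_ this
    filter_upwards [hf.contDiffAt, hg.contDiffAt] with x k1 k2
    simp [_root_.dirDeriv, fderiv_fun_mul (k1.differentiableAt hn0) (k2.differentiableAt hn0)]
  | @add s f g hf hg h1 h2 =>
    refine .congr ?_ (.add h1 h2)
    filter_upwards [hf.contDiffAt, hg.contDiffAt] with x k1 k2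
    simp [_root_.dirDeriv, fderiv_fun_add (k1.differentiableAt hn0) (k2.differentiableAt hn0)]
  | mono h _ h1 => exact .mono (by omega) h1
  | congr h _ h1 => exact .congr (foldr_dirDeriv_congr h [X]) h1

theorem HasWeightedOrder.foldr_dirDeriv (hn : n = ∞ ∨ n = ω)
    {D : (Fin N → ℝ) → Submodule ℝ (Fin N → ℝ)}
    (hD : ∀ X, IsSection n D 0 X → ∀ i, HasWeightedOrder n w (w i - 1) fun x => X x i)
    (hf : HasWeightedOrder n w s f) (l : List ((Fin N → ℝ) → (Fin N → ℝ)))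
    (hl : ∀ X ∈ l, IsSection n D 0 X) :
    HasWeightedOrder n w (s - l.length) (l.foldr _root_.dirDeriv f) := by
  induction l with
  | nil => exact hf
  | cons X l ih =>
    have hX := hl X List.mem_cons_self
    have := (ih fun Y hY => hl Y (List.mem_cons_of_mem _ hY)).dirDeriv hn hX.1 (hD X hX)
    simpa [Nat.sub_sub] using this

end WeightedOrder

/-! ### Bounding the small flag and counting dimensions -/

section SmallFlag

variable {n : WithTop ℕ∞} {N : ℕ} {D : (Fin N → ℝ) → Submodule ℝ (Fin N → ℝ)} {p : Fin N → ℝ}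

/-- The sections of a family of subspaces form a linear space. -/
def sectionSubmodule (n : WithTop ℕ∞) (D : (Fin N → ℝ) → Submodule ℝ (Fin N → ℝ)) (p : Fin N → ℝ) :
    Submodule ℝ ((Fin N → ℝ) → (Fin N → ℝ)) where
  carrier := {Y | IsSection n D p Y}
  zero_mem' := ⟨Eventually.of_forall fun x => contDiffAt_const, .of_forall fun x => (D x).zero_mem⟩
  add_mem' := by
    rintro X Y ⟨h1, h2⟩ ⟨k1, k2⟩
    refine ⟨?_, ?_⟩
    · filter_upwards [h1, k1] with x h1 h2 using h1.add h2
    · filter_upwards [h2, k2] with x h1 h2 using (D x).add_mem h1 h2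
  smul_mem' := by
    rintro r X ⟨h1, h2⟩
    refine ⟨?_, ?_⟩
    · filter_upwards [h1] with x h1 using contDiffAt_const.smul h1
    · filter_upwards [h2] with x h1 using (D x).smul_mem r h1

theorem smallFlag_le_of_lieBracket_mem {M : ℕ → Submodule ℝ ((Fin N → ℝ) → (Fin N → ℝ))}
    (h0 : ∀ X, IsSection n D p X → X ∈ M 0) (hM : ∀ i, M i ≤ M (i + 1))
    (h : ∀ i X Y, IsSection n D p X → Y ∈ smallFlag n D p i → Y ∈ M i →
      VectorField.lieBracket ℝ X Y ∈ M (i + 1)) (i : ℕ) :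
    smallFlag n D p i ≤ M i := by
  induction i with
  | zero => exact Submodule.span_le.2 h0
  | succ i ih =>
    refine sup_le (ih.trans (hM i)) (Submodule.span_le.2 ?_)
    rintro _ ⟨X, Y, hX, hY, rfl⟩
    exact h i X Y hX hY (ih hY)

/-- The values at `p` of a member of the small flag. -/
def smallFlagAt (n : WithTop ℕ∞) (D : (Fin N → ℝ) → Submodule ℝ (Fin N → ℝ)) (p : Fin N → ℝ)
    (i : ℕ) : Submodule ℝ (Fin N → ℝ) :=
  (smallFlag n D p i).map (LinearMap.proj p : ((Fin N → ℝ) → (Fin N → ℝ)) →ₗ[ℝ] (Fin N → ℝ))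

theorem smallFlagAt_mono : Monotone (smallFlagAt n D p) :=
  monotone_nat_of_le_succ fun i => Submodule.map_mono (smallFlag_mono i)

theorem finrank_eq_of_basis {V : Type*} [AddCommGroup V] [Module ℝ V]
    (b : Module.Basis (Fin N) ℝ V) (S : Submodule ℝ V) {k : ℕ} (hk : k ≤ N)
    (h1 : ∀ j : Fin N, (j : ℕ) < k → b j ∈ S)
    (h2 : ∀ v ∈ S, ∀ j : Fin N, k ≤ (j : ℕ) → b.repr v j = 0) : Module.finrank ℝ S = k := by
  have hS : S = Submodule.span ℝ (Set.range (b ∘ Fin.castLE hk)) := by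
    refine le_antisymm (fun v hv => ?_) (Submodule.span_le.2 ?_)
    · rw [← b.sum_repr v]
      refine Submodule.sum_mem _ fun j _ => ?_
      rcases lt_or_ge (j : ℕ) k with h | h
      · exact Submodule.smul_mem _ _ (Submodule.subset_span ⟨⟨j, h⟩, rfl⟩)
      · rw [h2 v hv j h, zero_smul]
        exact Submodule.zero_mem _
    · rintro _ ⟨j, rfl⟩
      exact h1 _ j.2
  rw [hS, finrank_span_eq_card (b.linearIndependent.comp _ (Fin.castLE_injective hk)),
    Fintype.card_fin]

end SmallFlag

/-! ### Brackets with sections of the pseudo-normal form -/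

section PseudoNormalForm

variable {n : WithTop ℕ∞} {b c B C : ℝ}

/-- The sections of this distribution of rank `3 + 2 * d` (11 for `d ≥ 4`) contain the `d`-th member
of the small flag of the pseudo-normal form. -/
def ekrFlag (b c B C : ℝ) (d : ℕ) (x : Fin 11 → ℝ) : Submodule ℝ (Fin 11 → ℝ) where
  carrier := {v | (d < 4 → v 1 = x 3 * v 0 ∧ v 2 = x 4 * v 0) ∧
    (d < 3 → v 0 = x 5 * v 3 ∧ v 4 = x 6 * v 3) ∧
    (d < 2 → v 5 = (b + x 7) * v 3 ∧ v 6 = (c + x 8) * v 3) ∧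
    (d < 1 → v 7 = (B + x 9) * v 3 ∧ v 8 = (C + x 10) * v 3)}
  zero_mem' := by simp
  add_mem' := by
    rintro u v ⟨h1, h2, h3, h4⟩ ⟨k1, k2, k3, k4⟩
    refine ⟨fun h => ⟨?_, ?_⟩, fun h => ⟨?_, ?_⟩, fun h => ⟨?_, ?_⟩, fun h => ⟨?_, ?_⟩⟩
    · rw [Pi.add_apply, Pi.add_apply, (h1 h).1, (k1 h).1]; ring
    · rw [Pi.add_apply, Pi.add_apply, (h1 h).2, (k1 h).2]; ring
    · rw [Pi.add_apply, Pi.add_apply, (h2 h).1, (k2 h).1]; ring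
    · rw [Pi.add_apply, Pi.add_apply, (h2 h).2, (k2 h).2]; ring
    · rw [Pi.add_apply, Pi.add_apply, (h3 h).1, (k3 h).1]; ring
    · rw [Pi.add_apply, Pi.add_apply, (h3 h).2, (k3 h).2]; ring
    · rw [Pi.add_apply, Pi.add_apply, (h4 h).1, (k4 h).1]; ring
    · rw [Pi.add_apply, Pi.add_apply, (h4 h).2, (k4 h).2]; ring
  smul_mem' := by
    rintro a v ⟨h1, h2, h3, h4⟩
    refine ⟨fun h => ⟨?_, ?_⟩, fun h => ⟨?_, ?_⟩, fun h => ⟨?_, ?_⟩, fun h => ⟨?_, ?_⟩⟩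
    · rw [Pi.smul_apply, Pi.smul_apply, smul_eq_mul, smul_eq_mul, (h1 h).1]; ring
    · rw [Pi.smul_apply, Pi.smul_apply, smul_eq_mul, smul_eq_mul, (h1 h).2]; ring
    · rw [Pi.smul_apply, Pi.smul_apply, smul_eq_mul, smul_eq_mul, (h2 h).1]; ring
    · rw [Pi.smul_apply, Pi.smul_apply, smul_eq_mul, smul_eq_mul, (h2 h).2]; ring
    · rw [Pi.smul_apply, Pi.smul_apply, smul_eq_mul, smul_eq_mul, (h3 h).1]; ring
    · rw [Pi.smul_apply, Pi.smul_apply, smul_eq_mul, smul_eq_mul, (h3 h).2]; ring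
    · rw [Pi.smul_apply, Pi.smul_apply, smul_eq_mul, smul_eq_mul, (h4 h).1]; ring
    · rw [Pi.smul_apply, Pi.smul_apply, smul_eq_mul, smul_eq_mul, (h4 h).2]; ring

theorem mem_ekrFlag {d : ℕ} {x v : Fin 11 → ℝ} : v ∈ ekrFlag b c B C d x ↔
    (d < 4 → v 1 = x 3 * v 0 ∧ v 2 = x 4 * v 0) ∧
    (d < 3 → v 0 = x 5 * v 3 ∧ v 4 = x 6 * v 3) ∧
    (d < 2 → v 5 = (b + x 7) * v 3 ∧ v 6 = (c + x 8) * v 3) ∧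
    (d < 1 → v 7 = (B + x 9) * v 3 ∧ v 8 = (C + x 10) * v 3) := Iff.rfl

/-- The structure equation of `dxᵢ = (r + xₖ) dxⱼ`. The correction term measures the failure of a
bracket to satisfy the equation again. -/
theorem lieBracket_apply_of_pfaff {N : ℕ} {X Y : (Fin N → ℝ) → (Fin N → ℝ)} {x : Fin N → ℝ}
    {i j k : Fin N} (r : ℝ) (hX : DifferentiableAt ℝ X x) (hY : DifferentiableAt ℝ Y x)
    (hXi : ∀ᶠ y in 𝓝 x, X y i = (r + y k) * X y j) (hYi : ∀ᶠ y in 𝓝 x, Y y i = (r + y k) * Y y j) :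
    VectorField.lieBracket ℝ X Y x i = (r + x k) * VectorField.lieBracket ℝ X Y x j +
      (X x k * Y x j - Y x k * X x j) := by
  have hc : ∀ (l : Fin N) (y v : Fin N → ℝ), fderiv ℝ (fun y : Fin N → ℝ => y l) y v = v l :=
    fun l y v => by rw [(hasFDerivAt_apply l y).fderiv]; rfl
  have ha : ∀ v, fderiv ℝ (fun y : Fin N → ℝ => r + y k) x v = v k := fun v => by
    rw [fderiv_const_add]; exact hc k x v
  have := fderiv_lieBracket_of_pfaff (f := fun y => y i) (g := fun y => y j)
    (a := fun y => r + y k) (x := x) (X := X) (Y := Y) (contDiff_apply ℝ ℝ i).contDiffAt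
    (contDiff_apply ℝ ℝ j).contDiffAt (by fun_prop) hX hY (by simpa only [hc] using hXi)
    (by simpa only [hc] using hYi)
  simpa only [hc, ha] using this

/-- Each bracket loses only the last remaining pair of equations: the correction term of the
preceding pair vanishes, since both fields still satisfy the pair being lost. -/
theorem isSection_ekrFlag_lieBracket (hn : n = ∞ ∨ n = ω) {d : ℕ}
    {X Y : (Fin 11 → ℝ) → (Fin 11 → ℝ)} {p : Fin 11 → ℝ}
    (hX : IsSection n (ekr1211 b c B C) p X) (hY : IsSection n (ekrFlag b c B C d) p Y) :
    IsSection n (ekrFlag b c B C (d + 1)) p (VectorField.lieBracket ℝ X Y) := by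
  have hn0 : n ≠ 0 := (lt_of_lt_of_le one_pos (natCast_le_of_infty_or_omega hn 1)).ne'
  refine ⟨?_, ?_⟩
  · filter_upwards [hX.1, hY.1] with x k1 k2
    exact k1.lieBracket_vectorField k2 (add_one_le_of_infty_or_omega hn)
  · filter_upwards [hX.eventually, hY.eventually] with x k1 k2
    have hXx := k1.2.self_of_nhds
    have hYx := k2.2.self_of_nhds
    have key : ∀ {i j k : Fin 11} (r : ℝ), (∀ᶠ y in 𝓝 x, X y i = (r + y k) * X y j) →
      (∀ᶠ y in 𝓝 x, Y y i = (r + y k) * Y y j) → _ := fun r h h' => lieBracket_apply_of_pfaff r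
        (k1.1.self_of_nhds.differentiableAt hn0) (k2.1.self_of_nhds.differentiableAt hn0) h h'
    have e := k1.2
    have e' := k2.2
    simp only [mem_ekr1211, mem_ekrFlag] at e e' hXx hYx ⊢
    obtain ⟨x1, x2, x0, x4, x5, x6, x7, x8⟩ := hXx
    obtain ⟨y12, y04, y56, y78⟩ := hYx
    refine ⟨fun hd => ?_, fun hd => ?_, fun hd => ?_, fun hd => by omega⟩
    · have h1 := key (i := 1) (j := 0) (k := 3) 0 (e.mono fun y h => by simpa using h.1)
        (e'.mono fun y h => by simpa using (h.1 (by omega)).1)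
      have h2 := key (i := 2) (j := 0) (k := 4) 0 (e.mono fun y h => by simpa using h.2.1)
        (e'.mono fun y h => by simpa using (h.1 (by omega)).2)
      obtain ⟨y0, y4⟩ := y04 (by omega)
      constructor
      · rw [h1, x0, y0]; ring
      · rw [h2, x0, y0, x4, y4]; ring
    · have h1 := key (i := 0) (j := 3) (k := 5) 0 (e.mono fun y h => by simpa using h.2.2.1)
        (e'.mono fun y h => by simpa using (h.2.1 (by omega)).1)
      have h2 := key (i := 4) (j := 3) (k := 6) 0 (e.mono fun y h => by simpa using h.2.2.2.1)
        (e'.mono fun y h => by simpa using (h.2.1 (by omega)).2)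
      obtain ⟨y5, y6⟩ := y56 (by omega)
      constructor
      · rw [h1, x5, y5]; ring
      · rw [h2, x6, y6]; ring
    · have h1 := key (i := 5) (j := 3) (k := 7) b (e.mono fun y h => h.2.2.2.2.1)
        (e'.mono fun y h => (h.2.2.1 (by omega)).1)
      have h2 := key (i := 6) (j := 3) (k := 8) c (e.mono fun y h => h.2.2.2.2.2.1)
        (e'.mono fun y h => (h.2.2.1 (by omega)).2)
      obtain ⟨y7, y8⟩ := y78 (by omega)
      constructor
      · rw [h1, x7, y7]; ring
      · rw [h2, x8, y8]; ring

theorem isSection_ekrFlag_of_mem_smallFlag (hn : n = ∞ ∨ n = ω) {d : ℕ} {p : Fin 11 → ℝ}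
    {Y : (Fin 11 → ℝ) → (Fin 11 → ℝ)} (hY : Y ∈ smallFlag n (ekr1211 b c B C) p d) :
    IsSection n (ekrFlag b c B C d) p Y := by
  refine smallFlag_le_of_lieBracket_mem (M := fun d => sectionSubmodule n (ekrFlag b c B C d) p)
    (fun X hX => ?_) (fun i X hX => ?_) (fun i X Y hX _ hY => ?_) d hY
  · refine hX.mono (.of_forall fun x v h => ?_)
    rw [mem_ekr1211] at h
    rw [mem_ekrFlag]
    tauto
  · refine IsSection.mono (D := ekrFlag b c B C i) hX (.of_forall fun x v h => ?_)
    rw [mem_ekrFlag] at h ⊢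
    exact ⟨fun h' => h.1 (by omega), fun h' => h.2.1 (by omega), fun h' => h.2.2.1 (by omega),
      fun h' => h.2.2.2 (by omega)⟩
  · exact isSection_ekrFlag_lieBracket hn hX hY

/-- A form which vanishes on the distribution `ekrFlag b c B C 3`. -/
def ekrForm (x v : Fin 11 → ℝ) : ℝ := v 2 - x 4 * v 0 - x 6 * (v 1 - x 3 * v 0)

/-- The multiple of `dx₁ - x₂ dt` in the form is chosen so that it also kills `∂/∂x₁ + y₃ ∂/∂y₁`, a
field of `V₅`. Differentiating that coefficient `y₃` produces the term in `c + y₄`, while `dt = x₃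
dx₂` produces the term in `x₃`. -/
theorem ekrForm_lieBracket {X Y : (Fin 11 → ℝ) → (Fin 11 → ℝ)} {x : Fin 11 → ℝ}
    (hX : DifferentiableAt ℝ X x) (hY : DifferentiableAt ℝ Y x)
    (h : ∀ᶠ y in 𝓝 x, X y ∈ ekr1211 b c B C y) :
    ekrForm x (VectorField.lieBracket ℝ X Y x) = dirDeriv X (fun y => ekrForm y (Y y)) x +
      ((c + x 8) * X x 3 * (Y x 1 - x 3 * Y x 0) - x 5 * X x 3 * (Y x 4 - x 6 * Y x 3)) := by
  have hX' := fun i => hasFDerivAt_pi'.1 hX.hasFDerivAt i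
  have hY' := fun i => hasFDerivAt_pi'.1 hY.hasFDerivAt i
  have hc := fun i : Fin 11 => hasFDerivAt_apply (𝕜 := ℝ) i x
  obtain ⟨x1, x2, x0, x4, x5, x6, x7, x8⟩ := mem_ekr1211.1 h.self_of_nhds
  have d1 := (hX' 1).unique (((hc 3).mul (hX' 0)).congr_of_eventuallyEq
    (h.mono fun y h => (mem_ekr1211.1 h).1))
  have d2 := (hX' 2).unique (((hc 4).mul (hX' 0)).congr_of_eventuallyEq
    (h.mono fun y h => (mem_ekr1211.1 h).2.1))
  have d1' := congrArg (fun L : (Fin 11 → ℝ) →L[ℝ] ℝ => L (Y x)) d1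
  have d2' := congrArg (fun L : (Fin 11 → ℝ) →L[ℝ] ℝ => L (Y x)) d2
  have e := ((hY' 2).sub ((hc 4).mul (hY' 0))).sub ((hc 6).mul ((hY' 1).sub ((hc 3).mul (hY' 0))))
  have e' : dirDeriv X (fun y => ekrForm y (Y y)) x = _ :=
    congrArg (fun L : (Fin 11 → ℝ) →L[ℝ] ℝ => L (X x)) e.fderiv
  rw [e']
  simp only [ekrForm, VectorField.lieBracket, Pi.sub_apply, Pi.mul_apply, ContinuousLinearMap.comp_apply,
    add_apply, sub_apply, smul_apply, ContinuousLinearMap.proj_apply, smul_eq_mul] at d1' d2' ⊢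
  rw [d1', d2', x4, x6, x0]
  ring

end PseudoNormalForm

/-! ### The small growth vectors of the pseudo-normal forms -/

section SmallGrowth

variable {n : WithTop ℕ∞} {b c B C : ℝ}

/-- Derivation along a section costs one unit of order, and the two extra terms of the bracket
formula carry factors `x₃`, of weight `m`, and `c + y₄`, of order at least `m - 1`. So each bracket
beyond `V₅` costs at most one unit. -/
theorem hasWeightedOrder_ekrForm (hn : n = ∞ ∨ n = ω) {w : Fin 11 → ℕ} {m : ℕ} (hw5 : w 5 = m)
    (hw : ∀ X, IsSection n (ekr1211 b c B C) 0 X → ∀ i, HasWeightedOrder n w (w i - 1) fun x => X x i)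
    (hc : HasWeightedOrder n w (m - 1) fun x => c + x 8) {j : ℕ} {Y : (Fin 11 → ℝ) → (Fin 11 → ℝ)}
    (hY : Y ∈ smallFlag n (ekr1211 b c B C) 0 (4 + j)) :
    HasWeightedOrder n w (m - j) fun x => ekrForm x (Y x) := by
  have hn0 : n ≠ 0 := (lt_of_lt_of_le one_pos (natCast_le_of_infty_or_omega hn 1)).ne'
  have hcoord : ∀ k : Fin 11, ∀ᶠ x in 𝓝 (0 : Fin 11 → ℝ), ContDiffAt ℝ n (fun x => x k) x :=
    fun k => .of_forall fun x => (contDiff_apply ℝ ℝ k).contDiffAt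
  let M : ℕ → Submodule ℝ ((Fin 11 → ℝ) → (Fin 11 → ℝ)) := fun i =>
    { carrier := {Y | HasWeightedOrder n w (m + 4 - i) fun x => ekrForm x (Y x)}
      zero_mem' := .congr (.of_forall fun x => by simp [ekrForm]) (.zero _)
      add_mem' := fun {X Y} h1 h2 => .congr (.of_forall fun x => by
        simp only [ekrForm, Pi.add_apply]; ring) (.add h1 h2)
      smul_mem' := fun r X h => .congr (.of_forall fun x => by
        simp only [ekrForm, Pi.smul_apply, smul_eq_mul]; ring)
        (.mul_left (f := fun _ => r) (.of_forall fun x => contDiffAt_const) h) }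
  -- Up to `V₄` the form vanishes identically near 0, so any order may be claimed there, including
  -- the values `m + 4 - i` above `m`.
  have hlow : ∀ i ≤ 3, ∀ Y ∈ smallFlag n (ekr1211 b c B C) 0 i, ∀ s,
      HasWeightedOrder n w s fun x => ekrForm x (Y x) := fun i hi Y hY s => by
    refine .congr ?_ (.zero _)
    filter_upwards [(isSection_ekrFlag_of_mem_smallFlag hn hY).2] with x hx
    obtain ⟨h1, h2⟩ := (mem_ekrFlag.1 hx).1 (by omega)
    rw [ekrForm, h1, h2]
    ring
  have key := smallFlag_le_of_lieBracket_mem (M := M) (n := n) (D := ekr1211 b c B C) (p := 0)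
    (fun X hX => hlow 0 (by omega) X (Submodule.subset_span hX) _)
    (fun i X hX => HasWeightedOrder.mono (by omega) hX) (fun i X Y hX hY hYM => ?_) (4 + j) hY
  · exact .mono (by omega) key
  · rcases lt_or_ge i 3 with hi | hi
    · exact hlow (i + 1) (by omega) _ (lieBracket_mem_smallFlag hX hY) _
    · have hYs := smoothNear_of_mem_smallFlag hn hY
      have hXc := fun k => hX.1.mono fun x hx => contDiffAt_pi.1 hx k
      have hYc := fun k => hYs.mono fun x hx => contDiffAt_pi.1 hx k
      have o1 : HasWeightedOrder n w (m + 4 - (i + 1)) (dirDeriv X fun x => ekrForm x (Y x)) :=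
        .mono (by omega) (HasWeightedOrder.dirDeriv hn hX.1 (hw X hX) hYM)
      have o2 : HasWeightedOrder n w (m + 4 - (i + 1))
          fun x => (c + x 8) * (X x 3 * (Y x 1 - x 3 * Y x 0)) := by
        -- On entering `V₅` order `m` is required, one more than `c + y₄` offers. At that moment `Y`
        -- still satisfies `dx₁ = x₂ dt`, so the term is absent.
        rcases hi.eq_or_lt with rfl | hi
        · refine .congr ?_ (.zero _)
          filter_upwards [(isSection_ekrFlag_of_mem_smallFlag hn hY).2] with x hx
          rw [((mem_ekrFlag.1 hx).1 (by omega)).1]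
          ring
        · refine .mono (by omega) (hc.mul_right ?_)
          filter_upwards [hXc 3, hYc 1, hYc 0, hcoord 3] with x h1 h2 h3 h4
          exact h1.mul (h2.sub (h4.mul h3))
      have o3 : HasWeightedOrder n w (m + 4 - (i + 1))
          fun x => x 5 * (-(X x 3 * (Y x 4 - x 6 * Y x 3))) := by
        refine .mono (t := w 5) (by omega) ((HasWeightedOrder.coord 5).mul_right ?_)
        filter_upwards [hXc 3, hYc 4, hYc 3, hcoord 6] with x h1 h2 h3 h4
        exact (h1.mul (h2.sub (h4.mul h3))).neg
      refine .congr ?_ (.add o1 (.add o2 o3))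
      filter_upwards [hX.eventually, hYs] with x h1 h2
      rw [ekrForm_lieBracket (h1.1.self_of_nhds.differentiableAt hn0) (h2.differentiableAt hn0) h1.2]
      ring

/-- At 0 the form is `dy₁`, and positive order makes it vanish. The parameter `m` counts the members
`V₅, V₆, …` that miss `∂/∂y₁`: one in general, two if `b = c = 0`, three if all constants are 0. -/
theorem apply_two_eq_zero_of_mem_smallFlag (hn : n = ∞ ∨ n = ω) {m : ℕ} (hm : m ≤ 3)
    (h2 : 2 ≤ m → b = 0 ∧ c = 0) (h3 : 3 ≤ m → B = 0 ∧ C = 0) {j : ℕ} (hj : j < m)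
    {Y : (Fin 11 → ℝ) → (Fin 11 → ℝ)} (hY : Y ∈ smallFlag n (ekr1211 b c B C) 0 (4 + j)) :
    Y 0 2 = 0 := by
  -- The derivative of `x₃` along sections involves `b + x₄`, and those of `x₄, y₄` involve `B + x₅,
  -- C + y₅`. The weights `m, m - 1, m - 2` are thus admissible exactly as far as these constants
  -- vanish.
  let w : Fin 11 → ℕ := ![0, 0, 0, 0, 0, m, 0, m - 1, m - 1, m - 2, m - 2]
  have aff : ∀ (r : ℝ) (k : Fin 11) (s : ℕ), s ≤ w k → (1 ≤ s → r = 0) →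
      HasWeightedOrder n w s fun x => r + x k := fun r k s hs hr => by
    rcases Nat.eq_zero_or_pos s with rfl | h
    · exact .smooth (.of_forall fun x => contDiffAt_const.add (contDiff_apply ℝ ℝ k).contDiffAt)
    · simp only [hr h, zero_add]
      exact .mono hs (.coord k)
  have hc : HasWeightedOrder n w (m - 1) fun x => c + x 8 :=
    aff c 8 _ le_rfl fun h => (h2 (by omega)).2
  have key := hasWeightedOrder_ekrForm (b := b) (B := B) (C := C) (w := w) hn rfl
    (fun X hX => ?_) hc hY
  · simpa [ekrForm] using key.apply_zero (show 1 ≤ m - j by omega)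
  · have hXc := fun k => hX.1.mono fun x hx => contDiffAt_pi.1 hx k
    have smooth : ∀ i, w i - 1 = 0 → HasWeightedOrder n w (w i - 1) fun x => X x i :=
      fun i hi => by rw [hi]; exact .smooth (hXc i)
    have pf : ∀ (r : ℝ) (i k : Fin 11), w i - 1 ≤ w k → (1 ≤ w i - 1 → r = 0) →
        (∀ᶠ x in 𝓝 0, X x i = (r + x k) * X x 3) → HasWeightedOrder n w (w i - 1) fun x => X x i :=
      fun r i k h1 h2 h3 => .congr (h3.mono fun x hx => hx.symm) ((aff r k _ h1 h2).mul_right (hXc 3))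
    have e := hX.2.mono fun x hx => mem_ekr1211.1 hx
    intro i
    fin_cases i
    · exact smooth 0 rfl
    · exact smooth 1 rfl
    · exact smooth 2 rfl
    · exact smooth 3 rfl
    · exact smooth 4 rfl
    · exact pf b 5 7 le_rfl (fun h => (h2 (show 2 ≤ m by change 1 ≤ m - 1 at h; omega)).1)
        (e.mono fun x h => h.2.2.2.2.1)
    · exact smooth 6 rfl
    · exact pf B 7 9 (show m - 1 - 1 ≤ m - 2 by omega)
        (fun h => (h3 (show 3 ≤ m by change 1 ≤ m - 1 - 1 at h; omega)).1)
        (e.mono fun x h => h.2.2.2.2.2.2.1)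
    · exact pf C 8 10 (show m - 1 - 1 ≤ m - 2 by omega)
        (fun h => (h3 (show 3 ≤ m by change 1 ≤ m - 1 - 1 at h; omega)).2)
        (e.mono fun x h => h.2.2.2.2.2.2.2)
    · exact smooth 9 (show m - 2 - 1 = 0 by omega)
    · exact smooth 10 (show m - 2 - 1 = 0 by omega)

/-- With the fields `∂/∂x₅` and `∂/∂y₅`, this field spans the pseudo-normal form. -/
def ekrField (b c B C : ℝ) (x : Fin 11 → ℝ) : Fin 11 → ℝ :=
  ![x 5, x 5 * x 3, x 5 * x 4, 1, x 6, b + x 7, c + x 8, B + x 9, C + x 10, 0, 0]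

theorem contDiff_ekrField : ContDiff ℝ n (ekrField b c B C) := by
  refine contDiff_pi.2 fun i => ?_
  have := fun k : Fin 11 => contDiff_apply ℝ ℝ k (n := n)
  fin_cases i
  · exact this 5
  · exact (this 5).mul (this 3)
  · exact (this 5).mul (this 4)
  · exact contDiff_const
  · exact this 6
  · exact contDiff_const.add (this 7)
  · exact contDiff_const.add (this 8)
  · exact contDiff_const.add (this 9)
  · exact contDiff_const.add (this 10)
  · exact contDiff_const
  · exact contDiff_const

theorem fderiv_ekrField (x v : Fin 11 → ℝ) : fderiv ℝ (ekrField b c B C) x v =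
    ![v 5, x 5 * v 3 + x 3 * v 5, x 5 * v 4 + x 4 * v 5, 0, v 6, v 7, v 8, v 9, v 10, 0, 0] := by
  have h := fun i => hasFDerivAt_pi'.1
    (((contDiff_ekrField (n := 1)).differentiable one_ne_zero x).hasFDerivAt
      (f := ekrField b c B C)) i
  have hc := fun k : Fin 11 => hasFDerivAt_apply (𝕜 := ℝ) k x
  have key : ∀ (i : Fin 11) {L : (Fin 11 → ℝ) →L[ℝ] ℝ},
      HasFDerivAt (fun x => ekrField b c B C x i) L x →
      fderiv ℝ (ekrField b c B C) x v i = L v := fun i L hL =>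
    congrArg (fun L : (Fin 11 → ℝ) →L[ℝ] ℝ => L v) ((h i).unique hL)
  funext i
  fin_cases i
  · exact key 0 (hc 5)
  · exact key 1 ((hc 5).mul (hc 3))
  · exact key 2 ((hc 5).mul (hc 4))
  · exact key 3 (hasFDerivAt_const _ x)
  · exact key 4 (hc 6)
  · exact key 5 ((hc 7).const_add b)
  · exact key 6 ((hc 8).const_add c)
  · exact key 7 ((hc 9).const_add B)
  · exact key 8 ((hc 10).const_add C)
  · exact key 9 (hasFDerivAt_const _ x)
  · exact key 10 (hasFDerivAt_const _ x)

theorem isSection_ekrField (p : Fin 11 → ℝ) :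
    IsSection n (ekr1211 b c B C) p (ekrField b c B C) :=
  ⟨.of_forall fun x => contDiff_ekrField.contDiffAt, .of_forall fun x => by
    rw [mem_ekr1211]
    simp [ekrField]
    constructor <;> ring⟩

theorem isSection_single {k : Fin 11} (hk : 9 ≤ k) (p : Fin 11 → ℝ) :
    IsSection n (ekr1211 b c B C) p fun _ => Pi.single k 1 :=
  ⟨.of_forall fun x => contDiffAt_const, .of_forall fun x => by
    have h : ∀ i : Fin 11, i < 9 → (Pi.single k 1 : Fin 11 → ℝ) i = 0 := fun i hi =>
      Pi.single_eq_of_ne (by omega) _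
    rw [mem_ekr1211]
    simp [h]⟩

theorem lieBracket_ekrField_mem {i : ℕ} {Y : (Fin 11 → ℝ) → (Fin 11 → ℝ)}
    {Y' : (Fin 11 → ℝ) → (Fin 11 → ℝ) →L[ℝ] (Fin 11 → ℝ)} (hY' : ∀ x, HasFDerivAt Y (Y' x) x)
    (hY : Y ∈ smallFlag n (ekr1211 b c B C) 0 i) (W : (Fin 11 → ℝ) → (Fin 11 → ℝ))
    (hW : ∀ x, W x = Y' x (ekrField b c B C x) - ![Y x 5, x 5 * Y x 3 + x 3 * Y x 5,
      x 5 * Y x 4 + x 4 * Y x 5, 0, Y x 6, Y x 7, Y x 8, Y x 9, Y x 10, 0, 0]) :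
    W ∈ smallFlag n (ekr1211 b c B C) 0 (i + 1) := by
  have : W = VectorField.lieBracket ℝ (ekrField b c B C) Y := funext fun x => by
    rw [hW, VectorField.lieBracket, (hY' x).fderiv, fderiv_ekrField]
  rw [this]
  exact lieBracket_mem_smallFlag (isSection_ekrField 0) hY

/-- Up to sign, all fields but the last are iterated brackets with `Z = ekrField`. The chains
`∂/∂x₅, ∂/∂x₄, ∂/∂x₃, T, P` and `∂/∂y₅, ∂/∂y₄, ∂/∂y₃, ∂/∂y₂` continue with multiples of `∂/∂y₁`,
whose coefficients are then differentiated along `Z`. -/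
theorem exists_mem_smallFlag_ekr1211 :
    ∃ T P : (Fin 11 → ℝ) → (Fin 11 → ℝ), T 0 = Pi.single 0 1 ∧ P 0 = Pi.single 1 1 ∧
      (∀ k : Fin 11, 7 ≤ k → k < 9 → (fun _ => Pi.single k 1) ∈ smallFlag n (ekr1211 b c B C) 0 1) ∧
      (∀ k : Fin 11, 5 ≤ k → k < 7 → (fun _ => Pi.single k 1) ∈ smallFlag n (ekr1211 b c B C) 0 2) ∧
      T ∈ smallFlag n (ekr1211 b c B C) 0 3 ∧
      (fun _ => Pi.single 4 1) ∈ smallFlag n (ekr1211 b c B C) 0 3 ∧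
      P ∈ smallFlag n (ekr1211 b c B C) 0 4 ∧
      (fun x => (b + x 7) • Pi.single 2 1) ∈ smallFlag n (ekr1211 b c B C) 0 5 ∧
      (fun x => (c + x 8) • Pi.single 2 1) ∈ smallFlag n (ekr1211 b c B C) 0 5 ∧
      (fun x => (B + x 9) • Pi.single 2 1) ∈ smallFlag n (ekr1211 b c B C) 0 6 ∧
      (fun x => (C + x 10) • Pi.single 2 1) ∈ smallFlag n (ekr1211 b c B C) 0 6 ∧
      (fun _ => Pi.single 2 1) ∈ smallFlag n (ekr1211 b c B C) 0 7 := by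
  have hc := fun (k : Fin 11) (x : Fin 11 → ℝ) => hasFDerivAt_apply (𝕜 := ℝ) k x
  have neg : ∀ {i : ℕ} {Y : (Fin 11 → ℝ) → (Fin 11 → ℝ)},
      (fun x => -Y x) ∈ smallFlag n (ekr1211 b c B C) 0 i → Y ∈ smallFlag n (ekr1211 b c B C) 0 i :=
    fun {i Y} h => by
      have h' := (smallFlag n (ekr1211 b c B C) 0 i).neg_mem h
      rwa [show -(fun x => -Y x) = Y from funext fun x => neg_neg _] at h'
  have const : ∀ {i : ℕ} {u : Fin 11 → ℝ}, (fun _ => u) ∈ smallFlag n (ekr1211 b c B C) 0 i →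
      ∀ W : (Fin 11 → ℝ) → (Fin 11 → ℝ), (∀ x, -W x = -![u 5, x 5 * u 3 + x 3 * u 5,
        x 5 * u 4 + x 4 * u 5, 0, u 6, u 7, u 8, u 9, u 10, 0, 0]) →
      W ∈ smallFlag n (ekr1211 b c B C) 0 (i + 1) := fun {i u} hu W hW =>
    neg (lieBracket_ekrField_mem (fun x => hasFDerivAt_const u x) hu _ fun x => by
      rw [hW]; simp)
  have aff : ∀ {i : ℕ} (r s : ℝ) (k l : Fin 11), (∀ x, ekrField b c B C x k = s + x l) →
      (fun x => (r + x k) • Pi.single 2 1) ∈ smallFlag n (ekr1211 b c B C) 0 i →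
      (fun x => (s + x l) • Pi.single 2 1) ∈ smallFlag n (ekr1211 b c B C) 0 (i + 1) :=
    fun r s k l hk hY => lieBracket_ekrField_mem
      (fun x => ((hc k x).const_add r).smul_const (Pi.single 2 1 : Fin 11 → ℝ)) hY _ fun x => by
        rw [← hk]
        funext i
        fin_cases i <;> simp
  have m9 : ∀ k : Fin 11, 9 ≤ k → (fun _ => Pi.single k 1) ∈ smallFlag n (ekr1211 b c B C) 0 0 :=
    fun k hk => Submodule.subset_span (isSection_single hk 0)
  have m7 := const (m9 9 le_rfl) (fun _ => Pi.single 7 1) fun x => by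
    congr 1; funext i; fin_cases i <;> simp
  have m8 := const (m9 10 (by decide)) (fun _ => Pi.single 8 1) fun x => by
    congr 1; funext i; fin_cases i <;> simp
  have m5 := const m7 (fun _ => Pi.single 5 1) fun x => by
    congr 1; funext i; fin_cases i <;> simp
  have m6 := const m8 (fun _ => Pi.single 6 1) fun x => by
    congr 1; funext i; fin_cases i <;> simp
  have m4 := const m6 (fun _ => Pi.single 4 1) fun x => by
    congr 1; funext i; fin_cases i <;> simp
  have mT := const m5 (fun x => Pi.single 0 1 + x 3 • Pi.single 1 1 + x 4 • Pi.single 2 1)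
    fun x => by congr 1; funext i; fin_cases i <;> simp
  -- The second chain continues with `x₃ ∂/∂y₁`: it vanishes at 0, and its derivatives along `Z`
  -- bring in `b + x₄` and then `B + x₅`.
  have mQ := const m4 (fun x => (0 + x 5) • Pi.single 2 1) fun x => by
    congr 1; funext i; fin_cases i <;> simp
  have mP := lieBracket_ekrField_mem (fun x => ((hasFDerivAt_const (Pi.single 0 1 : Fin 11 → ℝ) x).add
    ((hc 3 x).smul_const (Pi.single 1 1 : Fin 11 → ℝ))).add
    ((hc 4 x).smul_const (Pi.single 2 1 : Fin 11 → ℝ))) mT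
    (fun x => Pi.single 1 1 + x 6 • Pi.single 2 1) fun x => by
      funext i; fin_cases i <;> simp [ekrField]
  have mc := lieBracket_ekrField_mem (fun x => (hasFDerivAt_const (Pi.single 1 1 : Fin 11 → ℝ) x).add
    ((hc 6 x).smul_const (Pi.single 2 1 : Fin 11 → ℝ))) mP
    (fun x => (c + x 8) • Pi.single 2 1) fun x => by
      funext i; fin_cases i <;> simp [ekrField]
  have mb := aff 0 b 5 7 (fun x => by simp [ekrField]) mQ
  have mB := aff b B 7 9 (fun x => by simp [ekrField]) mb
  have mC := aff c C 8 10 (fun x => by simp [ekrField]) mc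
  -- A bracket with `∂/∂x₅` itself removes the coefficient `B + x₅`, whatever `B` is.
  have mE : (fun _ => Pi.single 2 1) ∈ smallFlag n (ekr1211 b c B C) 0 7 := by
    have h := lieBracket_mem_smallFlag (isSection_single (n := n) (b := b) (c := c) (B := B) (C := C)
      (le_refl 9) 0) mB
    have e : VectorField.lieBracket ℝ (fun _ => Pi.single 9 1)
        (fun x : Fin 11 → ℝ => (B + x 9) • (Pi.single 2 1 : Fin 11 → ℝ)) =
        fun _ => Pi.single 2 1 := funext fun x => by
      rw [VectorField.lieBracket, (((hc 9 x).const_add B).smul_const _).fderiv]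
      simp
    rwa [e] at h
  refine ⟨_, _, ?_, ?_, fun k h1 h2 => ?_, fun k h1 h2 => ?_, mT, m4, mP, mb, mc, mB, mC, mE⟩
  · simp
  · simp
  · obtain rfl | rfl : k = 7 ∨ k = 8 := by omega
    exacts [m7, m8]
  · obtain rfl | rfl : k = 5 ∨ k = 6 := by omega
    exacts [m5, m6]

/-- Coordinates adapted to the values at 0 of the members of the small flag. -/
noncomputable def ekrBasis (b c B C : ℝ) : Module.Basis (Fin 11) ℝ (Fin 11 → ℝ) :=
  .ofEquivFun
    { toFun := fun v => ![v 3, v 9, v 10, v 7 - B * v 3, v 8 - C * v 3, v 5 - b * v 3, v 6 - c * v 3,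
        v 0, v 4, v 1, v 2]
      invFun := fun a => ![a 7, a 9, a 10, a 0, a 8, a 5 + b * a 0, a 6 + c * a 0, a 3 + B * a 0,
        a 4 + C * a 0, a 1, a 2]
      map_add' := fun u v => by
        funext i; fin_cases i <;> simp <;> ring
      map_smul' := fun r v => by
        funext i; fin_cases i <;> simp <;> ring
      left_inv := fun v => by
        funext i; fin_cases i <;> simp
      right_inv := fun v => by
        funext i; fin_cases i <;> simp }

theorem ekrBasis_repr (v : Fin 11 → ℝ) : ⇑((ekrBasis b c B C).repr v) =
    ![v 3, v 9, v 10, v 7 - B * v 3, v 8 - C * v 3, v 5 - b * v 3, v 6 - c * v 3,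
        v 0, v 4, v 1, v 2] := rfl

theorem ekrBasis_apply (j : Fin 11) : ekrBasis b c B C j = (fun a : Fin 11 → ℝ =>
    ![a 7, a 9, a 10, a 0, a 8, a 5 + b * a 0, a 6 + c * a 0, a 3 + B * a 0, a 4 + C * a 0, a 1, a 2])
      (Pi.single j 1) := by
  rw [ekrBasis, Module.Basis.coe_ofEquivFun]
  rfl

/-- The last entry 7 is the worst case, valid for all constants; nonzero constants let `∂/∂y₁`
appear earlier. -/
theorem ekrBasis_mem_smallFlagAt (j : Fin 11) : ekrBasis b c B C j ∈
    smallFlagAt n (ekr1211 b c B C) 0 ((![0, 0, 0, 1, 1, 2, 2, 3, 3, 4, 7] : Fin 11 → ℕ) j) := by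
  obtain ⟨T, P, hT, hP, h1, h2, h3, h4, h5, -, -, -, -, h6⟩ :=
    exists_mem_smallFlag_ekr1211 (n := n) (b := b) (c := c) (B := B) (C := C)
  have key : ∀ {i : ℕ} {Y : (Fin 11 → ℝ) → (Fin 11 → ℝ)} (j : Fin 11),
      Y ∈ smallFlag n (ekr1211 b c B C) 0 i → ekrBasis b c B C j = Y 0 →
      ekrBasis b c B C j ∈ smallFlagAt n (ekr1211 b c B C) 0 i :=
    fun j hY h => ⟨_, hY, h.symm⟩
  have m9 : ∀ k : Fin 11, 9 ≤ k → (fun _ => Pi.single k 1) ∈ smallFlag n (ekr1211 b c B C) 0 0 :=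
    fun k hk => Submodule.subset_span (isSection_single hk 0)
  fin_cases j
  · refine key 0 (Submodule.subset_span (isSection_ekrField 0)) ?_
    rw [ekrBasis_apply]
    funext i; fin_cases i <;> simp [ekrField]
  · exact key 1 (m9 9 (by decide)) (by rw [ekrBasis_apply]; funext i; fin_cases i <;> simp)
  · exact key 2 (m9 10 (by decide)) (by rw [ekrBasis_apply]; funext i; fin_cases i <;> simp)
  · exact key 3 (h1 7 (by decide) (by decide))
      (by rw [ekrBasis_apply]; funext i; fin_cases i <;> simp)
  · exact key 4 (h1 8 (by decide) (by decide))
      (by rw [ekrBasis_apply]; funext i; fin_cases i <;> simp)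
  · exact key 5 (h2 5 (by decide) (by decide))
      (by rw [ekrBasis_apply]; funext i; fin_cases i <;> simp)
  · exact key 6 (h2 6 (by decide) (by decide))
      (by rw [ekrBasis_apply]; funext i; fin_cases i <;> simp)
  · exact key 7 h3 (by rw [hT, ekrBasis_apply]; funext i; fin_cases i <;> simp)
  · exact key 8 h4 (by rw [ekrBasis_apply]; funext i; fin_cases i <;> simp)
  · exact key 9 h5 (by rw [hP, ekrBasis_apply]; funext i; fin_cases i <;> simp)
  · exact key 10 h6 (by rw [ekrBasis_apply]; funext i; fin_cases i <;> simp)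

theorem ekrBasis_ten : ekrBasis b c B C 10 = Pi.single 2 1 := by
  rw [ekrBasis_apply]; funext i; fin_cases i <;> simp

theorem smallGrowth_ekr1211_of_lt (hn : n = ∞ ∨ n = ω) {i : ℕ} (hi : i < 4) :
    smallGrowth n (ekr1211 b c B C) 0 i = 3 + 2 * i := by
  refine finrank_eq_of_basis (ekrBasis b c B C) _ (by omega) (fun j hj => ?_) ?_
  · refine smallFlagAt_mono ?_ (ekrBasis_mem_smallFlagAt j)
    interval_cases i <;> revert j <;> decide
  · rintro _ ⟨Y, hY, rfl⟩ j hj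
    obtain ⟨h1, h2, h3, h4⟩ :=
      mem_ekrFlag.1 (isSection_ekrFlag_of_mem_smallFlag hn hY).2.self_of_nhds
    rw [ekrBasis_repr]
    simp only [Pi.zero_apply, zero_mul, add_zero] at h1 h2 h3 h4
    fin_cases j
    · exact absurd hj (by change ¬ 3 + 2 * i ≤ 0; omega)
    · exact absurd hj (by change ¬ 3 + 2 * i ≤ 1; omega)
    · exact absurd hj (by change ¬ 3 + 2 * i ≤ 2; omega)
    · exact sub_eq_zero.2 (h4 (by change 3 + 2 * i ≤ 3 at hj; omega)).1
    · exact sub_eq_zero.2 (h4 (by change 3 + 2 * i ≤ 4 at hj; omega)).2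
    · exact sub_eq_zero.2 (h3 (by change 3 + 2 * i ≤ 5 at hj; omega)).1
    · exact sub_eq_zero.2 (h3 (by change 3 + 2 * i ≤ 6 at hj; omega)).2
    · exact (h2 (by change 3 + 2 * i ≤ 7 at hj; omega)).1
    · exact (h2 (by change 3 + 2 * i ≤ 8 at hj; omega)).2
    · exact (h1 hi).1
    · exact (h1 hi).2

theorem smallGrowth_ekr1211_eq_ten (hn : n = ∞ ∨ n = ω) {m : ℕ} (hm : m ≤ 3)
    (h2 : 2 ≤ m → b = 0 ∧ c = 0) (h3 : 3 ≤ m → B = 0 ∧ C = 0) {i : ℕ} (hi : 4 ≤ i) (him : i < 4 + m) :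
    smallGrowth n (ekr1211 b c B C) 0 i = 10 := by
  refine finrank_eq_of_basis (ekrBasis b c B C) _ (by omega) (fun j hj => ?_) ?_
  · refine smallFlagAt_mono (le_trans ?_ hi) (ekrBasis_mem_smallFlagAt j)
    revert j
    decide
  · rintro _ ⟨Y, hY, rfl⟩ j hj
    obtain ⟨k, rfl⟩ := Nat.exists_eq_add_of_le hi
    obtain rfl : j = 10 := by omega
    exact apply_two_eq_zero_of_mem_smallFlag hn hm h2 h3 (by omega) hY

theorem smallGrowth_ekr1211_eq_eleven {i : ℕ} (hi : 4 ≤ i)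
    (h : Pi.single 2 1 ∈ smallFlagAt n (ekr1211 b c B C) 0 i) :
    smallGrowth n (ekr1211 b c B C) 0 i = 11 := by
  refine finrank_eq_of_basis (ekrBasis b c B C) _ le_rfl (fun j hj => ?_) fun _ _ j hj => by omega
  rcases eq_or_ne j 10 with rfl | hj'
  · rw [ekrBasis_ten]
    exact h
  · refine smallFlagAt_mono (le_trans ?_ hi) (ekrBasis_mem_smallFlagAt j)
    revert j
    decide

theorem smallGrowth_ekr1211_of_ne (hn : n = ∞ ∨ n = ω) (h : b ≠ 0 ∨ c ≠ 0) :
    (List.range 6).map (smallGrowth n (ekr1211 b c B C) 0) = [3, 5, 7, 9, 10, 11] := by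
  obtain ⟨-, -, -, -, -, -, -, -, -, hb, hc, -⟩ :=
    exists_mem_smallFlag_ekr1211 (n := n) (b := b) (c := c) (B := B) (C := C)
  have h5 : Pi.single 2 1 ∈ smallFlagAt n (ekr1211 b c B C) 0 5 := by
    rcases h with h | h
    · exact ⟨b⁻¹ • _, Submodule.smul_mem _ _ hb, by simp [h]⟩
    · exact ⟨c⁻¹ • _, Submodule.smul_mem _ _ hc, by simp [h]⟩
  simp [List.range_succ, smallGrowth_ekr1211_of_lt hn, smallGrowth_ekr1211_eq_eleven _ h5,
    smallGrowth_ekr1211_eq_ten (m := 1) hn]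

theorem smallGrowth_ekr1211_zero_of_ne (hn : n = ∞ ∨ n = ω) (h : B ≠ 0 ∨ C ≠ 0) :
    (List.range 7).map (smallGrowth n (ekr1211 0 0 B C) 0) = [3, 5, 7, 9, 10, 10, 11] := by
  obtain ⟨-, -, -, -, -, -, -, -, -, -, -, hb, hc, -⟩ :=
    exists_mem_smallFlag_ekr1211 (n := n) (b := 0) (c := 0) (B := B) (C := C)
  have h5 : Pi.single 2 1 ∈ smallFlagAt n (ekr1211 0 0 B C) 0 6 := by
    rcases h with h | h
    · exact ⟨B⁻¹ • _, Submodule.smul_mem _ _ hb, by simp [h]⟩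
    · exact ⟨C⁻¹ • _, Submodule.smul_mem _ _ hc, by simp [h]⟩
  simp [List.range_succ, smallGrowth_ekr1211_of_lt hn, smallGrowth_ekr1211_eq_eleven _ h5,
    smallGrowth_ekr1211_eq_ten (m := 2) hn]

theorem smallGrowth_ekr1211_zero (hn : n = ∞ ∨ n = ω) (i : ℕ) :
    smallGrowth n (ekr1211 0 0 0 0) 0 i = (if i < 4 then 3 + 2 * i else if i < 7 then 10 else 11) := by
  split_ifs with h1 h2
  · exact smallGrowth_ekr1211_of_lt hn h1
  · exact smallGrowth_ekr1211_eq_ten (m := 3) hn le_rfl (by simp) (by simp) (by omega) h2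
  · refine smallGrowth_ekr1211_eq_eleven (by omega) (smallFlagAt_mono (not_lt.1 h2) ?_)
    rw [← ekrBasis_ten (b := 0) (c := 0) (B := 0) (C := 0)]
    exact ekrBasis_mem_smallFlagAt 10

end SmallGrowth

/-! ### Strong nilpotency of the last pseudo-normal form -/

section StronglyNilpotent

variable {n : WithTop ℕ∞} {N : ℕ} {b c B C : ℝ}

theorem homogPart_of_homogeneous {w : Fin N → ℕ} {d : ℕ} {f : (Fin N → ℝ) → ℝ} {y : Fin N → ℝ}
    (h : ∀ ε : ℝ, f (fun i => ε ^ w i * y i) = ε ^ d * f y) : homogPart w d f y = f y := by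
  rw [homogPart, funext fun ε => (h ε).trans (mul_comm _ _), iteratedDeriv_const_mul_field,
    iteratedDeriv_fun_pow_zero, if_pos rfl]
  field_simp

theorem dirDeriv_apply_of_hasFDerivAt {X : (Fin N → ℝ) → (Fin N → ℝ)} {f : (Fin N → ℝ) → ℝ}
    {L : (Fin N → ℝ) →L[ℝ] ℝ} {x : Fin N → ℝ} (h : HasFDerivAt f L x) :
    dirDeriv X f x = L (X x) := by
  rw [dirDeriv, h.fderiv]

theorem dirDeriv_coord (X : (Fin N → ℝ) → (Fin N → ℝ)) (i : Fin N) :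
    dirDeriv X (fun x => x i) = fun x => X x i :=
  funext fun x => dirDeriv_apply_of_hasFDerivAt (hasFDerivAt_apply (𝕜 := ℝ) i x)

theorem dirDeriv_add (X : (Fin N → ℝ) → (Fin N → ℝ)) {f g : (Fin N → ℝ) → ℝ}
    (hf : Differentiable ℝ f) (hg : Differentiable ℝ g) :
    dirDeriv X (fun x => f x + g x) = fun x => dirDeriv X f x + dirDeriv X g x :=
  funext fun x => dirDeriv_apply_of_hasFDerivAt ((hf x).hasFDerivAt.add (hg x).hasFDerivAt)

theorem dirDeriv_mul (X : (Fin N → ℝ) → (Fin N → ℝ)) {f g : (Fin N → ℝ) → ℝ}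
    (hf : Differentiable ℝ f) (hg : Differentiable ℝ g) :
    dirDeriv X (fun x => f x * g x) = fun x => f x * dirDeriv X g x + g x * dirDeriv X f x :=
  funext fun x => dirDeriv_apply_of_hasFDerivAt ((hf x).hasFDerivAt.mul (hg x).hasFDerivAt)

/-- The frame `ekrField, ∂/∂x₅, ∂/∂y₅` of the pseudo-normal form. -/
def ekrFrame (b c B C : ℝ) (i : Fin 3) : (Fin 11 → ℝ) → (Fin 11 → ℝ) :=
  ![ekrField b c B C, fun _ => Pi.single 9 1, fun _ => Pi.single 10 1] i

theorem isSection_ekrFrame (i : Fin 3) (p : Fin 11 → ℝ) :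
    IsSection n (ekr1211 b c B C) p (ekrFrame b c B C i) := by
  fin_cases i
  · exact isSection_ekrField p
  · exact isSection_single (by decide) p
  · exact isSection_single (by decide) p

theorem ekr1211_eq_span (x : Fin 11 → ℝ) :
    ekr1211 b c B C x = Submodule.span ℝ (Set.range fun i => ekrFrame b c B C i x) := by
  refine le_antisymm (fun v hv => ?_) (Submodule.span_le.2 ?_)
  · have : v = ∑ i, ![v 3, v 9, v 10] i • ekrFrame b c B C i x := by
      obtain ⟨h1, h2, h0, h4, h5, h6, h7, h8⟩ := mem_ekr1211.1 hv
      rw [Fin.sum_univ_three]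
      funext i
      change v i = v 3 * ekrField b c B C x i + v 9 * (Pi.single 9 1 : Fin 11 → ℝ) i +
        v 10 * (Pi.single 10 1 : Fin 11 → ℝ) i
      fin_cases i <;> simp [ekrField, *] <;> ring
    rw [this]
    exact Submodule.sum_mem _ fun i _ => Submodule.smul_mem _ _ (Submodule.subset_span ⟨i, rfl⟩)
  · rintro _ ⟨i, rfl⟩
    exact (isSection_ekrFrame (n := ∞) i x).2.self_of_nhds

theorem isFrame_ekrFrame (p : Fin 11 → ℝ) :
    IsFrame n (ekr1211 b c B C) p (ekrFrame b c B C) := by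
  refine ⟨fun i => (isSection_ekrFrame i p).1, .of_forall fun x => ⟨?_, ekr1211_eq_span x⟩⟩
  rw [Fintype.linearIndependent_iff]
  intro g hg
  rw [Fin.sum_univ_three] at hg
  have h : ∀ i : Fin 11, g 0 * ekrField b c B C x i + g 1 * (Pi.single 9 1 : Fin 11 → ℝ) i +
    g 2 * (Pi.single 10 1 : Fin 11 → ℝ) i = 0 := fun i => congrFun hg i
  intro i
  fin_cases i
  · simpa [ekrField] using h 3
  · simpa [ekrField] using h 9
  · simpa [ekrField] using h 10

/-- The linear coordinates dual to `ekrBasis 0 0 0 0`: a permutation of the standard ones. -/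
noncomputable def ekrCoords : (Fin 11 → ℝ) ≃L[ℝ] (Fin 11 → ℝ) :=
  (ekrBasis 0 0 0 0).equivFun.toContinuousLinearEquiv

theorem ekrCoords_apply (v : Fin 11 → ℝ) :
    ekrCoords v = ![v 3, v 9, v 10, v 7, v 8, v 5, v 6, v 0, v 4, v 1, v 2] := by
  have : ekrCoords v = ⇑((ekrBasis 0 0 0 0).repr v) := rfl
  rw [this, ekrBasis_repr]
  simp

theorem ekrCoords_symm_apply (a : Fin 11 → ℝ) :
    ekrCoords.symm a = ![a 7, a 9, a 10, a 0, a 8, a 5, a 6, a 3, a 4, a 1, a 2] := by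
  rw [ContinuousLinearEquiv.symm_apply_eq, ekrCoords_apply]
  funext i
  fin_cases i <;> rfl

theorem isWeights_ekr1211_zero (hn : n = ∞ ∨ n = ω) :
    IsWeights n (ekr1211 0 0 0 0) 0 ![1, 1, 1, 2, 2, 3, 3, 4, 4, 5, 8] := by
  intro i
  simp only [smallGrowth_ekr1211_zero hn]
  fin_cases i <;> refine ⟨by simp, fun s => ?_⟩ <;> simp <;> split_ifs <;> omega

/-- The weights, listed in the order `t, x₁, y₁, …, x₅, y₅`, are forced by the equations: for
instance `dx₃ = x₄ dx₂` asks 3 = 2 + 1, and `dy₁ = y₂ x₃ dx₂` asks 8 = 4 + 3 + 1. -/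
theorem hasWeightedOrder_of_isSection_ekr1211_zero {X : (Fin 11 → ℝ) → (Fin 11 → ℝ)}
    (hX : IsSection n (ekr1211 0 0 0 0) 0 X) (i : Fin 11) :
    HasWeightedOrder n ![4, 5, 8, 1, 4, 3, 3, 2, 2, 1, 1]
      ((![4, 5, 8, 1, 4, 3, 3, 2, 2, 1, 1] : Fin 11 → ℕ) i - 1) fun x => X x i := by
  set w : Fin 11 → ℕ := ![4, 5, 8, 1, 4, 3, 3, 2, 2, 1, 1]
  have hXc := fun k => hX.1.mono fun x hx => contDiffAt_pi.1 hx k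
  have e := hX.2.mono fun x hx => mem_ekr1211.1 hx
  have pf : ∀ i k : Fin 11, w i - 1 ≤ w k →
      (∀ᶠ x in 𝓝 0, X x i = x k * X x 3) → HasWeightedOrder n w (w i - 1) fun x => X x i :=
    fun i k h1 h3 => .congr (h3.mono fun x hx => hx.symm)
      (.mono h1 ((HasWeightedOrder.coord k).mul_right (hXc 3)))
  have h0 := pf 0 5 (by decide) (e.mono fun x h => h.2.2.1)
  fin_cases i
  · exact h0
  · exact .congr (e.mono fun x h => h.1.symm) (.mono (by decide) (.mul (.coord 3) h0))
  · exact .congr (e.mono fun x h => h.2.1.symm) (.mono (by decide) (.mul (.coord 4) h0))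
  · exact .smooth (hXc 3)
  · exact pf 4 6 (by decide) (e.mono fun x h => h.2.2.2.1)
  · exact pf 5 7 (by decide) (e.mono fun x h => by simpa using h.2.2.2.2.1)
  · exact pf 6 8 (by decide) (e.mono fun x h => by simpa using h.2.2.2.2.2.1)
  · exact pf 7 9 (by decide) (e.mono fun x h => by simpa using h.2.2.2.2.2.2.1)
  · exact pf 8 10 (by decide) (e.mono fun x h => by simpa using h.2.2.2.2.2.2.2)
  · exact .smooth (hXc 9)
  · exact .smooth (hXc 10)

/-- The words apply `Z = ekrField` first and finish with `∂/∂x₅` or `∂/∂y₅`, except for `x₂` itself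
and for `x₅, y₅`, which need no `Z`. -/
theorem exists_foldr_dirDeriv_ne_zero (k : Fin 11) :
    ∃ l : List (Fin 3), l.length = (![4, 5, 8, 1, 4, 3, 3, 2, 2, 1, 1] : Fin 11 → ℕ) k ∧
      (l.map (ekrFrame 0 0 0 0)).foldr dirDeriv (fun x => x k) 0 ≠ 0 := by
  have hd : ∀ k : Fin 11, Differentiable ℝ fun x : Fin 11 → ℝ => x k := fun k => by fun_prop
  let Z := ekrField 0 0 0 0
  have s : ∀ k l : Fin 11, (∀ x, Z x k = x l) → dirDeriv Z (fun x => x k) = fun x => x l :=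
    fun k l h => (dirDeriv_coord Z k).trans (funext h)
  have s0 := s 0 5 fun x => rfl
  have s4 := s 4 6 fun x => rfl
  have s5 := s 5 7 fun x => zero_add _
  have s6 := s 6 8 fun x => zero_add _
  have s7 := s 7 9 fun x => zero_add _
  have s8 := s 8 10 fun x => zero_add _
  have s3 : dirDeriv Z (fun x => x 3) = fun x => 1 := dirDeriv_coord Z 3
  have s9 : dirDeriv Z (fun x => x 9) = fun x => 0 := dirDeriv_coord Z 9
  have s10 : dirDeriv Z (fun x => x 10) = fun x => 0 := dirDeriv_coord Z 10
  have t1 : dirDeriv Z (fun x => x 1) = fun x => x 5 * x 3 := dirDeriv_coord Z 1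
  have t2 : dirDeriv Z (fun x => x 2) = fun x => x 5 * x 4 := dirDeriv_coord Z 2
  have e9 := dirDeriv_coord (fun _ : Fin 11 → ℝ => (Pi.single 9 1 : Fin 11 → ℝ))
  have e10 := dirDeriv_coord (fun _ : Fin 11 → ℝ => (Pi.single 10 1 : Fin 11 → ℝ))
  have f0 : ekrFrame 0 0 0 0 0 = Z := rfl
  have f1 : ekrFrame 0 0 0 0 1 = fun _ => Pi.single 9 1 := rfl
  have f2 : ekrFrame 0 0 0 0 2 = fun _ => Pi.single 10 1 := rfl
  have h9 : (Pi.single 9 1 : Fin 11 → ℝ) 10 = 0 := Pi.single_eq_of_ne (by decide) _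
  fin_cases k
  · exact ⟨[1, 0, 0, 0], rfl, by simp [f0, f1, s0, s5, s7, e9]⟩
  · refine ⟨[1, 0, 0, 0, 0], rfl, ?_⟩
    simp (disch := fun_prop) [f0, f1, t1, s3, s5, s7, s9, e9, dirDeriv_mul, dirDeriv_add]
    norm_num
  -- Here `Z⁶ y₁ = Z⁵ (x₃ y₂)`; as `Z³ x₃ = 0` and `Z⁴ y₂ = 0`, only `10 (Z² x₃) (Z³ y₂) = 10 x₅ y₅`
  -- survives.
  · refine ⟨[2, 1, 0, 0, 0, 0, 0, 0], rfl, ?_⟩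
    simp (disch := fun_prop) [f0, f1, f2, t2, s4, s5, s6, s7, s8, s9, s10, e9, e10, dirDeriv_mul,
      dirDeriv_add, h9]
    norm_num
  · exact ⟨[0], rfl, by simp [f0, s3]⟩
  · exact ⟨[2, 0, 0, 0], rfl, by simp [f0, f2, s4, s6, s8, e10]⟩
  · exact ⟨[1, 0, 0], rfl, by simp [f0, f1, s5, s7, e9]⟩
  · exact ⟨[2, 0, 0], rfl, by simp [f0, f2, s6, s8, e10]⟩
  · exact ⟨[1, 0], rfl, by simp [f0, f1, s7, e9]⟩
  · exact ⟨[2, 0], rfl, by simp [f0, f2, s8, e10]⟩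
  · exact ⟨[1], rfl, by simp [f1, e9]⟩
  · exact ⟨[2], rfl, by simp [f2, e10]⟩

theorem hasNonholonomicOrder_ekr1211_zero (hn : n = ∞ ∨ n = ω) (k : Fin 11) :
    HasNonholonomicOrder n (ekr1211 0 0 0 0) 0 (fun x => x k)
      ((![4, 5, 8, 1, 4, 3, 3, 2, 2, 1, 1] : Fin 11 → ℕ) k) := by
  refine ⟨fun l hl hlk => ?_, ?_⟩
  · exact (HasWeightedOrder.foldr_dirDeriv hn
      (fun X hX => hasWeightedOrder_of_isSection_ekr1211_zero hX) (.coord k) l hl).apply_zero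
      (by omega)
  · obtain ⟨l, hl, h⟩ := exists_foldr_dirDeriv_ne_zero k
    refine ⟨_, fun X hX => ?_, by simpa using hl, h⟩
    obtain ⟨i, -, rfl⟩ := List.mem_map.1 hX
    exact isSection_ekrFrame i 0

/-- In the coordinates sorted by weight the frame is already homogeneous of weight -1, so passing to
the nilpotent part changes nothing and the sorting permutation is the required equivalence. -/
theorem stronglyNilpotent_ekr1211_zero (hn : n = ∞ ∨ n = ω) :
    StronglyNilpotent n (ekr1211 0 0 0 0) 0 := by
  let z := ekrCoords.toHomeomorph.toOpenPartialHomeomorph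
  have hz : ContDiffOn ℝ n z z.source := ekrCoords.contDiff.contDiffOn
  have hz' : ContDiffOn ℝ n z.symm z.target := ekrCoords.symm.contDiff.contDiffOn
  have hfd : ∀ x, fderiv ℝ z x = (ekrCoords : (Fin 11 → ℝ) →L[ℝ] (Fin 11 → ℝ)) :=
    fun x => ekrCoords.fderiv
  have hX : ∀ i y, inCoords z (ekrFrame 0 0 0 0 i) y =
      ekrCoords (ekrFrame 0 0 0 0 i (ekrCoords.symm y)) := fun i y => by
    rw [inCoords, hfd]
    rfl
  let w : Fin 11 → ℕ := ![1, 1, 1, 2, 2, 3, 3, 4, 4, 5, 8]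
  have hnil : ∀ i, nilpotentPart w (inCoords z (ekrFrame 0 0 0 0 i)) =
      fun y => ekrCoords (ekrFrame 0 0 0 0 i (ekrCoords.symm y)) := fun i => by
    funext y j
    rw [nilpotentPart, homogPart_of_homogeneous, hX]
    intro ε
    simp only [hX, ekrCoords_apply, ekrCoords_symm_apply]
    fin_cases i <;> fin_cases j <;> simp [ekrFrame, ekrField, w] <;> ring
  refine ⟨_, ⟨3, ekrFrame 0 0 0 0, w, z, isFrame_ekrFrame 0,
    ⟨isWeights_ekr1211_zero hn, Set.mem_univ _, map_zero ekrCoords, hz, hz', fun j => ?_⟩,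
    fun y => rfl⟩, z, Set.mem_univ _, map_zero ekrCoords, hz, hz', fun x _ => ?_⟩
  · have hk : ∃ k : Fin 11, (fun x => z x j) = (fun x => x k) ∧
        w j = (![4, 5, 8, 1, 4, 3, 3, 2, 2, 1, 1] : Fin 11 → ℕ) k := by
      refine ⟨(![3, 9, 10, 7, 8, 5, 6, 0, 4, 1, 2] : Fin 11 → Fin 11) j, funext fun x => ?_, ?_⟩
      · change ekrCoords x j = _
        rw [ekrCoords_apply]
        fin_cases j <;> rfl
      · revert j
        decide
    obtain ⟨k, h1, h2⟩ := hk
    rw [h1, h2]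
    exact hasNonholonomicOrder_ekr1211_zero hn k
  · have e : ∀ i, nilpotentPart w (inCoords z (ekrFrame 0 0 0 0 i)) (z x) =
        ekrCoords (ekrFrame 0 0 0 0 i x) := fun i =>
      (congrFun (hnil i) (z x)).trans
        (congrArg (fun u => ekrCoords (ekrFrame 0 0 0 0 i u)) (ekrCoords.symm_apply_apply x))
    rw [hfd, ekr1211_eq_span, Submodule.map_span, ← Set.range_comp]
    exact congrArg (fun f => Submodule.span ℝ (Set.range f)) (funext e)

end StronglyNilpotent

/-! ### Nilpotent approximations are homogeneous -/

section Homogeneous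

variable {n : WithTop ℕ∞} {N : ℕ}

/-- No smoothness is required, since the rule for `deriv` under a rescaling of the variable needs
none. Consequently `homogPart` is homogeneous for every function. -/
theorem iteratedDeriv_comp_mul_left (g : ℝ → ℝ) (r : ℝ) (d : ℕ) :
    iteratedDeriv d (fun ε => g (r * ε)) = fun ε => r ^ d * iteratedDeriv d g (r * ε) := by
  induction d with
  | zero => simp
  | succ d ih =>
    funext ε
    rw [iteratedDeriv_succ, ih, deriv_const_mul_field, deriv_comp_mul_left r (iteratedDeriv d g) ε,
      iteratedDeriv_succ, smul_eq_mul, pow_succ]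
    ring

theorem homogPart_dilation (w : Fin N → ℕ) (d : ℕ) (f : (Fin N → ℝ) → ℝ) (r : ℝ) (y : Fin N → ℝ) :
    homogPart w d f (fun i => r ^ w i * y i) = r ^ d * homogPart w d f y := by
  have : (fun ε : ℝ => f fun i => ε ^ w i * (r ^ w i * y i)) =
      fun ε => (fun ε : ℝ => f fun i => ε ^ w i * y i) (r * ε) := by
    funext ε
    beta_reduce
    congr 1
    funext i
    rw [mul_pow]
    ring
  rw [homogPart, homogPart, this,
    iteratedDeriv_comp_mul_left (fun ε : ℝ => f fun i => ε ^ w i * y i) r d]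
  simp only [mul_zero, mul_div_assoc]

/-- The dilation `y ↦ (2 ^ w i * y i)`. -/
noncomputable def dilationTwo (w : Fin N → ℕ) : (Fin N → ℝ) ≃L[ℝ] (Fin N → ℝ) :=
  LinearEquiv.toContinuousLinearEquiv
    { toFun := fun y i => 2 ^ w i * y i
      invFun := fun y i => (2 ^ w i)⁻¹ * y i
      map_add' := fun x y => by
        funext i; simp only [Pi.add_apply]; ring
      map_smul' := fun r y => by
        funext i; simp only [Pi.smul_apply, smul_eq_mul, RingHom.id_apply]; ring
      left_inv := fun y => by
        funext i; simp
      right_inv := fun y => by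
        funext i; simp }

theorem dilationTwo_apply (w : Fin N → ℕ) (y : Fin N → ℝ) :
    dilationTwo w y = fun i => 2 ^ w i * y i := rfl

theorem dilationTwo_nilpotentPart {w : Fin N → ℕ} (hw : ∀ i, 1 ≤ w i)
    (Z : (Fin N → ℝ) → (Fin N → ℝ)) (y : Fin N → ℝ) :
    dilationTwo w (nilpotentPart w Z y) = (2 : ℝ) • nilpotentPart w Z (dilationTwo w y) := by
  funext j
  simp only [dilationTwo_apply, nilpotentPart, Pi.smul_apply, smul_eq_mul, homogPart_dilation]
  -- Positive weights keep the truncated subtraction `w j - 1` from spoiling the exponent.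
  rw [← mul_assoc, ← pow_succ', Nat.sub_add_cancel (hw j)]

variable {Dhat : (Fin N → ℝ) → Submodule ℝ (Fin N → ℝ)} {m : ℕ}
  {w : Fin N → ℕ} {Z : Fin m → (Fin N → ℝ) → (Fin N → ℝ)}

theorem map_dilationTwo_of_eq_span (hw : ∀ i, 1 ≤ w i)
    (h : ∀ y, Dhat y = Submodule.span ℝ (Set.range fun i => nilpotentPart w (Z i) y))
    (y : Fin N → ℝ) : Dhat (dilationTwo w y) =
      (Dhat y).map ((dilationTwo w : (Fin N → ℝ) →L[ℝ] (Fin N → ℝ)) : (Fin N → ℝ) →ₗ[ℝ] _) := by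
  rw [h, h, Submodule.map_span, ← Set.range_comp]
  refine le_antisymm (Submodule.span_le.2 ?_) (Submodule.span_le.2 ?_)
  · rintro _ ⟨i, rfl⟩
    have : nilpotentPart w (Z i) (dilationTwo w y) =
        (2 : ℝ)⁻¹ • dilationTwo w (nilpotentPart w (Z i) y) := by
      rw [dilationTwo_nilpotentPart hw, smul_smul]
      simp
    beta_reduce
    rw [this]
    exact Submodule.smul_mem _ _ (Submodule.subset_span ⟨i, rfl⟩)
  · rintro _ ⟨i, rfl⟩
    change dilationTwo w (nilpotentPart w (Z i) y) ∈ _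
    rw [dilationTwo_nilpotentPart hw]
    exact Submodule.smul_mem _ _ (Submodule.subset_span ⟨i, rfl⟩)

theorem dilationTwo_apply_of_mem_zero (hw : ∀ i, 1 ≤ w i)
    (h : ∀ y, Dhat y = Submodule.span ℝ (Set.range fun i => nilpotentPart w (Z i) y))
    {v : Fin N → ℝ} (hv : v ∈ Dhat 0) : dilationTwo w v = (2 : ℝ) • v := by
  rw [h] at hv
  induction hv using Submodule.span_induction with
  | mem v hv =>
    obtain ⟨i, rfl⟩ := hv
    have := dilationTwo_nilpotentPart hw (Z i) 0
    rwa [map_zero] at this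
  | zero => simp
  | add x y _ _ hx hy => rw [map_add, hx, hy, smul_add]
  | smul r x _ hx => rw [map_smul, hx, smul_comm]

theorem isGermIso_dilationTwo (hw : ∀ i, 1 ≤ w i)
    (h : ∀ y, Dhat y = Submodule.span ℝ (Set.range fun i => nilpotentPart w (Z i) y)) :
    IsGermIso n Dhat 0 Dhat 0 (dilationTwo w).toHomeomorph.toOpenPartialHomeomorph where
  mem_source := Set.mem_univ _
  map_eq := map_zero (dilationTwo w)
  contDiffOn := (dilationTwo w).contDiff.contDiffOn
  contDiffOn_symm := (dilationTwo w).symm.contDiff.contDiffOn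
  map_fderiv := fun x _ => by
    have : fderiv ℝ (dilationTwo w).toHomeomorph.toOpenPartialHomeomorph x =
      (dilationTwo w : (Fin N → ℝ) →L[ℝ] (Fin N → ℝ)) := (dilationTwo w).fderiv
    rw [this]
    exact map_dilationTwo_of_eq_span hw h x

end Homogeneous

/-! ### Symmetries acting as a homothety on the distribution at 0 -/

section Symmetry

variable {n : WithTop ℕ∞} {b c B C : ℝ}

theorem isSection_iterate_lieBracket (hn : n = ∞ ∨ n = ω) {X Y : (Fin 11 → ℝ) → (Fin 11 → ℝ)}
    {p : Fin 11 → ℝ} (hX : IsSection n (ekr1211 b c B C) p X)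
    (hY : IsSection n (ekr1211 b c B C) p Y) (d : ℕ) :
    IsSection n (ekrFlag b c B C d) p ((VectorField.lieBracket ℝ X)^[d] Y) := by
  induction d with
  | zero => exact isSection_ekrFlag_of_mem_smallFlag hn (Submodule.subset_span hY)
  | succ d ih =>
    rw [Function.iterate_succ_apply']
    exact isSection_ekrFlag_lieBracket hn hX ih

/-- Successive brackets pass the `x₅`-component of `Y` to `x₄`, `x₃` and `t`, and its `y₅`-component
to `y₄`, `y₃` and `y₂`, each time with a factor `-X₃`. The constants cancel when the components are
compared modulo the equations, so derivatives of `X` and `Y` never enter. -/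
theorem iterate_lieBracket_apply (hn : n = ∞ ∨ n = ω) {X Y : (Fin 11 → ℝ) → (Fin 11 → ℝ)}
    (hX : IsSection n (ekr1211 b c B C) 0 X) (hY : IsSection n (ekr1211 b c B C) 0 Y)
    (h9 : X 0 9 = 0) (h10 : X 0 10 = 0) :
    (VectorField.lieBracket ℝ X)^[3] Y 0 0 = -(X 0 3 ^ 3 * Y 0 9) ∧
      (VectorField.lieBracket ℝ X)^[3] Y 0 4 = -(X 0 3 ^ 3 * Y 0 10) := by
  have hn0 : n ≠ 0 := (lt_of_lt_of_le one_pos (natCast_le_of_infty_or_omega hn 1)).ne'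
  have key : ∀ (r : ℝ) (i k : Fin 11) (d : ℕ), (∀ᶠ y in 𝓝 0, X y i = (r + y k) * X y 3) →
      (∀ᶠ y in 𝓝 0, (VectorField.lieBracket ℝ X)^[d] Y y i =
        (r + y k) * (VectorField.lieBracket ℝ X)^[d] Y y 3) →
      (VectorField.lieBracket ℝ X)^[d + 1] Y 0 i -
        r * (VectorField.lieBracket ℝ X)^[d + 1] Y 0 3 =
      X 0 k * (VectorField.lieBracket ℝ X)^[d] Y 0 3 -
        (VectorField.lieBracket ℝ X)^[d] Y 0 k * X 0 3 := fun r i k d h h' => by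
    have := lieBracket_apply_of_pfaff r (hX.1.self_of_nhds.differentiableAt hn0)
      ((isSection_iterate_lieBracket hn hX hY d).1.self_of_nhds.differentiableAt hn0) h h'
    rw [Function.iterate_succ_apply', this]
    simp
  have e := hX.2.mono fun x hx => mem_ekr1211.1 hx
  have e' := fun d => (isSection_iterate_lieBracket hn hX hY d).2.mono fun x hx => mem_ekrFlag.1 hx
  obtain ⟨-, -, x0, x4, x5, x6, x7, x8⟩ := e.self_of_nhds
  simp only [Pi.zero_apply, zero_mul, add_zero] at x0 x4 x5 x6 x7 x8
  have k7 := key B 7 9 0 (e.mono fun x h => h.2.2.2.2.2.2.1)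
    ((e' 0).mono fun x h => (h.2.2.2 (by omega)).1)
  have k8 := key C 8 10 0 (e.mono fun x h => h.2.2.2.2.2.2.2)
    ((e' 0).mono fun x h => (h.2.2.2 (by omega)).2)
  have k5 := key b 5 7 1 (e.mono fun x h => h.2.2.2.2.1)
    ((e' 1).mono fun x h => (h.2.2.1 (by omega)).1)
  have k6 := key c 6 8 1 (e.mono fun x h => h.2.2.2.2.2.1)
    ((e' 1).mono fun x h => (h.2.2.1 (by omega)).2)
  have k0 := key 0 0 5 2 (e.mono fun x h => by simpa using h.2.2.1)
    ((e' 2).mono fun x h => by simpa using (h.2.1 (by omega)).1)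
  have k4 := key 0 4 6 2 (e.mono fun x h => by simpa using h.2.2.2.1)
    ((e' 2).mono fun x h => by simpa using (h.2.1 (by omega)).2)
  simp only [Function.iterate_zero, id_eq, zero_add, Nat.reduceAdd, zero_mul, sub_zero, h9, h10,
    x5, x6, x7, x8, zero_sub] at k7 k8 k5 k6 k0 k4
  constructor
  · rw [k0]
    linear_combination (-X 0 3) * k5 + X 0 3 ^ 2 * k7
  · rw [k4]
    linear_combination (-X 0 3) * k6 + X 0 3 ^ 2 * k8

/-- The equation `dy₁ = y₂ dt` turns the bracket into a product of a `t`- and a `y₂`-component, each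
of which contributes `r ^ 4`. Only values at 0 enter, so the fields may be images under a symmetry.
-/
theorem lieBracket_iterate_lieBracket_apply_two (hn : n = ∞ ∨ n = ω) {r : ℝ}
    {X Y Y' : (Fin 11 → ℝ) → (Fin 11 → ℝ)} (hX : IsSection n (ekr1211 b c B C) 0 X)
    (hY : IsSection n (ekr1211 b c B C) 0 Y) (hY' : IsSection n (ekr1211 b c B C) 0 Y')
    (hX0 : X 0 = r • ekrField b c B C 0) (hY0 : Y 0 = r • Pi.single 9 1)
    (hY0' : Y' 0 = r • Pi.single 10 1) :
    VectorField.lieBracket ℝ ((VectorField.lieBracket ℝ X)^[3] Y')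
      ((VectorField.lieBracket ℝ X)^[3] Y) 0 2 = r ^ 8 := by
  have hn0 : n ≠ 0 := (lt_of_lt_of_le one_pos (natCast_le_of_infty_or_omega hn 1)).ne'
  have s := isSection_iterate_lieBracket hn hX hY 3
  have s' := isSection_iterate_lieBracket hn hX hY' 3
  have h9 : X 0 9 = 0 := by simp [hX0, ekrField]
  have h10 : X 0 10 = 0 := by simp [hX0, ekrField]
  have h3 : X 0 3 = r := by simp [hX0, ekrField]
  obtain ⟨h1, h2⟩ := iterate_lieBracket_apply hn hX hY h9 h10
  obtain ⟨h1', h2'⟩ := iterate_lieBracket_apply hn hX hY' h9 h10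
  rw [lieBracket_apply_of_pfaff (i := 2) (j := 0) (k := 4) 0
    (s'.1.self_of_nhds.differentiableAt hn0) (s.1.self_of_nhds.differentiableAt hn0)
    (s'.2.mono fun x hx => by simpa using ((mem_ekrFlag.1 hx).1 (by omega)).2)
    (s.2.mono fun x hx => by simpa using ((mem_ekrFlag.1 hx).1 (by omega)).2),
    h1, h2, h1', h2', h3, hY0, hY0']
  simp
  ring

theorem inCoords_iterate_lieBracket (hn : n = ∞ ∨ n = ω) {N : ℕ}
    {D D' : (Fin N → ℝ) → Submodule ℝ (Fin N → ℝ)} {p p' : Fin N → ℝ}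
    {φ : OpenPartialHomeomorph (Fin N → ℝ) (Fin N → ℝ)} (h : IsGermIso n D p D' p' φ)
    {X Y : (Fin N → ℝ) → (Fin N → ℝ)} (hX : SmoothNear n X p) (hY : SmoothNear n Y p) (d : ℕ) :
    SmoothNear n ((VectorField.lieBracket ℝ X)^[d] Y) p ∧
    inCoords φ ((VectorField.lieBracket ℝ X)^[d] Y) =ᶠ[𝓝 p']
      (VectorField.lieBracket ℝ (inCoords φ X))^[d] (inCoords φ Y) := by
  induction d with
  | zero => exact ⟨hY, EventuallyEq.rfl⟩
  | succ d ih =>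
    simp only [Function.iterate_succ_apply']
    refine ⟨?_, ?_⟩
    · filter_upwards [hX, ih.1] with x k1 k2
      exact k1.lieBracket_vectorField k2 (add_one_le_of_infty_or_omega hn)
    · have h1 := lieBracket_inCoords hn h.contDiffOn h.contDiffOn_symm h.mem_source hX ih.1
      rw [h.map_eq] at h1
      exact h1.trans (EventuallyEq.rfl.lieBracket_vectorField ih.2)

/-- A symmetry of the pseudo-normal form which is a homothety on the distribution at 0 multiplies
the last coordinate of the small flag by the eighth power of the ratio. -/
theorem IsGermIso.fderiv_apply_two (hn : n = ∞ ∨ n = ω)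
    {ψ : OpenPartialHomeomorph (Fin 11 → ℝ) (Fin 11 → ℝ)}
    (h : IsGermIso n (ekr1211 b c B C) 0 (ekr1211 b c B C) 0 ψ) {r : ℝ}
    (hr : ∀ v ∈ ekr1211 b c B C 0, fderiv ℝ ψ 0 v = r • v) (v : Fin 11 → ℝ) :
    fderiv ℝ ψ 0 v 2 = r ^ 8 * v 2 := by
  have at0 : ∀ Y : (Fin 11 → ℝ) → (Fin 11 → ℝ), inCoords ψ Y 0 = fderiv ℝ ψ 0 (Y 0) := fun Y => by
    have := inCoords_apply_map Y h.mem_source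
    rwa [h.map_eq] at this
  -- The hyperplane where the `y₁`-component vanishes is `V₅(0)` for all values of the constants,
  -- hence preserved by every symmetry.
  have pres : ∀ v : Fin 11 → ℝ, v 2 = 0 → fderiv ℝ ψ 0 v 2 = 0 := fun v hv => by
    have hmem : v ∈ smallFlagAt n (ekr1211 b c B C) 0 4 := by
      rw [← (ekrBasis b c B C).sum_repr v]
      refine Submodule.sum_mem _ fun j _ => ?_
      rcases eq_or_ne j 10 with rfl | hj
      · have : (ekrBasis b c B C).repr v 10 = v 2 := rfl
        rw [this, hv, zero_smul]
        exact Submodule.zero_mem _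
      · refine Submodule.smul_mem _ _ (smallFlagAt_mono ?_ (ekrBasis_mem_smallFlagAt j))
        revert j
        decide
    obtain ⟨Y, hY, rfl⟩ := hmem
    have := apply_two_eq_zero_of_mem_smallFlag (m := 1) (j := 0) hn (by omega) (by omega) (by omega)
      one_pos (h.inCoords_mem_smallFlag hn 4 ⟨Y, hY, rfl⟩)
    rw [inCoordsLinear_apply, at0] at this
    exact this
  have hX := isSection_ekrField (n := n) (b := b) (c := c) (B := B) (C := C) 0
  have hY := isSection_single (n := n) (b := b) (c := c) (B := B) (C := C) (le_refl 9) 0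
  have hY' := isSection_single (n := n) (b := b) (c := c) (B := B) (C := C) (k := 10) (by decide) 0
  have t := inCoords_iterate_lieBracket hn h hX.1 hY.1 3
  have t' := inCoords_iterate_lieBracket hn h hX.1 hY'.1 3
  -- `U` spans the quotient by that hyperplane. Its image under the symmetry is the same bracket of
  -- the image fields, whose values at 0 are `r` times the original ones.
  set U := VectorField.lieBracket ℝ
    ((VectorField.lieBracket ℝ (ekrField b c B C))^[3] fun _ => Pi.single 10 1)
    ((VectorField.lieBracket ℝ (ekrField b c B C))^[3] fun _ => Pi.single 9 1) with hU
  have u1 : U 0 2 = 1 := by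
    rw [hU, lieBracket_iterate_lieBracket_apply_two (r := 1) hn hX hY hY' (by simp) (by simp)
      (by simp), one_pow]
  have u2 : fderiv ℝ ψ 0 (U 0) 2 = r ^ 8 := by
    have h1 := lieBracket_inCoords hn h.contDiffOn h.contDiffOn_symm h.mem_source t'.1 t.1
    rw [h.map_eq] at h1
    rw [← at0, hU, (h1.trans (t'.2.lieBracket_vectorField t.2)).self_of_nhds]
    refine lieBracket_iterate_lieBracket_apply_two hn (h.isSection hn hX) (h.isSection hn hY)
      (h.isSection hn hY') ?_ ?_ ?_
    · rw [at0, hr _ hX.2.self_of_nhds]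
    · rw [at0, hr _ hY.2.self_of_nhds]
    · rw [at0, hr _ hY'.2.self_of_nhds]
  have h3 := pres (v - v 2 • U 0) (by simp [u1])
  rw [map_sub, map_smul, Pi.sub_apply, Pi.smul_apply, u2, smul_eq_mul] at h3
  linarith

/-- The dilation of the nilpotent approximation, conjugated to a symmetry of the pseudo-normal form,
acts by `2 ^ 8` modulo a hyperplane. Its eigenvalues are the `2 ^ w i`, so some weight is 8. -/
theorem StronglyNilpotent.exists_weights (hn : n = ∞ ∨ n = ω)
    (h : StronglyNilpotent n (ekr1211 b c B C) 0) :
    ∃ w : Fin 11 → ℕ, IsWeights n (ekr1211 b c B C) 0 w ∧ ∃ i, w i = 8 := by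
  have hn1 : 1 ≤ n := natCast_le_of_infty_or_omega hn 1
  have hn0 : n ≠ 0 := (lt_of_lt_of_le one_pos hn1).ne'
  obtain ⟨Dhat, ⟨m, X, w, z, -, ⟨hw, -⟩, hD⟩, he⟩ := h
  obtain ⟨φ, hφ⟩ := germEquiv_iff_exists_isGermIso.1 he
  have hw1 := fun i => (hw i).1
  set δ := dilationTwo w with hδ
  have hs := hφ.symm hn1
  have hψ := hφ.trans hn1 ((isGermIso_dilationTwo hw1 hD).trans hn1 hs)
  have hfd : ∀ v, fderiv ℝ (φ.trans (δ.toHomeomorph.toOpenPartialHomeomorph.trans φ.symm)) 0 v =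
      fderiv ℝ φ.symm 0 (δ (fderiv ℝ φ 0 v)) := fun v => by
    have h1 := ((hφ.contDiffOn.contDiffAt (φ.open_source.mem_nhds hφ.mem_source)).differentiableAt
      hn0).hasFDerivAt
    have h2 : HasFDerivAt δ (δ : (Fin 11 → ℝ) →L[ℝ] (Fin 11 → ℝ)) (φ 0) := δ.hasFDerivAt
    have h3 := ((hs.contDiffOn.contDiffAt (φ.symm.open_source.mem_nhds hs.mem_source)).differentiableAt
      hn0).hasFDerivAt
    have h4 : HasFDerivAt φ.symm (fderiv ℝ φ.symm 0) (δ (φ 0)) := by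
      rw [hφ.map_eq, map_zero]
      exact h3
    exact congrArg (fun L : (Fin 11 → ℝ) →L[ℝ] (Fin 11 → ℝ) => L v) (h4.comp 0 (h2.comp 0 h1)).fderiv
  have hinv : ∀ v, fderiv ℝ φ.symm 0 (fderiv ℝ φ 0 v) = v := fun v => by
    have := fderiv_symm_fderiv_of_contDiffOn hn1 hφ.contDiffOn hφ.contDiffOn_symm hφ.mem_source v
    rwa [hφ.map_eq] at this
  have hinv' : ∀ v, fderiv ℝ φ 0 (fderiv ℝ φ.symm 0 v) = v := fun v => by
    have := fderiv_fderiv_symm_of_contDiffOn hn1 hφ.contDiffOn hφ.contDiffOn_symm hφ.mem_source v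
    rwa [hφ.map_eq] at this
  have key := hψ.fderiv_apply_two hn (r := 2) fun v hv => by
    have hmem : fderiv ℝ φ 0 v ∈ Dhat 0 := by
      have := hφ.map_fderiv 0 hφ.mem_source
      rw [hφ.map_eq] at this
      rw [this]
      exact ⟨v, hv, rfl⟩
    rw [hfd, hδ, dilationTwo_apply_of_mem_zero hw1 hD hmem, map_smul, hinv]
  refine ⟨w, hw, ?_⟩
  by_contra hne
  push Not at hne
  -- The preimage of the `i`-th basis vector is an eigenvector with eigenvalue `2 ^ w i`. If this is
  -- not `2 ^ 8`, its `y₁`-component is 0; but not all vectors have `y₁`-component 0.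
  have hzero : ∀ i : Fin 11, fderiv ℝ φ.symm 0 (Pi.single i 1) 2 = 0 := fun i => by
    have h1 := key (fderiv ℝ φ.symm 0 (Pi.single i 1))
    have h2 : δ (Pi.single i 1) = (2 : ℝ) ^ w i • Pi.single i 1 := by
      funext j
      rw [hδ, dilationTwo_apply]
      rcases eq_or_ne j i with rfl | hj
      · simp
      · simp [hj]
    rw [hfd, hinv', h2, map_smul, Pi.smul_apply, smul_eq_mul] at h1
    have h3 : (2 : ℝ) ^ w i ≠ 2 ^ 8 := fun h =>
      hne i (pow_right_injective₀ (by norm_num) (by norm_num) h)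
    have h4 : ((2 : ℝ) ^ w i - 2 ^ 8) * fderiv ℝ φ.symm 0 (Pi.single i 1) 2 = 0 := by
      linear_combination h1
    exact (mul_eq_zero.1 h4).resolve_left (sub_ne_zero.2 h3)
  have h1 : fderiv ℝ φ.symm 0 (fderiv ℝ φ 0 (Pi.single 2 1)) 2 = 0 := by
    rw [← Finset.univ_sum_single (fderiv ℝ φ 0 (Pi.single 2 1)), map_sum, Finset.sum_apply]
    refine Finset.sum_eq_zero fun i _ => ?_
    have : ∀ a : ℝ, (Pi.single i a : Fin 11 → ℝ) = a • Pi.single i 1 := fun a => by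
      rw [← Pi.single_smul, smul_eq_mul, mul_one]
    rw [this, map_smul, Pi.smul_apply, hzero, smul_zero]
  rw [hinv] at h1
  simp at h1

/-- Counting from 0, dimension 11 at an index `s ≤ 6` bounds every weight by 7. -/
theorem not_stronglyNilpotent_ekr1211 (hn : n = ∞ ∨ n = ω) {s : ℕ} (hs : s ≤ 6)
    (h : smallGrowth n (ekr1211 b c B C) 0 s = 11) :
    ¬ StronglyNilpotent n (ekr1211 b c B C) 0 := fun hE => by
  obtain ⟨w, hw, i, hi⟩ := hE.exists_weights hn
  have := ((hw i).2 s).2 (h.symm ▸ i.2)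
  omega

end Symmetry

/-! ### The three parts of the class and their pseudo-normal forms -/

section Classification

variable {n : WithTop ℕ∞} {D : (Fin 11 → ℝ) → Submodule ℝ (Fin 11 → ℝ)} {p : Fin 11 → ℝ}

theorem GermEquiv.smallGrowth_eq (hn : n = ∞ ∨ n = ω) {N : ℕ}
    {D D' : (Fin N → ℝ) → Submodule ℝ (Fin N → ℝ)} {p p' : Fin N → ℝ}
    (h : GermEquiv n D p D' p') : smallGrowth n D p = smallGrowth n D' p' := by
  obtain ⟨φ, hφ⟩ := germEquiv_iff_exists_isGermIso.1 h
  exact hφ.smallGrowth_eq hn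

theorem GermEquiv.stronglyNilpotent_iff (hn : n = ∞ ∨ n = ω) {N : ℕ}
    {D D' : (Fin N → ℝ) → Submodule ℝ (Fin N → ℝ)} {p p' : Fin N → ℝ}
    (h : GermEquiv n D p D' p') : StronglyNilpotent n D p ↔ StronglyNilpotent n D' p' := by
  obtain ⟨φ, hφ⟩ := germEquiv_iff_exists_isGermIso.1 h
  exact ⟨(hφ.symm (natCast_le_of_infty_or_omega hn 1)).stronglyNilpotent hn,
    hφ.stronglyNilpotent hn⟩

theorem inPart1_of_germEquiv (hn : n = ∞ ∨ n = ω) (hD : InClass1211 n D p) {b c B C : ℝ}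
    (h : (b, c) ≠ (0, 0)) (he : GermEquiv n D p (ekr1211 b c B C) 0) : InPart1 n D p := by
  refine ⟨hD, ?_⟩
  rw [he.smallGrowth_eq hn, smallGrowth_ekr1211_of_ne hn]
  by_contra! h'
  exact h (by rw [h'.1, h'.2])

theorem inPart2_of_germEquiv (hn : n = ∞ ∨ n = ω) (hD : InClass1211 n D p) {B C : ℝ}
    (h : (B, C) ≠ (0, 0)) (he : GermEquiv n D p (ekr1211 0 0 B C) 0) : InPart2 n D p := by
  refine ⟨hD, ?_⟩
  rw [he.smallGrowth_eq hn, smallGrowth_ekr1211_zero_of_ne hn]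
  by_contra! h'
  exact h (by rw [h'.1, h'.2])

theorem inPart3_of_germEquiv (hn : n = ∞ ∨ n = ω) (hD : InClass1211 n D p)
    (he : GermEquiv n D p (ekr1211 0 0 0 0) 0) : InPart3 n D p := by
  refine ⟨hD, ?_⟩
  rw [he.smallGrowth_eq hn]
  simp [List.range_succ, smallGrowth_ekr1211_zero hn]

theorem InPart1.smallGrowth_five (h : InPart1 n D p) : smallGrowth n D p 5 = 11 := by
  simpa [List.range_succ] using congrArg (fun l => l.getD 5 0) h.2

theorem InPart2.smallGrowth_five (h : InPart2 n D p) : smallGrowth n D p 5 = 10 := by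
  simpa [List.range_succ] using congrArg (fun l => l.getD 5 0) h.2

theorem InPart2.smallGrowth_six (h : InPart2 n D p) : smallGrowth n D p 6 = 11 := by
  simpa [List.range_succ] using congrArg (fun l => l.getD 6 0) h.2

theorem InPart3.smallGrowth_five (h : InPart3 n D p) : smallGrowth n D p 5 = 10 := by
  simpa [List.range_succ] using congrArg (fun l => l.getD 5 0) h.2

theorem InPart3.smallGrowth_six (h : InPart3 n D p) : smallGrowth n D p 6 = 10 := by
  simpa [List.range_succ] using congrArg (fun l => l.getD 6 0) h.2

theorem InClass1211.exists_germEquiv_and_inPart (hn : n = ∞ ∨ n = ω) (hD : InClass1211 n D p) :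
    ∃ b c B C : ℝ, GermEquiv n D p (ekr1211 b c B C) 0 ∧
      (InPart1 n D p ∧ (b, c) ≠ (0, 0) ∨
        InPart2 n D p ∧ (b = 0 ∧ c = 0) ∧ (B, C) ≠ (0, 0) ∨
        InPart3 n D p ∧ (b = 0 ∧ c = 0) ∧ B = 0 ∧ C = 0) := by
  obtain ⟨b, c, B, C, he⟩ := hD.exists_germEquiv_ekr1211 hn
  refine ⟨b, c, B, C, he, ?_⟩
  by_cases h : (b, c) = (0, 0)
  · obtain ⟨rfl, rfl⟩ := Prod.mk.inj h
    by_cases h' : (B, C) = (0, 0)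
    · obtain ⟨rfl, rfl⟩ := Prod.mk.inj h'
      exact .inr (.inr ⟨inPart3_of_germEquiv hn hD he, ⟨rfl, rfl⟩, rfl, rfl⟩)
    · exact .inr (.inl ⟨inPart2_of_germEquiv hn hD h' he, ⟨rfl, rfl⟩, h'⟩)
  · exact .inl ⟨inPart1_of_germEquiv hn hD h he, h⟩

end Classification

theorem mainTheorem8 (n : WithTop ℕ∞) (hn : n = ∞ ∨ n = ω)
    (D : (Fin 11 → ℝ) → Submodule ℝ (Fin 11 → ℝ)) (p : Fin 11 → ℝ) (hD : InClass1211 n D p) :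
    (InPart1 n D p ∨ InPart2 n D p ∨ InPart3 n D p) ∧
    (InPart1 n D p ↔ ∃ b c B C : ℝ, (b, c) ≠ (0, 0) ∧ GermEquiv n D p (ekr1211 b c B C) 0) ∧
    (InPart2 n D p ↔ ∃ B C : ℝ, (B, C) ≠ (0, 0) ∧ GermEquiv n D p (ekr1211 0 0 B C) 0) ∧
    (InPart3 n D p ↔ GermEquiv n D p (ekr1211 0 0 0 0) 0) ∧
    (InPart3 n D p → StronglyNilpotent n D p) ∧
    (InPart1 n D p → ¬ StronglyNilpotent n D p) ∧
    (InPart2 n D p → ¬ StronglyNilpotent n D p) := by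
  obtain ⟨b, c, B, C, he, h⟩ := hD.exists_germEquiv_and_inPart hn
  -- Disjointness: the entry with index 5 of the growth vector separates the first part from the
  -- others, and the entry with index 6 separates the second from the third.
  have h12 : InPart1 n D p → InPart2 n D p → False := fun h1 h2 => by
    have := h1.smallGrowth_five.symm.trans h2.smallGrowth_five
    omega
  have h13 : InPart1 n D p → InPart3 n D p → False := fun h1 h2 => by
    have := h1.smallGrowth_five.symm.trans h2.smallGrowth_five
    omega
  have h23 : InPart2 n D p → InPart3 n D p → False := fun h1 h2 => by
    have := h1.smallGrowth_six.symm.trans h2.smallGrowth_six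
    omega
  have h3 : InPart3 n D p → GermEquiv n D p (ekr1211 0 0 0 0) 0 := fun hp => by
    rcases h with ⟨h1, -⟩ | ⟨h2, -⟩ | ⟨-, ⟨rfl, rfl⟩, rfl, rfl⟩
    · exact (h13 h1 hp).elim
    · exact (h23 h2 hp).elim
    · exact he
  refine ⟨?_, ⟨fun hp => ?_, fun ⟨b, c, B, C, h0, he⟩ => inPart1_of_germEquiv hn hD h0 he⟩,
    ⟨fun hp => ?_, fun ⟨B, C, h0, he⟩ => inPart2_of_germEquiv hn hD h0 he⟩,
    ⟨h3, inPart3_of_germEquiv hn hD⟩, fun hp => ?_, fun hp => ?_, fun hp => ?_⟩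
  · rcases h with h | h | h
    exacts [.inl h.1, .inr (.inl h.1), .inr (.inr h.1)]
  · rcases h with ⟨-, h1⟩ | ⟨h2, -⟩ | ⟨h2, -⟩
    · exact ⟨b, c, B, C, h1, he⟩
    · exact (h12 hp h2).elim
    · exact (h13 hp h2).elim
  · rcases h with ⟨h1, -⟩ | ⟨-, ⟨rfl, rfl⟩, h2⟩ | ⟨h2, -⟩
    · exact (h12 h1 hp).elim
    · exact ⟨B, C, h2, he⟩
    · exact (h23 hp h2).elim
  · exact ((h3 hp).stronglyNilpotent_iff hn).2 (stronglyNilpotent_ekr1211_zero hn)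
  · rw [he.stronglyNilpotent_iff hn]
    exact not_stronglyNilpotent_ekr1211 hn (s := 5) (by omega)
      (he.smallGrowth_eq hn ▸ hp.smallGrowth_five)
  · rw [he.stronglyNilpotent_iff hn]
    exact not_stronglyNilpotent_ekr1211 hn (s := 6) le_rfl
      (he.smallGrowth_eq hn ▸ hp.smallGrowth_six)
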